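/- **Setting.** Let $V=\{1,\dots,N\}$ with $N\ge 1$, let $\omega_{\{x,y\}}\ge 0$ be symmetric conductances with $\omega_{\{x,x\}}=0$ such that the graph with edges $\{x,y\}$, $\omega_{\{x,y\}}>0$, is connected, and let $\alpha_x\in\{1,2,\dots\}$ for $x\in V$. Let $\omega_L,\omega_R\ge 0$, $\alpha_L,\alpha_R>0$, let $\sigma\in\{-1,0,1\}$, and let $\theta_L,\theta_R\in\varTheta$, where $\varTheta=[0,1]$ if $\sigma=-1$ and $\varTheta=[0,\infty)$ otherwise. Let $\mathcal X=\prod_{x\in V}\{0,\dots,\alpha_x\}$ if $\sigma=-1$ and $\mathcal X=\mathbb N_0^V$ otherwise. Consider the Markov jump process $\{\eta_t:t\ge 0\}$ on $\mathcal X$ (SEP for $\sigma=-1$, IRW for $\sigma=0$, SIP for $\sigma=1$) with generator $$\mathcal L f(\eta)=\sum_{\{x,y\}}\omega_{\{x,y\}}\Big[\eta(x)(\alpha_y+\sigma\eta(y))\big(f(\eta-\delta_x+\delta_y)-f(\eta)\big)+\eta(y)(\alpha_x+\sigma\eta(x))\big(f(\eta-\delta_y+\delta_x)-f(\eta)\big)\Big]+\omega_L\mathcal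 L_Lf(\eta)+\omega_R\mathcal L_Rf(\eta),$$ $$\mathcal L_Lf(\eta)=\eta(1)\,\alpha_L(1+\sigma\theta_L)\big(f(\eta-\delta_1)-f(\eta)\big)+\alpha_L\theta_L(\alpha_1+\sigma\eta(1))\big(f(\eta+\delta_1)-f(\eta)\big),$$ and $\mathcal L_R$ defined in the same way with $N,\alpha_R,\theta_R$ in place of $1,\alpha_L,\theta_L$. **Theorem.** Assume $\omega_L\vee\omega_R>0$. Then there exists a unique stationary probability measure $\mu=\mu_{\theta_L,\theta_R}$ for $\{\eta_t:t\ge0\}$, and for every probability measure $\mu'$ on $\mathcal X$ and every bounded $f:\mathcal X\to\mathbb R$, $\lim_{t\to\infty}\mathbb E_{\mu'}[f(\eta_t)]=\mathbb E_\mu[f(\eta)]$. The profile $\bar\theta_x:=\mathbb E_\mu[\eta(x)/\alpha_x]$, $x\in V$, is finite and solves, for all $x\in V$, $$\sum_{y\in V}\omega_{\{x,y\}}\alpha_y(\bar\theta_y-\bar\theta_x)+\mathbf 1_{\{x=1\}}\omega_L\alpha_L(\theta_L-\bar\theta_1)+\mathbf 1_{\{x=N\}}\omega_R\alpha_R(\theta_R-\bar\theta_N)=0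 .$$ Moreover: (a) If $\sigma=0$ (IRW), then $\mu$ is the product measure $\bigotimes_{x\in V}\mathrm{Poisson}(\alpha_x\bar\theta_x)$ (the local equilibrium product measure). (b) If $\sigma\in\{-1,1\}$ (SEP or SIP), $\omega_L,\omega_R>0$, $\theta_L\ne\theta_R$ and $N\ge 2$, then there exist $x\ne y$ in $V$ with $$\mathbb E_\mu\left[\left(\frac{\eta(x)}{\alpha_x}-\bar\theta_x\right)\left(\frac{\eta(y)}{\alpha_y}-\bar\theta_y\right)\right]\ne 0$$ (the expectation being well defined), and $\mu$ is not a product measure over the sites of $V$. -/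

import Mathlib

open MeasureTheory ProbabilityTheory Filter Topology
open scoped ENNReal NNReal

noncomputable section

/-- The data of a boundary driven particle system on the sites `V = {1, …, N}` (here `Fin N`):
the type of interaction `σ` (`-1`: symmetric partial exclusion SEP, `0`: independent random
walkers IRW, `1`: symmetric inclusion SIP), symmetric conductances `ω` whose graph is connected,
site parameters `α` (positive integers), and the parameters of the left and right reservoirs. -/
structure BoundaryDrivenSystem (N : ℕ) where
  σ : ℤ
  σ_mem : σ = -1 ∨ σ = 0 ∨ σ = 1
  N_pos : 0 < N
  ω : Fin N → Fin N → ℝ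
  ω_nonneg : ∀ x y, 0 ≤ ω x y
  ω_symm : ∀ x y, ω x y = ω y x
  ω_self : ∀ x, ω x x = 0
  connected : (SimpleGraph.fromRel (fun x y : Fin N => ω x y ≠ 0)).Connected
  α : Fin N → ℕ
  α_pos : ∀ x, 0 < α x
  ωL : ℝ
  ωR : ℝ
  ωL_nonneg : 0 ≤ ωL
  ωR_nonneg : 0 ≤ ωR
  αL : ℝ
  αR : ℝ
  αL_pos : 0 < αL
  αR_pos : 0 < αR
  θL : ℝ
  θR : ℝ
  θL_nonneg : 0 ≤ θL
  θR_nonneg : 0 ≤ θR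
  θL_le_one : σ = -1 → θL ≤ 1
  θR_le_one : σ = -1 → θR ≤ 1

namespace BoundaryDrivenSystem

variable {N : ℕ} (S : BoundaryDrivenSystem N)

/-- The site `1`, in contact with the left reservoir. -/
def first : Fin N := ⟨0, S.N_pos⟩

/-- The site `N`, in contact with the right reservoir. -/
def last : Fin N := ⟨N - 1, Nat.sub_lt S.N_pos Nat.one_pos⟩

/-- The configuration space: `∏ₓ {0, …, αₓ}` if `σ = -1`, and `ℕ₀ ^ V` otherwise. -/
abbrev Config : Type := {η : Fin N → ℕ // S.σ = -1 → ∀ x, η x ≤ S.α x}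

variable {S} in
/-- `ζ` if it is a configuration of the system, else `η`. -/
def moveTo (η : S.Config) (ζ : Fin N → ℕ) : S.Config :=
  open Classical in if h : S.σ = -1 → ∀ x, ζ x ≤ S.α x then ⟨ζ, h⟩ else η

variable {S} in
/-- `η^{x,-}`: a particle (if any) is removed from `x`. -/
def remove (η : S.Config) (x : Fin N) : S.Config :=
  moveTo η (Function.update η.1 x (η.1 x - 1))

variable {S} in
/-- `η^{x,+}`: a particle is added at `x` (if this is allowed; otherwise the rate vanishes). -/
def insert (η : S.Config) (x : Fin N) : S.Config :=
  moveTo η (Function.update η.1 x (η.1 x + 1))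

variable {S} in
/-- `η^{x,y} = η - δₓ + δ_y`: a particle (if any) is moved from `x` to `y`
(if this is allowed; otherwise the rate vanishes). -/
def hop (η : S.Config) (x y : Fin N) : S.Config :=
  if η.1 x = 0 then η else moveTo η (η.1 - Pi.single x 1 + Pi.single y 1)

/-- The single-bond generator `ℒ_{x,y}`. -/
def genBond (x y : Fin N) (f : S.Config → ℝ) (η : S.Config) : ℝ :=
  (η.1 x : ℝ) * (S.α y + S.σ * η.1 y) * (f (hop η x y) - f η)
    + (η.1 y : ℝ) * (S.α x + S.σ * η.1 x) * (f (hop η y x) - f η)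

/-- The generator of the exchanges between the site `x` and a reservoir with parameters
`a` (`αL` or `αR`) and `θ` (`θL` or `θR`). -/
def genReservoir (x : Fin N) (a θ : ℝ) (f : S.Config → ℝ) (η : S.Config) : ℝ :=
  (η.1 x : ℝ) * (a + S.σ * a * θ) * (f (remove η x) - f η)
    + a * θ * (S.α x + S.σ * η.1 x) * (f (insert η x) - f η)

/-- The infinitesimal generator `ℒ`; the bulk sum runs over unordered pairs of sites. -/
def gen (f : S.Config → ℝ) (η : S.Config) : ℝ :=
  (∑ x : Fin N, ∑ y ∈ Finset.Ioi x, S.ω x y * S.genBond x y f η)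
    + (S.ωL * S.genReservoir S.first S.αL S.θL f η
      + S.ωR * S.genReservoir S.last S.αR S.θR f η)

/-- The jump rate from `η` to `ζ ≠ η`, i.e. the off-diagonal entry `ℒ 1_ζ (η)` of the generator. -/
def jumpRate (η ζ : S.Config) : ℝ≥0∞ :=
  if ζ = η then 0 else ENNReal.ofReal (S.gen (Set.indicator {ζ} 1) η)

/-- The total jump rate out of `η`, i.e. minus the diagonal entry `ℒ 1_η (η)` of the generator. -/
def exitRate (η : S.Config) : ℝ := - S.gen (Set.indicator {η} 1) η

/-- The probability that the Markov jump process with generator `ℒ` started from `η` is in `ζ` at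
time `t` having made fewer than `n` jumps: either it has not jumped by time `t`, or it has first
jumped at a time `s ≤ t`, to some `η'`, and makes fewer than `n - 1` jumps in the remaining time. -/
def transIter : ℕ → ℝ → S.Config → S.Config → ℝ≥0∞
  | 0, _, _, _ => 0
  | n + 1, t, η, ζ =>
      (if η = ζ then ENNReal.ofReal (Real.exp (-(S.exitRate η * t))) else 0)
        + ∫⁻ s in Set.Icc 0 t, ENNReal.ofReal (Real.exp (-(S.exitRate η * s)))
            * ∑' η' : S.Config, S.jumpRate η η' * transIter n (t - s) η' ζ

/-- The transition probability `ℙ_η(η_t = ζ)`, `t ≥ 0`, of the Markov jump process `{η_t : t ≥ 0}`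
with generator `ℒ`. -/
def transProb (t : ℝ) (η ζ : S.Config) : ℝ≥0∞ := ⨆ n, S.transIter n t η ζ

/-- The transition kernel at time `t`: the law of `η_t` as a function of the starting point. -/
def transKernel (t : ℝ) : Kernel S.Config S.Config where
  toFun η := Measure.sum fun ζ => S.transProb t η ζ • Measure.dirac ζ
  measurable' := Measurable.of_discrete

/-- The law of `η_t` when `η_0` is distributed according to `μ`. -/
def law (μ : Measure S.Config) (t : ℝ) : Measure S.Config := μ.bind (S.transKernel t)

/-- `μ` is a stationary (probability) measure of the particle system. -/
def IsStationary (μ : Measure S.Config) : Prop :=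
  IsProbabilityMeasure μ ∧ ∀ t : ℝ, 0 ≤ t → S.law μ t = μ

/-- Started from any initial distribution, the expectations of bounded functions of the particle
system converge to those under `μ`. -/
def AttractsAll (μ : Measure S.Config) : Prop :=
  ∀ f : S.Config → ℝ, (∃ C, ∀ η, |f η| ≤ C) →
    ∀ μ' : Measure S.Config, IsProbabilityMeasure μ' →
      Tendsto (fun t : ℝ => ∫ η, f η ∂(S.law μ' t)) atTop (𝓝 (∫ η, f η ∂μ))

/-- The profile `θ̄ₓ = 𝔼_μ[η(x) / αₓ]`. -/
def profile (μ : Measure S.Config) (x : Fin N) : ℝ := ∫ η, (η.1 x : ℝ) / S.α x ∂μ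

/-- The difference equations that characterize the stationary profile. -/
def SolvesProfileEquations (θ : Fin N → ℝ) : Prop :=
  ∀ x, (∑ y, S.ω x y * S.α y * (θ y - θ x))
    + (if x = S.first then S.ωL * S.αL * (S.θL - θ x) else 0)
    + (if x = S.last then S.ωR * S.αR * (S.θR - θ x) else 0) = 0

/-- `μ` is the product over the sites of the measures `ν x` on `ℕ₀`. -/
def IsProductOf (μ : Measure S.Config) (ν : Fin N → Measure ℕ) : Prop :=
  μ.map Subtype.val = Measure.pi ν

end BoundaryDrivenSystem

end

noncomputable section

namespace BoundaryDrivenSystem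

variable {N : ℕ} (S : BoundaryDrivenSystem N)

/-! ### The generator as a finite sum over elementary moves -/

/-! Everything rests on one cancellation. In the drift of a linear function of the configuration,
the interaction terms `σ η(x) η(y)` are antisymmetric along bonds and vanish, so for all three
values of `σ` the drift is that of a single dual particle that walks on the sites and is absorbed at
the reservoirs (`sum_rate_mul_sum_disp`, `oneParticle`). Connectedness and one active reservoir make
this operator invertible, and its solution `h` of `oneParticle h = -1`, the mean absorption time, is
strictly positive.

Lyapunov function. Bulk moves conserve the number `n` of particles, so `V η = n ^ 2 * ∑ z, η z * h
z` has drift at most `-n ^ 3` plus terms of order `n ^ 2` and a constant (`exists_isLyapunov`). The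
cubic order is forced by the second moments: quadratic rates times the linear increments of `η x * η
y` must be integrable.

Ergodicity. The process is the minimal solution of the backward equation, hence lies below every
supersolution (`evol_le_of_supersolution`). With `V` this gives conservation of mass, the semigroup
property and moment bounds uniform in time. The empty configuration, or the full one when particles
cannot be removed at the chosen reservoir, is charged at time one from every starting point. On the
finite sublevel sets of `V` this is a minorization, and Harris' theorem follows by contraction of a
weighted oscillation (`exists_contraction`, `exists_limit`, `exists_attracting`).

Moments. A stationary measure with third moments satisfies `∫ gen f = 0` for every `f` with linearly
growing increments (`integral_gen_of_growth`). Coordinates give the profile equations, products of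
two coordinates give `second_moment_equation`.

(a) For `σ = 0`, Mecke's formula reduces `∫ gen g` under a product of Poisson laws to a combination
of the quantities `E g(η + δ_x) - E g(η)`, whose coefficients are the profile equations. The product
is therefore stationary, and uniqueness identifies it with the measure already found.

(b) If distinct sites were uncorrelated, the diagonal second moment equations would force the
variance at `x` to be `α_x θ_x (1 + σ θ_x)`, and the equation for a bond would become `ω α_x α_y σ
(θ_x - θ_y)^2 = 0` (`profile_eq_of_uncorrelated`). The profile would be constant, and the profile
equations at the two ends would give `θL = θR`. -/

/-- The elementary moves: a jump from `x` to `y`, or an exchange with a reservoir (`false`: left,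
`true`: right), which is a removal (`true`) or an insertion (`false`). -/
abbrev Move (N : ℕ) : Type := (Fin N × Fin N) ⊕ (Bool × Bool)

/-- The site in contact with a reservoir. -/
def resSite : Bool → Fin N
  | false => S.first
  | true => S.last

/-- The strength of the coupling to a reservoir, including its parameter `α`. -/
def resRate : Bool → ℝ
  | false => S.ωL * S.αL
  | true => S.ωR * S.αR

/-- The density parameter of a reservoir. -/
def resDensity : Bool → ℝ
  | false => S.θL
  | true => S.θR

/-- The rate of an elementary move. -/
def rate : Move N → S.Config → ℝ
  | .inl (x, y), η => S.ω x y * ((η.1 x : ℝ) * (S.α y + S.σ * η.1 y))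
  | .inr (b, true), η => S.resRate b * ((η.1 (S.resSite b) : ℝ) * (1 + S.σ * S.resDensity b))
  | .inr (b, false), η =>
      S.resRate b * (S.resDensity b * (S.α (S.resSite b) + S.σ * η.1 (S.resSite b)))

variable {S} in
/-- The configuration after an elementary move. -/
def target : Move N → S.Config → S.Config
  | .inl (x, y), η => hop η x y
  | .inr (b, true), η => remove η (S.resSite b)
  | .inr (b, false), η => insert η (S.resSite b)

/-- The change of the number of particles at `z` in an elementary move. -/
def disp : Move N → Fin N → ℝ
  | .inl (x, y), z => (if z = y then 1 else 0) - (if z = x then 1 else 0)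
  | .inr (b, true), z => - (if z = S.resSite b then 1 else 0)
  | .inr (b, false), z => if z = S.resSite b then 1 else 0

lemma sum_pairs_Ioi {h : Fin N → Fin N → ℝ} (h0 : ∀ x, h x x = 0) :
    ∑ x, ∑ y ∈ Finset.Ioi x, (h x y + h y x) = ∑ x, ∑ y, h x y := by
  have h1 := Finset.sum_sum_Ioi_add_eq_sum_sum_off_diag (fun x y => h y x)
  rw [h1]
  refine Finset.sum_congr rfl fun x _ => ?_
  rw [← Finset.sum_add_sum_compl {x} (fun y => h x y)]
  simp [h0]

/-- The two terms of a bond are the two ordered pairs of its endpoints, so the sum over unordered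
bonds unfolds into one over ordered pairs; the diagonal is harmless because `ω x x = 0`. All later
computations with the generator start from this form. -/
lemma gen_eq_sum (f : S.Config → ℝ) (η : S.Config) :
    S.gen f η = ∑ m, S.rate m η * (f (target m η) - f η) := by
  rw [Fintype.sum_sum_type, Fintype.sum_prod_type, Fintype.sum_prod_type, Fintype.sum_bool,
    Fintype.sum_bool, Fintype.sum_bool, gen,
    ← sum_pairs_Ioi (h := fun x y => S.rate (.inl (x, y)) η * (f (target (.inl (x, y)) η) - f η))]
  · congr 1
    · refine Finset.sum_congr rfl fun x _ => Finset.sum_congr rfl fun y _ => ?_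
      simp only [genBond, rate, target, S.ω_symm y x]
      ring
    · simp only [genReservoir, rate, target, resRate, resSite, resDensity]
      ring
  · intro x
    simp [rate, S.ω_self]

lemma σ_real : (S.σ : ℝ) = -1 ∨ (S.σ : ℝ) = 0 ∨ (S.σ : ℝ) = 1 := by
  rcases S.σ_mem with h | h | h <;> simp [h]

lemma σ_sq_le : |(S.σ : ℝ)| ≤ 1 := by
  rcases S.σ_real with h | h | h <;> simp [h]

lemma alpha_add_nonneg (η : S.Config) (x : Fin N) : (0 : ℝ) ≤ S.α x + S.σ * η.1 x := by
  rcases S.σ_mem with h | h | h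
  · have := η.2 h x
    have h2 : (η.1 x : ℝ) ≤ S.α x := by exact_mod_cast this
    simp only [h]; push_cast; linarith
  · simp [h]
  · simp only [h]; push_cast; positivity

lemma resRate_nonneg (b : Bool) : 0 ≤ S.resRate b := by
  cases b
  · exact mul_nonneg S.ωL_nonneg S.αL_pos.le
  · exact mul_nonneg S.ωR_nonneg S.αR_pos.le

lemma resDensity_nonneg (b : Bool) : 0 ≤ S.resDensity b := by
  cases b
  · exact S.θL_nonneg
  · exact S.θR_nonneg

lemma resDensity_le_one (h : S.σ = -1) (b : Bool) : S.resDensity b ≤ 1 := by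
  cases b
  · exact S.θL_le_one h
  · exact S.θR_le_one h

lemma one_add_resDensity_nonneg (b : Bool) : (0 : ℝ) ≤ 1 + S.σ * S.resDensity b := by
  have h0 := S.resDensity_nonneg b
  rcases S.σ_mem with h | h | h
  · have := S.resDensity_le_one h b
    simp only [h]; push_cast; linarith
  · simp [h]
  · simp only [h]; push_cast; linarith

lemma rate_nonneg (m : Move N) (η : S.Config) : 0 ≤ S.rate m η := by
  rcases m with ⟨x, y⟩ | ⟨b, _ | _⟩
  · exact mul_nonneg (S.ω_nonneg x y) (mul_nonneg (Nat.cast_nonneg _) (S.alpha_add_nonneg η y))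
  · exact mul_nonneg (S.resRate_nonneg b)
      (mul_nonneg (S.resDensity_nonneg b) (S.alpha_add_nonneg η _))
  · exact mul_nonneg (S.resRate_nonneg b)
      (mul_nonneg (Nat.cast_nonneg _) (S.one_add_resDensity_nonneg b))

variable {S}

lemma moveTo_val {η : S.Config} {ζ : Fin N → ℕ} (h : S.σ = -1 → ∀ x, ζ x ≤ S.α x) :
    (moveTo η ζ).1 = ζ := by
  rw [moveTo, dif_pos h]

lemma lt_alpha_of_ne_zero {η : S.Config} {x : Fin N} (h : (S.α x + S.σ * η.1 x : ℝ) ≠ 0)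
    (hσ : S.σ = -1) : η.1 x < S.α x := by
  refine lt_of_le_of_ne (η.2 hσ x) fun h' => h ?_
  simp [hσ, h']

/-- The fallback values in `moveTo` and `hop` and the truncated subtraction in `remove` are only met
when the rate vanishes: a nonzero rate guarantees a particle at the departure site and, for `σ =
-1`, room at the arrival site. Beyond this point moves are plain translations by `disp`. -/
lemma target_val {m : Move N} {η : S.Config} (h : S.rate m η ≠ 0) (z : Fin N) :
    ((target m η).1 z : ℝ) = η.1 z + S.disp m z := by
  rcases m with ⟨x, y⟩ | ⟨b, _ | _⟩
  · simp only [rate, mul_ne_zero_iff, Nat.cast_ne_zero] at h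
    obtain ⟨h1, h2, h3⟩ := h
    have hxy : x ≠ y := by rintro rfl; exact h1 (S.ω_self x)
    simp only [target, hop, if_neg h2]
    rw [moveTo_val]
    · simp only [Pi.add_apply, Pi.sub_apply, Pi.single_apply, disp]
      by_cases hy : z = y
      · subst hy
        simp [hxy.symm]
      · by_cases hx : z = x
        · subst hx
          simp only [if_true, hy, if_false, add_zero]
          rw [Nat.cast_sub (Nat.one_le_iff_ne_zero.2 h2)]
          simp [sub_eq_add_neg]
        · simp [hx, hy]
    · intro hσ w
      have h4 := lt_alpha_of_ne_zero h3 hσ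
      have h5 := η.2 hσ w
      simp only [Pi.add_apply, Pi.sub_apply, Pi.single_apply]
      by_cases hy : w = y
      · subst hy
        simp only [hxy.symm, if_false, if_true]
        omega
      · simp only [hy, if_false]
        omega
  · simp only [rate, mul_ne_zero_iff] at h
    obtain ⟨-, -, h3⟩ := h
    simp only [target, insert]
    rw [moveTo_val]
    · by_cases hz : z = S.resSite b
      · subst hz; simp [disp]
      · simp [disp, hz]
    · intro hσ w
      have h4 := lt_alpha_of_ne_zero h3 hσ
      have h5 := η.2 hσ w
      by_cases hw : w = S.resSite b
      · subst hw; simp; omega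
      · simp [hw, h5]
  · simp only [rate, mul_ne_zero_iff, Nat.cast_ne_zero] at h
    obtain ⟨-, h2, -⟩ := h
    simp only [target, remove]
    rw [moveTo_val]
    · by_cases hz : z = S.resSite b
      · subst hz
        simp only [Function.update_self, disp, if_true]
        rw [Nat.cast_sub (Nat.one_le_iff_ne_zero.2 h2)]
        simp [sub_eq_add_neg]
      · simp [disp, hz]
    · intro hσ w
      have h5 := η.2 hσ w
      by_cases hw : w = S.resSite b
      · subst hw; simp; omega
      · simp [hw, h5]

variable (S)

/-- The generator acts on a function of the coordinates through the displacements. -/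
lemma gen_comp (F : (Fin N → ℝ) → ℝ) (η : S.Config) :
    S.gen (fun ζ => F fun z => (ζ.1 z : ℝ)) η
      = ∑ m, S.rate m η * (F (fun z => (η.1 z : ℝ) + S.disp m z) - F fun z => (η.1 z : ℝ)) := by
  rw [gen_eq_sum]
  refine Finset.sum_congr rfl fun m _ => ?_
  by_cases h : S.rate m η = 0
  · simp [h]
  · have : (fun z => ((target m η).1 z : ℝ)) = fun z => (η.1 z : ℝ) + S.disp m z :=
      funext (target_val h)
    simp only [this]

/-- The total rate at which moves are attempted. -/
def totalRate (η : S.Config) : ℝ := ∑ m, S.rate m η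

lemma exitRate_eq (η : S.Config) [DecidableEq S.Config] :
    S.exitRate η = ∑ m, if target m η = η then 0 else S.rate m η := by
  rw [exitRate, gen_eq_sum, ← Finset.sum_neg_distrib]
  refine Finset.sum_congr rfl fun m _ => ?_
  by_cases h : target m η = η
  · simp [h]
  · simp [h]

lemma exitRate_nonneg (η : S.Config) : 0 ≤ S.exitRate η := by
  classical
  rw [exitRate_eq]
  refine Finset.sum_nonneg fun m _ => ?_
  split_ifs
  · exact le_rfl
  · exact S.rate_nonneg m η

lemma exitRate_le_totalRate (η : S.Config) : S.exitRate η ≤ S.totalRate η := by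
  classical
  rw [exitRate_eq]
  refine Finset.sum_le_sum fun m _ => ?_
  split_ifs
  · exact S.rate_nonneg m η
  · exact le_rfl

/-- The off-diagonal part of the generator. It is positive on nonnegative functions, which is what
allows the passage to `ℝ≥0∞` in `jumpOp_ofReal`. -/
lemma gen_add_exitRate (f : S.Config → ℝ) (η : S.Config) [DecidableEq S.Config] :
    S.gen f η + S.exitRate η * f η
      = ∑ m, if target m η = η then 0 else S.rate m η * f (target m η) := by
  rw [gen_eq_sum, exitRate_eq, Finset.sum_mul, ← Finset.sum_add_distrib]
  refine Finset.sum_congr rfl fun m _ => ?_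
  split_ifs with h
  · simp [h]
  · ring

lemma jumpRate_eq (η ζ : S.Config) [DecidableEq S.Config] :
    S.jumpRate η ζ
      = ∑ m, if target m η = ζ ∧ target m η ≠ η then ENNReal.ofReal (S.rate m η) else 0 := by
  rw [jumpRate]
  split_ifs with h
  · subst h
    symm
    refine Finset.sum_eq_zero fun m _ => if_neg (by tauto)
  · rw [gen_eq_sum, ENNReal.ofReal_sum_of_nonneg]
    · refine Finset.sum_congr rfl fun m _ => ?_
      have h' : η ≠ ζ := fun h'' => h h''.symm
      by_cases h1 : target m η = ζ
      · simp [h1, h, h']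
      · simp [h1, h']
    · intro m _
      refine mul_nonneg (S.rate_nonneg m η) ?_
      have h' : η ≠ ζ := fun h'' => h h''.symm
      simp only [Set.indicator, Set.mem_singleton_iff, h', if_false, sub_zero]
      split_ifs <;> simp

/-- The jump operator: the sum of a function against the jump rates. -/
def jumpOp (u : S.Config → ℝ≥0∞) (η : S.Config) : ℝ≥0∞ := ∑' ζ, S.jumpRate η ζ * u ζ

lemma jumpOp_eq (u : S.Config → ℝ≥0∞) (η : S.Config) [DecidableEq S.Config] :
    S.jumpOp u η
      = ∑ m, if target m η = η then 0 else ENNReal.ofReal (S.rate m η) * u (target m η) := by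
  simp only [jumpOp, jumpRate_eq, Finset.sum_mul]
  rw [Summable.tsum_finsetSum fun _ _ => ENNReal.summable]
  refine Finset.sum_congr rfl fun m _ => ?_
  rw [tsum_eq_single (target m η)]
  · by_cases h : target m η = η <;> simp [h]
  · intro ζ hζ
    rw [if_neg (fun h => hζ h.1.symm), zero_mul]

lemma jumpOp_ofReal {f : S.Config → ℝ} (hf : ∀ η, 0 ≤ f η) (η : S.Config) :
    S.jumpOp (fun ζ => ENNReal.ofReal (f ζ)) η
      = ENNReal.ofReal (S.gen f η + S.exitRate η * f η) := by
  classical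
  rw [jumpOp_eq, gen_add_exitRate, ENNReal.ofReal_sum_of_nonneg]
  · refine Finset.sum_congr rfl fun m _ => ?_
    split_ifs
    · simp
    · rw [ENNReal.ofReal_mul (S.rate_nonneg m η)]
  · intro m _
    split_ifs
    · exact le_rfl
    · exact mul_nonneg (S.rate_nonneg m η) (hf _)

lemma gen_const (c : ℝ) (η : S.Config) : S.gen (fun _ => c) η = 0 := by
  simp [gen_eq_sum]

lemma jumpOp_one (η : S.Config) : S.jumpOp 1 η = ENNReal.ofReal (S.exitRate η) := by
  have := S.jumpOp_ofReal (f := fun _ => 1) (fun _ => zero_le_one) η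
  simpa [gen_const, Pi.one_def] using this

lemma jumpOp_mono {u v : S.Config → ℝ≥0∞} (h : ∀ η, u η ≤ v η) (η : S.Config) :
    S.jumpOp u η ≤ S.jumpOp v η :=
  ENNReal.tsum_le_tsum fun ζ => by gcongr; exact h ζ

lemma jumpOp_add (u v : S.Config → ℝ≥0∞) (η : S.Config) :
    S.jumpOp (fun ζ => u ζ + v ζ) η = S.jumpOp u η + S.jumpOp v η := by
  simp only [jumpOp, mul_add, ENNReal.tsum_add]

lemma jumpOp_const_mul (c : ℝ≥0∞) (u : S.Config → ℝ≥0∞) (η : S.Config) :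
    S.jumpOp (fun ζ => c * u ζ) η = c * S.jumpOp u η := by
  simp only [jumpOp, ← ENNReal.tsum_mul_left]
  exact tsum_congr fun ζ => by ring

lemma jumpOp_measurable {X : Type*} [MeasurableSpace X] {u : X → S.Config → ℝ≥0∞}
    (h : ∀ η, Measurable fun t => u t η) (η : S.Config) : Measurable fun t => S.jumpOp (u t) η :=
  Measurable.tsum fun ζ => (h ζ).const_mul _

end BoundaryDrivenSystem

end

noncomputable section

/-! ### The minimal transition function -/

lemma measurable_setLIntegral_Icc {F : ℝ × ℝ → ℝ≥0∞} (hF : Measurable F) :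
    Measurable fun t : ℝ => ∫⁻ s in Set.Icc 0 t, F (t, s) := by
  have h1 : MeasurableSet {p : ℝ × ℝ | 0 ≤ p.2 ∧ p.2 ≤ p.1} :=
    (measurableSet_le measurable_const measurable_snd).inter
      (measurableSet_le measurable_snd measurable_fst)
  have h2 := (hF.indicator h1).lintegral_prod_right' (ν := (volume : Measure ℝ))
  convert h2 using 2 with t
  rw [← lintegral_indicator measurableSet_Icc]
  rfl

/-- Monotone convergence for the counting measure. -/
lemma ENNReal.tsum_iSup_of_monotone {X : Type*} [Countable X] {a : ℕ → X → ℝ≥0∞}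
    (h : Monotone a) : ∑' x, ⨆ n, a n x = ⨆ n, ∑' x, a n x := by
  let _ : MeasurableSpace X := ⊤
  have := lintegral_iSup (μ := (Measure.count : Measure X)) (f := a)
    (fun n => Measurable.of_discrete) h
  simpa only [lintegral_count] using this

namespace BoundaryDrivenSystem

variable {N : ℕ} (S : BoundaryDrivenSystem N)

/-- The probability of not having jumped by time `t`. -/
def holdProb (η : S.Config) (t : ℝ) : ℝ≥0∞ := ENNReal.ofReal (Real.exp (-(S.exitRate η * t)))

lemma holdProb_measurable (η : S.Config) : Measurable (S.holdProb η) := by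
  unfold holdProb; fun_prop

lemma holdProb_ne_top (η : S.Config) (t : ℝ) : S.holdProb η t ≠ ∞ := ENNReal.ofReal_ne_top

lemma transIter_succ (n : ℕ) (t : ℝ) (η ζ : S.Config) :
    S.transIter (n + 1) t η ζ = (if η = ζ then S.holdProb η t else 0)
      + ∫⁻ s in Set.Icc 0 t, S.holdProb η s * S.jumpOp (fun η' => S.transIter n (t - s) η' ζ) η := by
  rfl

lemma transIter_measurable (n : ℕ) (η ζ : S.Config) :
    Measurable fun t => S.transIter n t η ζ := by
  induction n generalizing η with
  | zero => exact measurable_const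
  | succ n ih =>
    simp only [transIter_succ]
    refine Measurable.add ?_ ?_
    · split_ifs
      · exact S.holdProb_measurable η
      · exact measurable_const
    · refine measurable_setLIntegral_Icc
        (F := fun p => S.holdProb η p.2 * S.jumpOp (fun η' => S.transIter n (p.1 - p.2) η' ζ) η) ?_
      refine ((S.holdProb_measurable η).comp measurable_snd).mul ?_
      exact S.jumpOp_measurable
        (fun η' => (ih η').comp (measurable_fst.sub measurable_snd)) η

lemma transIter_mono (t : ℝ) (η ζ : S.Config) : Monotone fun n => S.transIter n t η ζ := by
  refine monotone_nat_of_le_succ fun n => ?_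
  induction n generalizing t η with
  | zero => exact zero_le
  | succ n ih =>
    rw [transIter_succ, transIter_succ]
    gcongr with s
    exact S.jumpOp_mono (fun η' => ih _ _) η

lemma transProb_measurable (η ζ : S.Config) : Measurable fun t => S.transProb t η ζ :=
  Measurable.iSup fun n => S.transIter_measurable n η ζ

/-- The action of the iterates of the transition function on nonnegative functions. -/
def evolIter (n : ℕ) (t : ℝ) (f : S.Config → ℝ≥0∞) (η : S.Config) : ℝ≥0∞ :=
  ∑' ζ, S.transIter n t η ζ * f ζ

/-- The action of the transition function on nonnegative functions. -/
def evol (t : ℝ) (f : S.Config → ℝ≥0∞) (η : S.Config) : ℝ≥0∞ :=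
  ∑' ζ, S.transProb t η ζ * f ζ

lemma evolIter_measurable (n : ℕ) (f : S.Config → ℝ≥0∞) (η : S.Config) :
    Measurable fun t => S.evolIter n t f η :=
  Measurable.tsum fun ζ => (S.transIter_measurable n η ζ).mul_const _

lemma evol_measurable (f : S.Config → ℝ≥0∞) (η : S.Config) :
    Measurable fun t => S.evol t f η :=
  Measurable.tsum fun ζ => (S.transProb_measurable η ζ).mul_const _

lemma evolIter_mono (t : ℝ) (f : S.Config → ℝ≥0∞) (η : S.Config) :
    Monotone fun n => S.evolIter n t f η := fun _ _ h =>
  ENNReal.tsum_le_tsum fun ζ => by gcongr; exact S.transIter_mono t η ζ h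

lemma evol_eq_iSup (t : ℝ) (f : S.Config → ℝ≥0∞) (η : S.Config) :
    S.evol t f η = ⨆ n, S.evolIter n t f η := by
  unfold evolIter
  rw [← ENNReal.tsum_iSup_of_monotone]
  · exact tsum_congr fun ζ => by rw [transProb, ENNReal.iSup_mul]
  · intro n m h ζ
    show S.transIter n t η ζ * f ζ ≤ S.transIter m t η ζ * f ζ
    gcongr
    exact S.transIter_mono t η ζ h

lemma evolIter_zero (t : ℝ) (f : S.Config → ℝ≥0∞) (η : S.Config) : S.evolIter 0 t f η = 0 := by
  simp [evolIter, transIter]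

lemma jumpOp_tsum (u : S.Config → S.Config → ℝ≥0∞) (η : S.Config) :
    S.jumpOp (fun η' => ∑' ζ, u η' ζ) η = ∑' ζ, S.jumpOp (fun η' => u η' ζ) η := by
  simp only [jumpOp, ← ENNReal.tsum_mul_left]
  exact ENNReal.tsum_comm

lemma jumpOp_mul_const (c : ℝ≥0∞) (u : S.Config → ℝ≥0∞) (η : S.Config) :
    S.jumpOp (fun ζ => u ζ * c) η = S.jumpOp u η * c := by
  simp only [mul_comm _ c, jumpOp_const_mul]

/-- The recursion is carried from transition probabilities to nonnegative functions by Tonelli, so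
that iterates can be compared with supersolutions pointwise. -/
lemma evolIter_succ (n : ℕ) (t : ℝ) (f : S.Config → ℝ≥0∞) (η : S.Config) :
    S.evolIter (n + 1) t f η = S.holdProb η t * f η
      + ∫⁻ s in Set.Icc 0 t, S.holdProb η s * S.jumpOp (S.evolIter n (t - s) f) η := by
  unfold evolIter
  simp only [transIter_succ, add_mul, ENNReal.tsum_add, jumpOp_tsum]
  congr 1
  · rw [tsum_eq_single η]
    · simp
    · intro ζ hζ
      simp [hζ.symm]
  · have hm : ∀ ζ, Measurable fun s =>
        S.holdProb η s * S.jumpOp (fun η' => S.transIter n (t - s) η' ζ * f ζ) η := fun ζ =>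
      (S.holdProb_measurable η).mul (S.jumpOp_measurable (fun η' =>
        ((S.transIter_measurable n η' ζ).comp (measurable_const.sub measurable_id)).mul_const _) η)
    simp only [← ENNReal.tsum_mul_left]
    rw [lintegral_tsum fun ζ => (hm ζ).aemeasurable]
    refine tsum_congr fun ζ => ?_
    rw [← lintegral_mul_const]
    · simp only [jumpOp_mul_const, mul_assoc]
    · exact (S.holdProb_measurable η).mul (S.jumpOp_measurable (fun η' =>
        ((S.transIter_measurable n η' ζ).comp (measurable_const.sub measurable_id))) η)

/-- The Kolmogorov backward equation in integrated form. -/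
lemma evol_eq (t : ℝ) (f : S.Config → ℝ≥0∞) (η : S.Config) :
    S.evol t f η = S.holdProb η t * f η
      + ∫⁻ s in Set.Icc 0 t, S.holdProb η s * S.jumpOp (S.evol (t - s) f) η := by
  have h1 : ∀ s, S.holdProb η s * S.jumpOp (S.evol (t - s) f) η
      = ⨆ n, S.holdProb η s * S.jumpOp (S.evolIter n (t - s) f) η := by
    intro s
    rw [← ENNReal.mul_iSup]
    congr 1
    unfold jumpOp
    rw [← ENNReal.tsum_iSup_of_monotone]
    · exact tsum_congr fun ζ => by rw [evol_eq_iSup, ENNReal.mul_iSup]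
    · intro n m h ζ
      show S.jumpRate η ζ * S.evolIter n (t - s) f ζ ≤ S.jumpRate η ζ * S.evolIter m (t - s) f ζ
      gcongr
      exact S.evolIter_mono _ f ζ h
  simp only [h1]
  rw [lintegral_iSup, ENNReal.add_iSup, evol_eq_iSup]
  · simp only [← evolIter_succ]
    exact ((S.evolIter_mono t f η).iSup_nat_add 1).symm
  · intro n
    exact (S.holdProb_measurable η).mul (S.jumpOp_measurable (fun η' =>
        ((S.evolIter_measurable n f η').comp (measurable_const.sub measurable_id))) η)
  · intro n m h s
    show S.holdProb η s * S.jumpOp (S.evolIter n (t - s) f) η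
      ≤ S.holdProb η s * S.jumpOp (S.evolIter m (t - s) f) η
    gcongr
    exact S.jumpOp_mono (fun η' => S.evolIter_mono _ f η' h) η

/-- The transition function is minimal among the supersolutions of the backward equation. -/
theorem evol_le_of_supersolution {f : S.Config → ℝ≥0∞} {u : ℝ → S.Config → ℝ≥0∞}
    (hu : ∀ t, 0 ≤ t → ∀ η, S.holdProb η t * f η
      + ∫⁻ s in Set.Icc 0 t, S.holdProb η s * S.jumpOp (u (t - s)) η ≤ u t η)
    {t : ℝ} (ht : 0 ≤ t) (η : S.Config) : S.evol t f η ≤ u t η := by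
  rw [evol_eq_iSup]
  refine iSup_le fun n => ?_
  induction n generalizing t η with
  | zero => simp [evolIter_zero]
  | succ n ih =>
    refine le_trans ?_ (hu t ht η)
    rw [evolIter_succ]
    refine add_le_add le_rfl ?_
    refine setLIntegral_mono' measurableSet_Icc fun s hs => ?_
    gcongr
    exact S.jumpOp_mono (fun η' => ih (sub_nonneg.2 hs.2) η') η

/-- A differential supersolution of the backward equation is an integral supersolution. -/
lemma supersolution_of_hasDerivAt {u u' : ℝ → S.Config → ℝ}
    (h0 : ∀ t, 0 ≤ t → ∀ η, 0 ≤ u t η)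
    (hd : ∀ t η, HasDerivAt (fun t => u t η) (u' t η) t)
    (hc : ∀ η, Continuous fun t => u' t η)
    (hg : ∀ t, 0 ≤ t → ∀ η, S.gen (u t) η ≤ u' t η) {t : ℝ} (ht : 0 ≤ t) (η : S.Config) :
    S.holdProb η t * ENNReal.ofReal (u 0 η)
      + ∫⁻ s in Set.Icc 0 t, S.holdProb η s
        * S.jumpOp (fun ζ => ENNReal.ofReal (u (t - s) ζ)) η ≤ ENNReal.ofReal (u t η) := by
  set q := S.exitRate η with hq
  set φ : ℝ → ℝ := fun s => Real.exp (-(q * s)) * (u' (t - s) η + q * u (t - s) η) with hφ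
  have hφ0 : ∀ s ∈ Set.Icc 0 t, 0 ≤ φ s := by
    intro s hs
    have hts : 0 ≤ t - s := sub_nonneg.2 hs.2
    refine mul_nonneg (Real.exp_pos _).le ?_
    have h1 := hg _ hts η
    classical
    have h2 := S.gen_add_exitRate (u (t - s)) η
    have h3 : 0 ≤ S.gen (u (t - s)) η + q * u (t - s) η := by
      rw [h2]
      refine Finset.sum_nonneg fun m _ => ?_
      split_ifs
      · exact le_rfl
      · exact mul_nonneg (S.rate_nonneg m η) (h0 _ hts _)
    linarith
  have hcu : Continuous fun s => u s η :=
    continuous_iff_continuousAt.2 fun s => (hd s η).continuousAt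
  have hφc : Continuous φ := by
    have h1 := (hc η).comp (continuous_const.sub continuous_id : Continuous fun s : ℝ => t - s)
    have h2 := hcu.comp (continuous_const.sub continuous_id : Continuous fun s : ℝ => t - s)
    simp only [Function.comp_def] at h1 h2
    exact (Real.continuous_exp.comp (by fun_prop)).mul (h1.add (continuous_const.mul h2))
  -- `φ` is minus the derivative of `s ↦ exp (-(q * s)) * u (t - s) η`, so its integral telescopes
  -- to the two endpoint values.
  have hint : ∫ s in (0:ℝ)..t, φ s = u t η - Real.exp (-(q * t)) * u 0 η := by
    have hder : ∀ s ∈ Set.uIcc 0 t,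
        HasDerivAt (fun s => -(Real.exp (-(q * s)) * u (t - s) η)) (φ s) s := by
      intro s _
      have h1 : HasDerivAt (fun s => Real.exp (-(q * s))) (Real.exp (-(q * s)) * (-(q * 1))) s :=
        ((hasDerivAt_id s).const_mul q).neg.exp
      have h2 : HasDerivAt (fun s => u (t - s) η) (-u' (t - s) η) s := by
        simpa using (hd (t - s) η).comp_const_sub t s
      refine (h1.mul h2).neg.congr_deriv ?_
      simp only [hφ]; ring
    rw [intervalIntegral.integral_eq_sub_of_hasDerivAt hder (hφc.intervalIntegrable _ _)]
    simp; ring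
  calc _ ≤ S.holdProb η t * ENNReal.ofReal (u 0 η)
      + ∫⁻ s in Set.Icc 0 t, ENNReal.ofReal (φ s) := by
        refine add_le_add le_rfl ?_
        refine setLIntegral_mono' measurableSet_Icc fun s hs => ?_
        have hts : 0 ≤ t - s := sub_nonneg.2 hs.2
        rw [S.jumpOp_ofReal (h0 _ hts), holdProb, ← ENNReal.ofReal_mul (Real.exp_pos _).le]
        refine ENNReal.ofReal_le_ofReal ?_
        exact mul_le_mul_of_nonneg_left (by linarith [hg _ hts η]) (Real.exp_pos _).le
    _ = ENNReal.ofReal (Real.exp (-(q * t)) * u 0 η) + ENNReal.ofReal (∫ s in (0:ℝ)..t, φ s) := by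
        congr 1
        · rw [holdProb, ← ENNReal.ofReal_mul (Real.exp_pos _).le]
        · rw [intervalIntegral.integral_of_le ht, ← integral_Icc_eq_integral_Ioc,
            ofReal_integral_eq_lintegral_ofReal]
          · exact hφc.integrableOn_Icc
          · exact (ae_restrict_iff' measurableSet_Icc).2 (ae_of_all _ hφ0)
    _ = ENNReal.ofReal (u t η) := by
        rw [← ENNReal.ofReal_add, hint]
        · congr 1; ring
        · exact mul_nonneg (Real.exp_pos _).le (h0 0 le_rfl η)
        · exact intervalIntegral.integral_nonneg ht hφ0

lemma lintegral_holdProb (η : S.Config) {t : ℝ} (ht : 0 ≤ t) :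
    ∫⁻ s in Set.Icc 0 t, S.holdProb η s * ENNReal.ofReal (S.exitRate η)
      = ENNReal.ofReal (1 - Real.exp (-(S.exitRate η * t))) := by
  set q := S.exitRate η with hq
  have hq0 : 0 ≤ q := S.exitRate_nonneg η
  have hint : ∫ s in (0:ℝ)..t, Real.exp (-(q * s)) * q = 1 - Real.exp (-(q * t)) := by
    have hder : ∀ s ∈ Set.uIcc 0 t,
        HasDerivAt (fun s => -(Real.exp (-(q * s)))) (Real.exp (-(q * s)) * q) s := by
      intro s _
      have h1 : HasDerivAt (fun s => Real.exp (-(q * s))) (Real.exp (-(q * s)) * (-(q * 1))) s :=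
        ((hasDerivAt_id s).const_mul q).neg.exp
      exact h1.neg.congr_deriv (by ring)
    rw [intervalIntegral.integral_eq_sub_of_hasDerivAt hder
      (Continuous.intervalIntegrable (by fun_prop) _ _)]
    simp; ring
  rw [← hint, intervalIntegral.integral_of_le ht, ← integral_Icc_eq_integral_Ioc,
    ofReal_integral_eq_lintegral_ofReal]
  · refine lintegral_congr fun s => ?_
    rw [holdProb, ← ENNReal.ofReal_mul (Real.exp_pos _).le]
  · exact Continuous.integrableOn_Icc (by fun_prop)
  · exact ae_of_all _ fun s => mul_nonneg (Real.exp_pos _).le hq0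

/-- The first jump either occurs before `t` or does not: the constant `1` solves the backward
equation. Non-explosion says that the minimal solution equals this one. -/
lemma holdProb_add_lintegral (η : S.Config) {t : ℝ} (ht : 0 ≤ t) :
    S.holdProb η t + ∫⁻ s in Set.Icc 0 t, S.holdProb η s * S.jumpOp 1 η = 1 := by
  simp only [jumpOp_one]
  rw [lintegral_holdProb _ _ ht, holdProb, ← ENNReal.ofReal_add (Real.exp_pos _).le]
  · simp
  · have : Real.exp (-(S.exitRate η * t)) ≤ 1 :=
      Real.exp_le_one_iff.2 (neg_nonpos.2 (mul_nonneg (S.exitRate_nonneg η) ht))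
    linarith

lemma evol_one_le {t : ℝ} (ht : 0 ≤ t) (η : S.Config) : S.evol t 1 η ≤ 1 := by
  refine S.evol_le_of_supersolution (u := fun _ => 1) (fun t ht η => ?_) ht η
  simpa using (S.holdProb_add_lintegral η ht).le

lemma holdProb_add (η : S.Config) (s t : ℝ) :
    S.holdProb η (s + t) = S.holdProb η s * S.holdProb η t := by
  rw [holdProb, holdProb, holdProb, ← ENNReal.ofReal_mul (Real.exp_pos _).le, ← Real.exp_add]
  congr 2; ring

/-- One half of the Chapman–Kolmogorov equation. -/
lemma evol_evol_le {s t : ℝ} (hs : 0 ≤ s) (ht : 0 ≤ t) (f : S.Config → ℝ≥0∞) (η : S.Config) :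
    S.evol t (S.evol s f) η ≤ S.evol (t + s) f η := by
  refine S.evol_le_of_supersolution (u := fun t => S.evol (t + s) f) (fun t ht η => ?_) ht η
  have hm : Measurable fun r => S.holdProb η r * S.jumpOp (S.evol (t + s - r) f) η :=
    (S.holdProb_measurable η).mul (S.jumpOp_measurable (fun η' =>
        ((S.evol_measurable f η').comp (measurable_const.sub measurable_id))) η)
  have hsplit : Set.Icc 0 (t + s) = Set.Ico 0 t ∪ Set.Icc t (t + s) :=
    (Set.Ico_union_Icc_eq_Icc ht (by linarith)).symm
  rw [S.evol_eq (t + s), S.evol_eq s, hsplit, lintegral_union measurableSet_Icc, mul_add,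
    ← mul_assoc, ← holdProb_add, add_assoc]
  · refine add_le_add le_rfl ?_
    rw [add_comm]
    refine add_le_add ?_ ?_
    · rw [setLIntegral_congr (Ico_ae_eq_Icc (a := (0:ℝ)) (b := t)).symm]
      refine lintegral_mono fun r => ?_
      rw [show t - r + s = t + s - r by ring]
    · rw [← lintegral_const_mul']
      · have h2 := (measurePreserving_add_left (volume : Measure ℝ) t).setLIntegral_comp_emb
          (measurableEmbedding_addLeft t)
          (fun r => S.holdProb η r * S.jumpOp (S.evol (t + s - r) f) η) (Set.Icc 0 s)
        rw [Set.image_const_add_Icc, add_zero] at h2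
        rw [← h2]
        refine lintegral_mono fun r => ?_
        rw [holdProb_add, mul_assoc, show t + s - (t + r) = s - r by ring]
      · exact S.holdProb_ne_top η t
  · rw [Set.disjoint_left]
    rintro r ⟨_, h1⟩ ⟨h2, _⟩
    linarith

end BoundaryDrivenSystem

end

noncomputable section

namespace BoundaryDrivenSystem

variable {N : ℕ} (S : BoundaryDrivenSystem N)

/-! ### Non-explosion and the semigroup property -/

/-- A nonnegative function with finite sublevel sets and negative drift. -/
structure IsLyapunov (V : S.Config → ℝ) (c K : ℝ) : Prop where
  nonneg : ∀ η, 0 ≤ V η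
  finite : ∀ R, {η | V η ≤ R}.Finite
  c_pos : 0 < c
  K_nonneg : 0 ≤ K
  drift : ∀ η, S.gen V η ≤ -c * V η + K

lemma gen_add (f g : S.Config → ℝ) (η : S.Config) :
    S.gen (fun ζ => f ζ + g ζ) η = S.gen f η + S.gen g η := by
  simp only [gen_eq_sum, ← Finset.sum_add_distrib]
  exact Finset.sum_congr rfl fun m _ => by ring

lemma gen_const_mul (c : ℝ) (f : S.Config → ℝ) (η : S.Config) :
    S.gen (fun ζ => c * f ζ) η = c * S.gen f η := by
  simp only [gen_eq_sum, Finset.mul_sum]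
  exact Finset.sum_congr rfl fun m _ => by ring

/-- Difference of the backward equations satisfied by `1` and by `evol t 1`: the lost mass is only
produced after a first jump. -/
lemma defect_eq {t : ℝ} (ht : 0 ≤ t) (η : S.Config) :
    1 - S.evol t 1 η
      = ∫⁻ s in Set.Icc 0 t, S.holdProb η s * S.jumpOp (fun ζ => 1 - S.evol (t - s) 1 ζ) η := by
  symm
  refine ENNReal.eq_sub_of_add_eq (ne_top_of_le_ne_top ENNReal.one_ne_top (S.evol_one_le ht η)) ?_
  rw [S.evol_eq t 1 η, add_comm, add_assoc, Pi.one_apply, mul_one, ← lintegral_add_left]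
  · refine Eq.trans ?_ (S.holdProb_add_lintegral η ht)
    congr 1
    refine setLIntegral_congr_fun measurableSet_Icc fun s hs => ?_
    rw [← mul_add, ← jumpOp_add]
    congr 2
    funext ζ
    exact add_tsub_cancel_of_le (S.evol_one_le (sub_nonneg.2 hs.2) ζ)
  · exact (S.holdProb_measurable η).mul (S.jumpOp_measurable (fun η' =>
        ((S.evol_measurable 1 η').comp (measurable_const.sub measurable_id))) η)

variable {S}

/-- Comparison of the defect of the total mass with a growing supersolution. -/
lemma IsLyapunov.defect_le {V : S.Config → ℝ} {c K : ℝ} (hV : S.IsLyapunov V c K) {ε : ℝ}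
    (hε : 0 < ε) {t : ℝ} (ht : 0 ≤ t) (η : S.Config) :
    1 - S.evol t 1 η ≤ ENNReal.ofReal (ε * (Real.exp (K * t) * (V η + 1))) := by
  set w : ℝ → S.Config → ℝ≥0∞ := fun t η => 1 - S.evol t 1 η with hw
  set v : ℝ → S.Config → ℝ := fun t η => ε * (Real.exp (K * t) * (V η + 1)) with hv
  have hK := hV.K_nonneg
  have hv0 : ∀ t, 0 ≤ t → ∀ η, 0 ≤ v t η := fun t _ η => by
    have := hV.nonneg η
    simp only [hv]; positivity
  have hsuper : ∀ t, 0 ≤ t → ∀ η, S.holdProb η t * ENNReal.ofReal (v 0 η)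
      + ∫⁻ s in Set.Icc 0 t, S.holdProb η s
        * S.jumpOp (fun ζ => ENNReal.ofReal (v (t - s) ζ)) η ≤ ENNReal.ofReal (v t η) := by
    intro t ht η
    refine S.supersolution_of_hasDerivAt (u := v)
      (u' := fun t η => ε * (Real.exp (K * t) * K * (V η + 1))) hv0 ?_ ?_ ?_ ht η
    · intro t η
      have h1 : HasDerivAt (fun t => Real.exp (K * t)) (Real.exp (K * t) * (K * 1)) t :=
        ((hasDerivAt_id t).const_mul K).exp
      simpa using (h1.mul_const (V η + 1)).const_mul ε
    · intro η; fun_prop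
    · intro t _ η
      simp only [hv]
      rw [gen_const_mul, gen_const_mul, gen_add, gen_const, mul_assoc (Real.exp (K * t))]
      have h1 := hV.drift η
      have h2 := mul_nonneg hV.c_pos.le (hV.nonneg η)
      have h3 := mul_nonneg hK (hV.nonneg η)
      gcongr
      linarith
  -- Where `V η > 1 / ε` the function `v` exceeds `1`, hence the defect. The comparison is only at
  -- stake on a finite set, and there the exit rates are bounded.
  obtain ⟨Q, hQ⟩ : ∃ Q, ∀ η ∈ {η | V η ≤ 1 / ε}, S.exitRate η ≤ Q := by
    obtain ⟨Q, hQ⟩ := ((hV.finite (1 / ε)).image S.exitRate).bddAbove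
    exact ⟨Q, fun η hη => hQ ⟨η, hη, rfl⟩⟩
  -- `G` is the largest excess of the defect over `v` up to time `t`. Inserting `w ≤ v + G` into the
  -- renewal equation multiplies `G` by the probability of a jump, at most `1 - exp (-(Q * t)) < 1`,
  -- so the finite number `G` vanishes.
  set G : ℝ≥0∞ := ⨆ s : Set.Icc 0 t, ⨆ η, (w s η - ENNReal.ofReal (v s η)) with hG
  have hw1 : ∀ s η, w s η ≤ 1 := fun s η => tsub_le_self
  have hG1 : G ≤ 1 := iSup_le fun s => iSup_le fun η => tsub_le_self.trans (hw1 _ _)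
  have hwG : ∀ s ∈ Set.Icc 0 t, ∀ η, w s η ≤ ENNReal.ofReal (v s η) + G := by
    intro s hs η
    rw [← tsub_le_iff_left]
    exact le_iSup_of_le ⟨s, hs⟩ (le_iSup_of_le η le_rfl)
  have key : G ≤ G * ENNReal.ofReal (1 - Real.exp (-(Q * t))) := by
    refine iSup_le fun ⟨s, hs⟩ => iSup_le fun η => ?_
    by_cases hη : V η ≤ 1 / ε
    · rw [tsub_le_iff_left]
      calc w s η = ∫⁻ r in Set.Icc 0 s, S.holdProb η r * S.jumpOp (w (s - r)) η :=
            S.defect_eq hs.1 η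
        _ ≤ ∫⁻ r in Set.Icc 0 s, (S.holdProb η r
              * S.jumpOp (fun ζ => ENNReal.ofReal (v (s - r) ζ)) η
              + G * (S.holdProb η r * ENNReal.ofReal (S.exitRate η))) := by
            refine setLIntegral_mono' measurableSet_Icc fun r hr => ?_
            rw [mul_left_comm G, ← mul_add, ← jumpOp_one, ← S.jumpOp_const_mul G, ← jumpOp_add]
            gcongr
            refine S.jumpOp_mono (fun ζ => ?_) η
            simpa using hwG (s - r) ⟨sub_nonneg.2 hr.2, by linarith [hr.1, hs.2]⟩ ζ
        _ = (∫⁻ r in Set.Icc 0 s, (S.holdProb η r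
              * S.jumpOp (fun ζ => ENNReal.ofReal (v (s - r) ζ)) η))
              + G * ENNReal.ofReal (1 - Real.exp (-(S.exitRate η * s))) := by
            rw [lintegral_add_right, lintegral_const_mul, lintegral_holdProb _ _ hs.1]
            · exact (S.holdProb_measurable η).mul_const _
            · exact ((S.holdProb_measurable η).mul_const _).const_mul _
        _ ≤ ENNReal.ofReal (v s η) + G * ENNReal.ofReal (1 - Real.exp (-(Q * t))) := by
            refine add_le_add (le_trans le_add_self (hsuper s hs.1 η)) ?_
            have h1 : S.exitRate η * s ≤ Q * t :=
              mul_le_mul (hQ η hη) hs.2 hs.1 ((S.exitRate_nonneg η).trans (hQ η hη))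
            gcongr
    · have : w s η - ENNReal.ofReal (v s η) = 0 := by
        rw [tsub_eq_zero_iff_le]
        refine (hw1 s η).trans ?_
        rw [ENNReal.one_le_ofReal]
        push Not at hη
        have h1 : 1 ≤ Real.exp (K * s) := Real.one_le_exp (mul_nonneg hK hs.1)
        have h2 : 1 < ε * V η := by rwa [div_lt_iff₀' hε] at hη
        have h3 : V η + 1 ≤ Real.exp (K * s) * (V η + 1) :=
          le_mul_of_one_le_left (by linarith [hV.nonneg η]) h1
        have h4 := mul_le_mul_of_nonneg_left h3 hε.le
        simp only [hv]
        nlinarith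
      rw [this]
      exact zero_le
  have hG0 : G = 0 := by
    by_contra hne
    have h1 : ENNReal.ofReal (1 - Real.exp (-(Q * t))) < 1 := by
      rw [← ENNReal.ofReal_one]
      exact (ENNReal.ofReal_lt_ofReal_iff one_pos).2 (by linarith [Real.exp_pos (-(Q * t))])
    have h2 : G * ENNReal.ofReal (1 - Real.exp (-(Q * t))) < G * 1 :=
      ENNReal.mul_lt_mul_right hne (ne_top_of_le_ne_top ENNReal.one_ne_top hG1) h1
    rw [mul_one] at h2
    exact absurd key (not_le.2 h2)
  have := hwG t ⟨ht, le_rfl⟩ η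
  rwa [hG0, add_zero] at this

/-- The process does not explode. -/
theorem IsLyapunov.evol_one {V : S.Config → ℝ} {c K : ℝ} (hV : S.IsLyapunov V c K) {t : ℝ}
    (ht : 0 ≤ t) (η : S.Config) : S.evol t 1 η = 1 := by
  refine le_antisymm (S.evol_one_le ht η) ?_
  rw [← tsub_eq_zero_iff_le, ← nonpos_iff_eq_zero]
  have h1 : Tendsto (fun ε : ℝ => ENNReal.ofReal (ε * (Real.exp (K * t) * (V η + 1)))) (𝓝[>] 0)
      (𝓝 0) := by
    have : Continuous fun ε : ℝ => ENNReal.ofReal (ε * (Real.exp (K * t) * (V η + 1))) :=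
      ENNReal.continuous_ofReal.comp (by fun_prop)
    simpa using (this.tendsto 0).mono_left nhdsWithin_le_nhds
  exact ge_of_tendsto h1 (eventually_mem_nhdsWithin.mono fun ε hε => hV.defect_le hε ht η)

variable (S)

lemma tsum_transProb_eq (t : ℝ) (η : S.Config) : ∑' ζ, S.transProb t η ζ = S.evol t 1 η := by
  simp [evol]

open Classical in
lemma evol_single (t : ℝ) (η ζ : S.Config) :
    S.evol t (Pi.single ζ 1) η = S.transProb t η ζ := by
  rw [evol, tsum_eq_single ζ]
  · simp
  · intro ξ hξ; simp [hξ]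

variable {S}

/-- Chapman–Kolmogorov. Only `≤` comes from minimality; both sides are probability distributions in
`ζ`, so a strict inequality at one state would contradict equality of the total masses. -/
lemma IsLyapunov.evol_transProb {V : S.Config → ℝ} {c K : ℝ} (hV : S.IsLyapunov V c K)
    {s t : ℝ} (hs : 0 ≤ s) (ht : 0 ≤ t) (η ζ : S.Config) :
    S.evol t (fun ξ => S.transProb s ξ ζ) η = S.transProb (t + s) η ζ := by
  classical
  have hle : ∀ ζ, S.evol t (fun ξ => S.transProb s ξ ζ) η ≤ S.transProb (t + s) η ζ := by
    intro ζ
    have := S.evol_evol_le hs ht (Pi.single ζ 1) η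
    rw [evol_single] at this
    convert this using 2
    funext ξ
    rw [evol_single]
  by_contra hne
  have hlt := lt_of_le_of_ne (hle ζ) hne
  have hsum : ∑' ζ, S.evol t (fun ξ => S.transProb s ξ ζ) η = 1 := by
    unfold evol
    rw [ENNReal.tsum_comm]
    simp only [ENNReal.tsum_mul_left, tsum_transProb_eq, hV.evol_one hs, mul_one, hV.evol_one ht]
  have := ENNReal.tsum_lt_tsum (hsum ▸ ENNReal.one_ne_top) hle hlt
  rw [hsum, tsum_transProb_eq, hV.evol_one (add_nonneg ht hs)] at this
  exact lt_irrefl _ this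

variable (S)

lemma lintegral_transKernel (t : ℝ) (η : S.Config) (f : S.Config → ℝ≥0∞) :
    ∫⁻ ζ, f ζ ∂(S.transKernel t η) = S.evol t f η := by
  show ∫⁻ ζ, f ζ ∂(Measure.sum fun ζ => S.transProb t η ζ • Measure.dirac ζ) = _
  rw [lintegral_sum_measure]
  simp [evol]

lemma transKernel_singleton (t : ℝ) (η ζ : S.Config) :
    S.transKernel t η {ζ} = S.transProb t η ζ := by
  classical
  rw [← lintegral_indicator_one (measurableSet_singleton ζ), lintegral_transKernel, ← evol_single]
  congr 1
  funext ξ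
  by_cases h : ξ = ζ
  · subst h; simp
  · simp [h]

variable {S}

lemma IsLyapunov.isProbabilityMeasure {V : S.Config → ℝ} {c K : ℝ} (hV : S.IsLyapunov V c K)
    {t : ℝ} (ht : 0 ≤ t) (η : S.Config) : IsProbabilityMeasure (S.transKernel t η) := by
  refine ⟨?_⟩
  rw [← hV.evol_one ht η, ← lintegral_transKernel]
  simp

lemma IsLyapunov.law_transKernel {V : S.Config → ℝ} {c K : ℝ} (hV : S.IsLyapunov V c K)
    {s t : ℝ} (hs : 0 ≤ s) (ht : 0 ≤ t) (η : S.Config) :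
    S.law (S.transKernel t η) s = S.transKernel (t + s) η := by
  refine Measure.ext_of_singleton fun ζ => ?_
  rw [law, Measure.bind_apply (measurableSet_singleton ζ) (Kernel.measurable _).aemeasurable,
    transKernel_singleton, lintegral_transKernel]
  simp only [transKernel_singleton]
  exact hV.evol_transProb hs ht η ζ

/-- Exponential decay of a Lyapunov function along the evolution. -/
lemma IsLyapunov.evol_le {V : S.Config → ℝ} {c K : ℝ} (hV : S.IsLyapunov V c K) {t : ℝ}
    (ht : 0 ≤ t) (η : S.Config) :
    S.evol t (fun ζ => ENNReal.ofReal (V ζ)) η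
      ≤ ENNReal.ofReal (Real.exp (-(c * t)) * V η + K / c) := by
  have hc := hV.c_pos
  -- The solution of `u' = -c * u + K` started at `V`; the drift condition makes it a supersolution.
  set u : ℝ → S.Config → ℝ := fun t η => Real.exp (-(c * t)) * V η
    + K / c * (1 - Real.exp (-(c * t))) with hu
  have hexp : ∀ t, 0 ≤ t → 0 ≤ 1 - Real.exp (-(c * t)) := fun t ht => by
    have : Real.exp (-(c * t)) ≤ 1 := Real.exp_le_one_iff.2 (by nlinarith)
    linarith
  have hKc : 0 ≤ K / c := div_nonneg hV.K_nonneg hc.le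
  have h1 : S.evol t (fun ζ => ENNReal.ofReal (V ζ)) η ≤ ENNReal.ofReal (u t η) := by
    refine S.evol_le_of_supersolution (u := fun t η => ENNReal.ofReal (u t η))
      (fun t ht η => ?_) ht η
    have := S.supersolution_of_hasDerivAt (u := u)
      (u' := fun t η => -c * Real.exp (-(c * t)) * V η + K * Real.exp (-(c * t))) ?_ ?_ ?_ ?_ ht η
    · simpa [hu] using this
    · intro t ht η
      exact add_nonneg (mul_nonneg (Real.exp_pos _).le (hV.nonneg η))
        (mul_nonneg hKc (hexp t ht))
    · intro t η
      have h1 : HasDerivAt (fun t => Real.exp (-(c * t))) (Real.exp (-(c * t)) * (-(c * 1))) t :=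
        ((hasDerivAt_id t).const_mul c).neg.exp
      refine ((h1.mul_const (V η)).add ((h1.const_sub 1).const_mul (K / c))).congr_deriv ?_
      field_simp
    · intro η; fun_prop
    · intro t _ η
      simp only [hu]
      rw [gen_add, gen_const, gen_const_mul]
      have := mul_le_mul_of_nonneg_left (hV.drift η) (Real.exp_pos (-(c * t))).le
      linarith
  refine h1.trans (ENNReal.ofReal_le_ofReal ?_)
  have := mul_nonneg hKc (Real.exp_pos (-(c * t))).le
  simp only [hu]
  linarith

/-! ### The semigroup on bounded functions -/

variable (S)

/-- The semigroup: the expectation of a function of the configuration at time `t`. -/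
def sg (t : ℝ) (g : S.Config → ℝ) (η : S.Config) : ℝ := ∫ ζ, g ζ ∂(S.transKernel t η)

lemma integrable_of_bound (ν : Measure S.Config) [IsFiniteMeasure ν] {g : S.Config → ℝ} {M : ℝ}
    (hg : ∀ η, |g η| ≤ M) : Integrable g ν :=
  Integrable.of_bound Measurable.of_discrete.aestronglyMeasurable M (ae_of_all _ hg)

variable {S} {V : S.Config → ℝ} {c K : ℝ}

lemma IsLyapunov.abs_sg_le (hV : S.IsLyapunov V c K) {t : ℝ} (ht : 0 ≤ t) {g : S.Config → ℝ}
    {M : ℝ} (hg : ∀ η, |g η| ≤ M) (η : S.Config) : |S.sg t g η| ≤ M := by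
  have := hV.isProbabilityMeasure ht η
  have h1 := norm_integral_le_of_norm_le_const (μ := S.transKernel t η) (f := g) (C := M)
    (ae_of_all _ hg)
  simpa [sg] using h1

lemma IsLyapunov.isProbabilityMeasure_law (hV : S.IsLyapunov V c K) {t : ℝ} (ht : 0 ≤ t)
    (ν : Measure S.Config) [IsProbabilityMeasure ν] : IsProbabilityMeasure (S.law ν t) := by
  refine ⟨?_⟩
  rw [law, Measure.bind_apply MeasurableSet.univ (Kernel.measurable _).aemeasurable]
  have : ∀ η, S.transKernel t η Set.univ = 1 := fun η =>
    (hV.isProbabilityMeasure ht η).measure_univ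
  simp [this]

lemma IsLyapunov.integral_law (hV : S.IsLyapunov V c K) {t : ℝ} (ht : 0 ≤ t)
    (ν : Measure S.Config) [IsProbabilityMeasure ν] {g : S.Config → ℝ} {M : ℝ}
    (hg : ∀ η, |g η| ≤ M) : ∫ η, g η ∂(S.law ν t) = ∫ η, S.sg t g η ∂ν := by
  have := hV.isProbabilityMeasure_law ht ν
  have h := S.integrable_of_bound (S.law ν t) hg
  rw [law, Measure.comp_eq_comp_const_apply] at h ⊢
  rw [Kernel.integral_comp h]
  rfl

lemma IsLyapunov.sg_sg (hV : S.IsLyapunov V c K) {s t : ℝ} (hs : 0 ≤ s) (ht : 0 ≤ t)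
    {g : S.Config → ℝ} {M : ℝ} (hg : ∀ η, |g η| ≤ M) (η : S.Config) :
    S.sg t (S.sg s g) η = S.sg (t + s) g η := by
  have := hV.isProbabilityMeasure ht η
  rw [sg, ← hV.integral_law hs _ hg, hV.law_transKernel hs ht, sg]

end BoundaryDrivenSystem

end

noncomputable section

namespace BoundaryDrivenSystem

variable {N : ℕ} {S : BoundaryDrivenSystem N} {V : S.Config → ℝ} {c K : ℝ}

/-! ### Small times, and the generator as a derivative -/

lemma jumpOp_mono_target {u v : S.Config → ℝ≥0∞} {η : S.Config}
    (h : ∀ m, u (target m η) ≤ v (target m η)) : S.jumpOp u η ≤ S.jumpOp v η := by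
  classical
  rw [jumpOp_eq, jumpOp_eq]
  refine Finset.sum_le_sum fun m _ => ?_
  split_ifs
  · exact le_rfl
  · gcongr
    exact h m

lemma IsLyapunov.ofReal_sg (hV : S.IsLyapunov V c K) {t : ℝ} (ht : 0 ≤ t) {f : S.Config → ℝ}
    {M : ℝ} (h0 : ∀ η, 0 ≤ f η) (hM : ∀ η, f η ≤ M) (η : S.Config) :
    ENNReal.ofReal (S.sg t f η) = S.evol t (fun ζ => ENNReal.ofReal (f ζ)) η := by
  have := hV.isProbabilityMeasure ht η
  rw [sg, ofReal_integral_eq_lintegral_ofReal, lintegral_transKernel]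
  · exact S.integrable_of_bound _ (M := M) fun η => by rw [abs_of_nonneg (h0 η)]; exact hM η
  · exact ae_of_all _ h0

lemma sg_nonneg {f : S.Config → ℝ} (h0 : ∀ η, 0 ≤ f η) (t : ℝ) (η : S.Config) :
    0 ≤ S.sg t f η := integral_nonneg h0

lemma hold_le_evol (t : ℝ) (f : S.Config → ℝ≥0∞) (η : S.Config) :
    S.holdProb η t * f η ≤ S.evol t f η := by
  rw [evol_eq]
  exact le_self_add

lemma IsLyapunov.hold_le_sg (hV : S.IsLyapunov V c K) {t : ℝ} (ht : 0 ≤ t) {f : S.Config → ℝ}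
    {M : ℝ} (h0 : ∀ η, 0 ≤ f η) (hM : ∀ η, f η ≤ M) (η : S.Config) :
    Real.exp (-(S.exitRate η * t)) * f η ≤ S.sg t f η := by
  rw [← ENNReal.ofReal_le_ofReal_iff (sg_nonneg h0 t η), hV.ofReal_sg ht h0 hM,
    ENNReal.ofReal_mul (Real.exp_pos _).le]
  exact hold_le_evol t _ η

/-- Keeps only the paths with no jump, or with one jump followed by a rest until time `t`. The bound
`Q` on the exit rates at `η` and at its neighbours makes the second contribution at least `t * exp
(-(Q * t))` times the jump term. -/
lemma IsLyapunov.le_sg (hV : S.IsLyapunov V c K) {t : ℝ} (ht : 0 ≤ t) {f : S.Config → ℝ}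
    {M : ℝ} (h0 : ∀ η, 0 ≤ f η) (hM : ∀ η, f η ≤ M) {η : S.Config} {Q : ℝ}
    (hQ : S.exitRate η ≤ Q) (hQ' : ∀ m, S.exitRate (target m η) ≤ Q) :
    Real.exp (-(S.exitRate η * t)) * f η
      + t * (Real.exp (-(Q * t)) * (S.gen f η + S.exitRate η * f η)) ≤ S.sg t f η := by
  have hpos : 0 ≤ S.gen f η + S.exitRate η * f η := by
    classical
    rw [gen_add_exitRate]
    refine Finset.sum_nonneg fun m _ => ?_
    split_ifs
    · exact le_rfl
    · exact mul_nonneg (S.rate_nonneg m η) (h0 _)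
  rw [← ENNReal.ofReal_le_ofReal_iff (sg_nonneg h0 t η), hV.ofReal_sg ht h0 hM, evol_eq,
    ENNReal.ofReal_add (mul_nonneg (Real.exp_pos _).le (h0 η))
      (mul_nonneg ht (mul_nonneg (Real.exp_pos _).le hpos)),
    ENNReal.ofReal_mul (Real.exp_pos _).le]
  refine add_le_add le_rfl ?_
  calc ENNReal.ofReal (t * (Real.exp (-(Q * t)) * (S.gen f η + S.exitRate η * f η)))
      = ∫⁻ _s in Set.Icc 0 t, ENNReal.ofReal (Real.exp (-(Q * t)))
          * S.jumpOp (fun ζ => ENNReal.ofReal (f ζ)) η := by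
        rw [setLIntegral_const, Real.volume_Icc, sub_zero, jumpOp_ofReal _ h0,
          ENNReal.ofReal_mul ht, ENNReal.ofReal_mul (Real.exp_pos _).le, mul_comm]
    _ ≤ _ := by
        refine setLIntegral_mono' measurableSet_Icc fun s hs => ?_
        have hts := sub_nonneg.2 hs.2
        have h1 : ENNReal.ofReal (Real.exp (-(Q * t)))
            ≤ S.holdProb η s * ENNReal.ofReal (Real.exp (-(Q * (t - s)))) := by
          rw [holdProb, ← ENNReal.ofReal_mul (Real.exp_pos _).le, ← Real.exp_add]
          refine ENNReal.ofReal_le_ofReal (Real.exp_le_exp.2 ?_)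
          have := mul_le_mul_of_nonneg_right hQ hs.1
          linarith
        calc _ ≤ S.holdProb η s * ENNReal.ofReal (Real.exp (-(Q * (t - s))))
              * S.jumpOp (fun ζ => ENNReal.ofReal (f ζ)) η := by gcongr
          _ ≤ _ := by
            rw [mul_assoc, ← jumpOp_const_mul]
            gcongr
            refine jumpOp_mono_target fun m => ?_
            refine le_trans ?_ (hold_le_evol (t - s) _ _)
            rw [holdProb]
            gcongr
            exact hQ' m

lemma IsLyapunov.sg_add_const (hV : S.IsLyapunov V c K) {t : ℝ} (ht : 0 ≤ t) {g : S.Config → ℝ}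
    {M : ℝ} (hg : ∀ η, |g η| ≤ M) (a : ℝ) (η : S.Config) :
    S.sg t (fun ζ => g ζ + a) η = S.sg t g η + a := by
  have := hV.isProbabilityMeasure ht η
  rw [sg, integral_add (S.integrable_of_bound _ hg) (integrable_const a)]
  simp [sg]

lemma sg_neg (t : ℝ) (g : S.Config → ℝ) (η : S.Config) :
    S.sg t (fun ζ => -g ζ) η = - S.sg t g η := integral_neg _

lemma gen_neg (g : S.Config → ℝ) (η : S.Config) :
    S.gen (fun ζ => -g ζ) η = - S.gen g η := by
  have := S.gen_const_mul (-1) g η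
  simpa using this

/-- Shifting by `M` makes the function nonnegative, so the event of no jump already gives a lower
bound. Applied to `-g` it gives the matching upper bound, linear in `t` with slope controlled by the
exit rate. -/
lemma IsLyapunov.sg_sub_ge (hV : S.IsLyapunov V c K) {t : ℝ} (ht : 0 ≤ t) {g : S.Config → ℝ}
    {M : ℝ} (hg : ∀ η, |g η| ≤ M) (η : S.Config) :
    -(2 * M * S.exitRate η * t) ≤ S.sg t g η - g η := by
  have h := hV.hold_le_sg ht (f := fun ζ => g ζ + M) (M := 2 * M)
    (fun η => by linarith [neg_le_of_abs_le (hg η)])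
    (fun η => by linarith [le_of_abs_le (hg η)]) η
  rw [hV.sg_add_const ht hg] at h
  have h1 : 1 - S.exitRate η * t ≤ Real.exp (-(S.exitRate η * t)) := by
    linarith [Real.add_one_le_exp (-(S.exitRate η * t))]
  have h2 : 0 ≤ g η + M := by linarith [neg_le_of_abs_le (hg η)]
  have h3 : g η + M ≤ 2 * M := by linarith [le_of_abs_le (hg η)]
  have h4 := mul_le_mul_of_nonneg_right h1 h2
  have h5 := mul_le_mul_of_nonneg_left h3 (mul_nonneg (S.exitRate_nonneg η) ht)
  linarith

lemma IsLyapunov.abs_sg_sub_le (hV : S.IsLyapunov V c K) {t : ℝ} (ht : 0 ≤ t)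
    {g : S.Config → ℝ} {M : ℝ} (hg : ∀ η, |g η| ≤ M) (η : S.Config) :
    |S.sg t g η - g η| ≤ 2 * M * S.exitRate η * t := by
  have h1 := hV.sg_sub_ge ht hg η
  have h2 := hV.sg_sub_ge ht (g := fun ζ => -g ζ) (M := M) (by simpa using hg) η
  rw [sg_neg] at h2
  rw [abs_le]
  constructor <;> linarith

/-- The lower half of the differentiability of the semigroup at time zero. -/
lemma IsLyapunov.exists_le_sg_sub (hV : S.IsLyapunov V c K) {g : S.Config → ℝ} {M : ℝ}
    (hg : ∀ η, |g η| ≤ M) (η : S.Config) :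
    ∃ l : ℝ → ℝ, Tendsto l (𝓝[>] 0) (𝓝 (S.gen g η)) ∧
      ∀ t, 0 < t → l t ≤ (S.sg t g η - g η) / t := by
  obtain ⟨Q, hQ⟩ := (Set.finite_range fun m => S.exitRate (target m η)).bddAbove
  set q := S.exitRate η with hq
  set Q' := max q Q
  -- The lower bound of `le_sg` for the nonnegative function `g + M`. Its value at zero is `g η + M`
  -- and its derivative there is `gen g η`, since the terms in `q * (g η + M)` cancel.
  set φ : ℝ → ℝ := fun t => Real.exp (-(q * t)) * (g η + M)
      + t * (Real.exp (-(Q' * t)) * (S.gen g η + q * (g η + M))) with hφ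
  have hd : HasDerivAt φ (S.gen g η) 0 := by
    have h1 : ∀ a : ℝ, HasDerivAt (fun t => Real.exp (-(a * t)))
        (Real.exp (-(a * 0)) * (-(a * 1))) 0 := fun a =>
      ((hasDerivAt_id (0 : ℝ)).const_mul a).neg.exp
    refine (((h1 q).mul_const (g η + M)).add ((hasDerivAt_id (0 : ℝ)).mul
      ((h1 Q').mul_const (S.gen g η + q * (g η + M))))).congr_deriv ?_
    simp
  refine ⟨fun t => t⁻¹ • (φ (0 + t) - φ 0), ?_, fun t ht => ?_⟩
  · exact (hasDerivAt_iff_tendsto_slope_zero.1 hd).mono_left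
      (nhdsWithin_mono 0 fun t (ht : 0 < t) => ht.ne')
  · have h := hV.le_sg ht.le (f := fun ζ => g ζ + M) (M := 2 * M) (η := η) (Q := Q')
      (fun η => by linarith [neg_le_of_abs_le (hg η)])
      (fun η => by linarith [le_of_abs_le (hg η)]) (le_max_left _ _)
      (fun m => (hQ ⟨m, rfl⟩).trans (le_max_right _ _))
    rw [hV.sg_add_const ht.le hg, gen_add, gen_const, add_zero] at h
    have h0 : φ 0 = g η + M := by simp [hφ]
    simp only [h0]
    rw [zero_add, smul_eq_mul, inv_mul_eq_div]
    refine div_le_div_of_nonneg_right ?_ ht.le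
    simp only [hφ]
    linarith

lemma IsLyapunov.tendsto_sg_sub_div (hV : S.IsLyapunov V c K) {g : S.Config → ℝ} {M : ℝ}
    (hg : ∀ η, |g η| ≤ M) (η : S.Config) :
    Tendsto (fun t => (S.sg t g η - g η) / t) (𝓝[>] 0) (𝓝 (S.gen g η)) := by
  obtain ⟨l, hl, hl'⟩ := hV.exists_le_sg_sub hg η
  obtain ⟨r, hr, hr'⟩ := hV.exists_le_sg_sub (g := fun ζ => -g ζ) (M := M) (by simpa using hg) η
  rw [gen_neg] at hr
  have hr2 := hr.neg
  rw [neg_neg] at hr2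
  refine tendsto_of_tendsto_of_tendsto_of_le_of_le' hl hr2 ?_ ?_
  · exact eventually_mem_nhdsWithin.mono hl'
  · refine eventually_mem_nhdsWithin.mono fun t ht => ?_
    have := hr' t ht
    rw [sg_neg] at this
    have h2 : (-S.sg t g η - -g η) / t = -((S.sg t g η - g η) / t) := by ring
    linarith

/-- Dominated convergence: the difference quotients are bounded by `2 * M * exitRate`, which is why
integrability of the exit rate is asked. -/
lemma IsLyapunov.tendsto_integral_sg (hV : S.IsLyapunov V c K) (ν : Measure S.Config)
    [IsProbabilityMeasure ν] (hν : Integrable S.exitRate ν) {g : S.Config → ℝ} {M : ℝ}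
    (hg : ∀ η, |g η| ≤ M) :
    Tendsto (fun t => (∫ η, S.sg t g η ∂ν - ∫ η, g η ∂ν) / t) (𝓝[>] 0)
      (𝓝 (∫ η, S.gen g η ∂ν)) := by
  have h : Tendsto (fun t => ∫ η, (S.sg t g η - g η) / t ∂ν) (𝓝[>] 0)
      (𝓝 (∫ η, S.gen g η ∂ν)) := by
    refine tendsto_integral_filter_of_dominated_convergence (fun η => 2 * M * S.exitRate η)
      (Eventually.of_forall fun t => Measurable.of_discrete.aestronglyMeasurable) ?_
      (hν.const_mul _) (ae_of_all _ fun η => hV.tendsto_sg_sub_div hg η)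
    refine eventually_mem_nhdsWithin.mono fun t (ht : 0 < t) => ae_of_all _ fun η => ?_
    rw [norm_div, Real.norm_eq_abs, Real.norm_of_nonneg ht.le, div_le_iff₀ ht]
    exact hV.abs_sg_sub_le ht.le hg η
  refine h.congr' (eventually_mem_nhdsWithin.mono fun t (ht : 0 < t) => ?_)
  rw [integral_div, integral_sub (S.integrable_of_bound ν fun η => hV.abs_sg_le ht.le hg η)
    (S.integrable_of_bound ν hg)]

/-- Infinitesimal invariance of a stationary measure, for bounded functions. -/
lemma IsLyapunov.integral_gen_of_bounded (hV : S.IsLyapunov V c K) {ν : Measure S.Config}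
    (hs : S.IsStationary ν) (hν : Integrable S.exitRate ν) {g : S.Config → ℝ} {M : ℝ}
    (hg : ∀ η, |g η| ≤ M) : ∫ η, S.gen g η ∂ν = 0 := by
  have := hs.1
  refine tendsto_nhds_unique (hV.tendsto_integral_sg ν hν hg) ?_
  refine tendsto_const_nhds.congr' (eventually_mem_nhdsWithin.mono fun t (ht : 0 < t) => ?_)
  simp only
  rw [← hV.integral_law ht.le ν hg, hs.2 t ht.le, sub_self, zero_div]

/-- Infinitesimal invariance of a stationary measure. -/
theorem IsLyapunov.integral_gen (hV : S.IsLyapunov V c K) {ν : Measure S.Config}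
    (hs : S.IsStationary ν) (hν : Integrable S.exitRate ν) {f : S.Config → ℝ}
    (hf : Integrable (fun η => ∑ m, S.rate m η * |f (target m η) - f η|) ν) :
    ∫ η, S.gen f η ∂ν = 0 := by
  -- Truncation at level `k` is a contraction of the real line, so the increments of `F k` along
  -- moves are dominated by those of `f`, and the bounded case passes to the limit.
  set F : ℕ → S.Config → ℝ := fun k η => max (-(k : ℝ)) (min (f η) k) with hF
  have hFb : ∀ k η, |F k η| ≤ k := fun k η => by
    rw [abs_le]
    exact ⟨le_max_left _ _, max_le (by linarith [Nat.cast_nonneg (α := ℝ) k]) (min_le_right _ _)⟩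
  have hFev : ∀ η, ∀ᶠ k in atTop, F k η = f η := fun η => by
    obtain ⟨k₀, hk₀⟩ := exists_nat_ge |f η|
    filter_upwards [eventually_ge_atTop k₀] with k hk
    have hk' : |f η| ≤ k := hk₀.trans (by exact_mod_cast hk)
    rw [abs_le] at hk'
    simp only [hF]
    rw [min_eq_left hk'.2, max_eq_right hk'.1]
  have hlip : ∀ k η ζ, |F k η - F k ζ| ≤ |f η - f ζ| := fun k η ζ => by
    have h1 := abs_max_sub_max_le_max (-(k : ℝ)) (min (f η) k) (-(k : ℝ)) (min (f ζ) k)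
    have h2 := abs_min_sub_min_le_max (f η) k (f ζ) k
    simp only [sub_self, abs_zero] at h1 h2
    refine h1.trans (max_le (abs_nonneg _) (h2.trans (max_le le_rfl (abs_nonneg _))))
  have h : Tendsto (fun k => ∫ η, S.gen (F k) η ∂ν) atTop (𝓝 (∫ η, S.gen f η ∂ν)) := by
    refine tendsto_integral_of_dominated_convergence _
      (fun k => Measurable.of_discrete.aestronglyMeasurable) hf
      (fun k => ae_of_all _ fun η => ?_) (ae_of_all _ fun η => ?_)
    · rw [gen_eq_sum]
      refine (norm_sum_le _ _).trans (Finset.sum_le_sum fun m _ => ?_)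
      rw [norm_mul, Real.norm_of_nonneg (S.rate_nonneg m η), Real.norm_eq_abs]
      exact mul_le_mul_of_nonneg_left (hlip k _ _) (S.rate_nonneg m η)
    · refine tendsto_const_nhds.congr' ?_
      have h1 : ∀ᶠ k in atTop, ∀ m, F k (target m η) = f (target m η) :=
        eventually_all.2 fun m => hFev (target m η)
      filter_upwards [h1, hFev η] with k hk1 hk2
      rw [gen_eq_sum, gen_eq_sum]
      exact Finset.sum_congr rfl fun m _ => by rw [hk1 m, hk2]
  refine tendsto_nhds_unique h ?_
  simp only [fun k => hV.integral_gen_of_bounded hs hν (hFb k)]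
  exact tendsto_const_nhds

/-- A probability measure is determined by the integrals of bounded functions. -/
lemma measure_ext_of_integral {μ ν : Measure S.Config} [IsProbabilityMeasure μ]
    [IsProbabilityMeasure ν] (h : ∀ g : S.Config → ℝ, (∀ η, |g η| ≤ 1) →
      ∫ η, g η ∂μ = ∫ η, g η ∂ν) : μ = ν := by
  refine Measure.ext_of_singleton fun ζ => ?_
  have := h (Set.indicator {ζ} 1) fun η => by
    by_cases h : η = ζ <;> simp [h]
  rw [integral_indicator_one (measurableSet_singleton ζ),
    integral_indicator_one (measurableSet_singleton ζ)] at this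
  exact (measureReal_eq_measureReal_iff).1 this

/-- Infinitesimal invariance on bounded functions implies stationarity. -/
theorem IsLyapunov.isStationary_of_integral_gen (hV : S.IsLyapunov V c K) (ν : Measure S.Config)
    [hp : IsProbabilityMeasure ν] (hν : Integrable S.exitRate ν)
    (h : ∀ g : S.Config → ℝ, (∃ M, ∀ η, |g η| ≤ M) → ∫ η, S.gen g η ∂ν = 0) :
    S.IsStationary ν := by
  refine ⟨hp, fun t ht => ?_⟩
  have := hV.isProbabilityMeasure_law ht ν
  refine measure_ext_of_integral fun g hg => ?_
  rw [hV.integral_law ht ν hg]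
  have hsg : ∀ s, 0 ≤ s → ∀ η, |S.sg s g η| ≤ 1 := fun s hs η => hV.abs_sg_le hs hg η
  have hadd : ∀ s, 0 ≤ s → ∀ r, 0 ≤ r → ∫ η, S.sg (s + r) g η ∂ν
      = ∫ η, S.sg r (S.sg s g) η ∂ν := fun s hs r hr =>
    integral_congr_ae (ae_of_all _ fun η => by
      simp only [hV.sg_sg hs hr hg, add_comm])
  have hlip : ∀ s, 0 ≤ s → ∀ r, 0 ≤ r →
      |∫ η, S.sg (s + r) g η ∂ν - ∫ η, S.sg s g η ∂ν| ≤ 2 * (∫ η, S.exitRate η ∂ν) * r := by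
    intro s hs r hr
    rw [hadd s hs r hr, ← integral_sub
      (S.integrable_of_bound ν (hV.abs_sg_le hr (hsg s hs))) (S.integrable_of_bound ν (hsg s hs))]
    refine (abs_integral_le_integral_abs).trans ?_
    calc _ ≤ ∫ η, 2 * 1 * S.exitRate η * r ∂ν := by
          refine integral_mono_of_nonneg (ae_of_all _ fun η => abs_nonneg _)
            ((hν.const_mul _).mul_const _) (ae_of_all _ fun η => ?_)
          exact hV.abs_sg_sub_le hr (hsg s hs) η
      _ = _ := by rw [integral_mul_const, integral_const_mul, mul_one]
  set Φ : ℝ → ℝ := fun s => ∫ η, S.sg s g η ∂ν with hΦ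
  -- By the semigroup property the right derivative of `Φ` at `s` is the integral of the generator
  -- applied to the bounded function `sg s g`, hence zero. Since the hypothesis covers all bounded
  -- functions, no core is needed; the Lipschitz bound supplies continuity.
  have hconst : ∀ x ∈ Set.Icc 0 t, Φ x = Φ 0 := by
    refine constant_of_has_deriv_right_zero ?_ ?_
    · set L := 2 * ∫ η, S.exitRate η ∂ν with hL
      have hL0 : 0 ≤ L := mul_nonneg zero_le_two (integral_nonneg S.exitRate_nonneg)
      have : LipschitzOnWith L.toNNReal Φ (Set.Icc 0 t) := by
        refine LipschitzOnWith.of_dist_le_mul fun x hx y hy => ?_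
        rw [Real.coe_toNNReal _ hL0, Real.dist_eq, Real.dist_eq]
        rcases le_total x y with hxy | hxy
        · have := hlip x hx.1 (y - x) (sub_nonneg.2 hxy)
          rw [add_sub_cancel] at this
          rw [abs_sub_comm, abs_sub_comm x y, abs_of_nonneg (sub_nonneg.2 hxy)]
          exact this
        · have := hlip y hy.1 (x - y) (sub_nonneg.2 hxy)
          rw [add_sub_cancel] at this
          rw [abs_of_nonneg (sub_nonneg.2 hxy)]
          exact this
      exact this.continuousOn
    · intro x hx
      rw [← hasDerivWithinAt_Ioi_iff_Ici, hasDerivWithinAt_iff_tendsto_slope' (by simp)]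
      have h1 := hV.tendsto_integral_sg ν hν (hsg x hx.1)
      rw [h _ ⟨1, hsg x hx.1⟩] at h1
      have h2 : Tendsto (fun y => y - x) (𝓝[>] x) (𝓝[>] 0) := by
        refine tendsto_nhdsWithin_iff.2 ⟨?_, ?_⟩
        · have : Tendsto (fun y => y - x) (𝓝 x) (𝓝 (x - x)) :=
            (continuous_id.sub continuous_const).tendsto x
          rw [sub_self] at this
          exact this.mono_left nhdsWithin_le_nhds
        · exact eventually_mem_nhdsWithin.mono fun y (hy : x < y) => sub_pos.2 hy
      refine (h1.comp h2).congr' (eventually_mem_nhdsWithin.mono fun y (hy : x < y) => ?_)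
      simp only [Function.comp, slope_def_field, hΦ]
      rw [← hadd x hx.1 (y - x) (sub_pos.2 hy).le, add_sub_cancel]
  rw [show ∫ η, S.sg t g η ∂ν = Φ t from rfl, hconst t ⟨ht, le_rfl⟩, hΦ]
  refine integral_congr_ae (ae_of_all _ fun η => ?_)
  have := hV.abs_sg_sub_le le_rfl hg η
  rw [mul_zero] at this
  exact sub_eq_zero.1 (abs_nonpos_iff.1 this)

end BoundaryDrivenSystem

end

noncomputable section

namespace BoundaryDrivenSystem

variable {N : ℕ} {S : BoundaryDrivenSystem N} {V : S.Config → ℝ} {c K : ℝ}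

/-! ### Harris' theorem -/

lemma IsLyapunov.integrable_transKernel (hV : S.IsLyapunov V c K) {t : ℝ} (ht : 0 ≤ t)
    (η : S.Config) : Integrable V (S.transKernel t η) := by
  refine ⟨Measurable.of_discrete.aestronglyMeasurable, ?_⟩
  rw [hasFiniteIntegral_iff_ofReal (ae_of_all _ hV.nonneg), lintegral_transKernel]
  exact (hV.evol_le ht η).trans_lt ENNReal.ofReal_lt_top

lemma IsLyapunov.sg_le (hV : S.IsLyapunov V c K) {t : ℝ} (ht : 0 ≤ t) (η : S.Config) :
    S.sg t V η ≤ Real.exp (-(c * t)) * V η + K / c := by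
  have h0 : 0 ≤ Real.exp (-(c * t)) * V η + K / c :=
    add_nonneg (mul_nonneg (Real.exp_pos _).le (hV.nonneg η)) (div_nonneg hV.K_nonneg hV.c_pos.le)
  rw [← ENNReal.ofReal_le_ofReal_iff h0, sg,
    ofReal_integral_eq_lintegral_ofReal (hV.integrable_transKernel ht η) (ae_of_all _ hV.nonneg),
    lintegral_transKernel]
  exact hV.evol_le ht η

lemma IsLyapunov.sg_le' (hV : S.IsLyapunov V c K) {t : ℝ} (ht : 0 ≤ t) (η : S.Config) :
    S.sg t V η ≤ V η + K / c := by
  refine (hV.sg_le ht η).trans ?_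
  have : Real.exp (-(c * t)) ≤ 1 := Real.exp_le_one_iff.2 (by nlinarith [hV.c_pos])
  have := mul_le_mul_of_nonneg_right this (hV.nonneg η)
  linarith

/-- A function with oscillations bounded by a weight is, up to a constant, bounded by it. -/
lemma exists_const_abs_add_le {X : Type*} [Nonempty X] {f W : X → ℝ}
    (h : ∀ x y, |f x - f y| ≤ W x + W y) : ∃ a, ∀ x, |f x + a| ≤ W x := by
  have hle : ∀ x y, f x - W x ≤ f y + W y := fun x y => by
    linarith [le_of_abs_le (h x y)]
  have hbdd : BddAbove (Set.range fun x => f x - W x) :=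
    ⟨f (Classical.arbitrary X) + W (Classical.arbitrary X), by
      rintro _ ⟨x, rfl⟩; exact hle _ _⟩
  refine ⟨-⨆ x, (f x - W x), fun x => ?_⟩
  have h1 : f x - W x ≤ ⨆ x, (f x - W x) := le_ciSup hbdd x
  have h2 : ⨆ x, (f x - W x) ≤ f x + W x := ciSup_le fun y => hle y x
  rw [abs_le]
  constructor <;> linarith

lemma mul_le_integral_of_le_measureReal {X : Type*} [MeasurableSpace X]
    [MeasurableSingletonClass X] {ν : Measure X} [IsFiniteMeasure ν] {F : X → ℝ}
    (hF : Integrable F ν) (h0 : ∀ x, 0 ≤ F x) {o : X} {ε : ℝ} (hε : ε ≤ ν.real {o}) :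
    ε * F o ≤ ∫ x, F x ∂ν := by
  calc ε * F o ≤ ν.real {o} * F o := mul_le_mul_of_nonneg_right hε (h0 o)
    _ = ∫ x in {o}, F x ∂ν := by simp [measureReal_def]
    _ ≤ _ := setIntegral_le_integral hF (ae_of_all _ h0)

/-- One step of the contraction: bounds of the semigroup at a point by means of the drift and of
the mass at a reference state. -/
lemma IsLyapunov.abs_sg_sub_const_le (hV : S.IsLyapunov V c K) {h : S.Config → ℝ} {M : ℝ}
    (hM : ∀ η, |h η| ≤ M) {C β ε : ℝ} (hC : 0 ≤ C) (hβ : 0 ≤ β) (hε0 : 0 ≤ ε)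
    (hh : ∀ η, |h η| ≤ C * (1 + β * V η)) {t : ℝ} (ht : 0 ≤ t) {x o : S.Config}
    (hε : ε ≤ (S.transKernel t x).real {o}) :
    |S.sg t h x - ε * h o| ≤ C * (1 - ε + β * S.sg t V x) := by
  have := hV.isProbabilityMeasure ht x
  have hVi := hV.integrable_transKernel ht x
  have hi := S.integrable_of_bound (S.transKernel t x) hM
  have hWi : Integrable (fun η => C * (1 + β * V η)) (S.transKernel t x) :=
    ((integrable_const _).add (hVi.const_mul _)).const_mul _
  have hW : ∫ η, C * (1 + β * V η) ∂(S.transKernel t x) = C * (1 + β * S.sg t V x) := by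
    rw [integral_const_mul, integral_add (integrable_const _) (hVi.const_mul _),
      integral_const_mul]
    simp [sg]
  have hWo : C ≤ C * (1 + β * V o) := by
    have := mul_nonneg hC (mul_nonneg hβ (hV.nonneg o))
    linarith
  have h3 := mul_le_mul_of_nonneg_left hWo hε0
  -- Both `C * (1 + β * V) + h` and `C * (1 + β * V) - h` are nonnegative, so each integral is at
  -- least `ε` times the value at `o`. The term `ε * h o` does not depend on the starting point and
  -- cancels when two starting points are compared.
  have h1 := mul_le_integral_of_le_measureReal (F := fun η => C * (1 + β * V η) + h η)
    (hWi.add hi) (fun η => by linarith [neg_le_of_abs_le (hh η)]) hε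
  have h2 := mul_le_integral_of_le_measureReal (F := fun η => C * (1 + β * V η) - h η)
    (hWi.sub hi) (fun η => by linarith [le_of_abs_le (hh η)]) hε
  rw [integral_add hWi hi, hW] at h1
  rw [integral_sub hWi hi, hW] at h2
  rw [sg, abs_le]
  constructor <;> linarith

/-- Contraction of the weighted oscillation in unit time. -/
lemma IsLyapunov.exists_contraction (hV : S.IsLyapunov V c K) {o : S.Config}
    (ho : ∀ η, 0 < S.transProb 1 η o) :
    ∃ β γ : ℝ, 0 ≤ β ∧ 0 ≤ γ ∧ γ < 1 ∧ ∀ (f : S.Config → ℝ) (M C : ℝ), (∀ η, |f η| ≤ M) →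
      0 ≤ C → (∀ x y, |f x - f y| ≤ C * (2 + β * V x + β * V y)) →
      ∀ x y, |S.sg 1 f x - S.sg 1 f y| ≤ γ * C * (2 + β * V x + β * V y) := by
  have hc := hV.c_pos
  have hK : 0 ≤ K / c := div_nonneg hV.K_nonneg hc.le
  set k := K / c with hk
  set g := Real.exp (-(c * 1)) with hg
  have hg0 : 0 < g := Real.exp_pos _
  have hg1 : g < 1 := Real.exp_lt_one_iff.2 (by linarith)
  -- Chosen so that for `V x + V y ≥ R` the drift loss `(1 - g) * (V x + V y)` exceeds the noise `2
  -- * k` by at least `(V x + V y) / R`.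
  set R := (2 * k + 1) / (1 - g) with hR
  have hg' : 0 < 1 - g := by linarith
  have hR0 : 0 < R := by positivity
  have hRg : R * (1 - g) = 2 * k + 1 := div_mul_cancel₀ _ hg'.ne'
  obtain ⟨ε, hε0, hε1, hε⟩ : ∃ ε : ℝ, 0 < ε ∧ ε ≤ 1 ∧
      ∀ x, V x ≤ R → ε ≤ (S.transKernel 1 x).real {o} := by
    obtain ⟨ε, hε0, hε⟩ : ∃ ε : ℝ, 0 < ε ∧ ∀ x ∈ (hV.finite R).toFinset,
        ε ≤ (S.transKernel 1 x).real {o} := by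
      rcases (hV.finite R).toFinset.eq_empty_or_nonempty with h | h
      · exact ⟨1, one_pos, by simp [h]⟩
      · obtain ⟨x₀, -, hx₀⟩ := Finset.exists_min_image _
          (fun x => (S.transKernel 1 x).real {o}) h
        refine ⟨_, ?_, hx₀⟩
        have := hV.isProbabilityMeasure zero_le_one x₀
        rw [measureReal_def, ENNReal.toReal_pos_iff]
        refine ⟨?_, measure_lt_top _ _⟩
        rw [transKernel_singleton]
        exact ho x₀
    refine ⟨min ε 1, by positivity, min_le_right _ _, fun x hx => ?_⟩
    exact (min_le_left _ _).trans (hε x (by simpa using hx))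
  -- With `β * R = ε` the weighted term costs at most `ε` when `V x + V y < R`, half of the gain `2
  -- * ε` obtained from the common mass at `o`.
  set β := ε / R with hβ
  have hβ0 : 0 < β := by positivity
  have hβR : β * R = ε := div_mul_cancel₀ _ hR0.ne'
  set κ := min (1 / R / 2) (min (β / 4) (ε / 2)) with hκ
  have hκ0 : 0 < κ := by positivity
  have hκ1 : κ ≤ 1 / R / 2 := min_le_left _ _
  have hκ2 : κ ≤ β / 4 := (min_le_right _ _).trans (min_le_left _ _)
  have hκ3 : κ ≤ ε / 2 := (min_le_right _ _).trans (min_le_right _ _)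
  refine ⟨β, 1 - κ, hβ0.le, by linarith, by linarith, fun f M C hM hC hf x y => ?_⟩
  have : Nonempty S.Config := ⟨o⟩
  -- The semigroup fixes constants, so `f` may be recentred: an oscillation bound becomes a
  -- pointwise bound by the weight.
  obtain ⟨a, ha⟩ := exists_const_abs_add_le (W := fun x => C * (1 + β * V x))
    (fun x y => (hf x y).trans (le_of_eq (by ring)))
  have hMa : ∀ η, |f η + a| ≤ M + |a| := fun η => (abs_add_le _ _).trans (by linarith [hM η])
  have hVx := hV.sg_le zero_le_one x
  have hVy := hV.sg_le zero_le_one y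
  rw [← hg, ← hk] at hVx hVy
  have hx0 := hV.nonneg x
  have hy0 := hV.nonneg y
  have main : ∀ ε', 0 ≤ ε' → ε' ≤ (S.transKernel 1 x).real {o} →
      ε' ≤ (S.transKernel 1 y).real {o} →
      |S.sg 1 f x - S.sg 1 f y| ≤ C * (2 - 2 * ε' + β * (g * (V x + V y) + 2 * k)) := by
    intro ε' h0 hx hy
    have h1 := hV.abs_sg_sub_const_le hMa hC hβ0.le h0 ha zero_le_one hx
    have h2 := hV.abs_sg_sub_const_le hMa hC hβ0.le h0 ha zero_le_one hy
    rw [hV.sg_add_const zero_le_one hM] at h1 h2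
    have h3 : |S.sg 1 f x - S.sg 1 f y| ≤
        C * (1 - ε' + β * S.sg 1 V x) + C * (1 - ε' + β * S.sg 1 V y) := by
      rw [abs_le] at h1 h2 ⊢
      constructor <;> linarith
    refine h3.trans ?_
    rw [← mul_add]
    refine mul_le_mul_of_nonneg_left ?_ hC
    have := mul_le_mul_of_nonneg_left (add_le_add hVx hVy) hβ0.le
    linarith
  -- Far out the drift alone contracts, with no minorization (`ε' = 0`); near the centre both points
  -- lie in the sublevel set and share mass `ε` at `o`.
  by_cases hS : R ≤ V x + V y
  · refine (main 0 le_rfl measureReal_nonneg measureReal_nonneg).trans ?_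
    rw [mul_comm (1 - κ) C, mul_assoc]
    refine mul_le_mul_of_nonneg_left ?_ hC
    set s := V x + V y with hs
    have e1 : 2 * k ≤ (1 - g) * s - 1 / R * s := by
      have : 2 * k = (1 - g) * R - 1 / R * R := by
        rw [one_div, inv_mul_cancel₀ hR0.ne']; linarith
      have h5 : 0 ≤ (1 - g) - 1 / R := by
        have h6 : 1 - g = (2 * k + 1) / R := by rw [← hRg]; field_simp
        rw [h6, ← sub_div]
        exact div_nonneg (by linarith) hR0.le
      rw [this, ← sub_mul, ← sub_mul]
      exact mul_le_mul_of_nonneg_left hS h5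
    have e2 : κ * (2 + β * s) ≤ β * (1 / R * s) := by
      have a1 : κ * (β * s) ≤ 1 / R / 2 * (β * s) :=
        mul_le_mul_of_nonneg_right hκ1 (by positivity)
      have a2 : β * (1 / R * R) ≤ β * (1 / R * s) := by gcongr
      rw [one_div, inv_mul_cancel₀ hR0.ne'] at a2
      rw [one_div] at a1 ⊢
      linarith
    have e3 := mul_le_mul_of_nonneg_left e1 hβ0.le
    linarith
  · push Not at hS
    have hx : V x ≤ R := by linarith
    have hy : V y ≤ R := by linarith
    refine (main ε hε0.le (hε x hx) (hε y hy)).trans ?_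
    rw [mul_comm (1 - κ) C, mul_assoc]
    refine mul_le_mul_of_nonneg_left ?_ hC
    have e1 : β * (g * (V x + V y) + 2 * k) ≤ β * R := by
      have : g * (V x + V y) ≤ g * R := mul_le_mul_of_nonneg_left hS.le hg0.le
      exact mul_le_mul_of_nonneg_left (by linarith) hβ0.le
    have e2 : (1 - ε / 2) * (2 + β * V x + β * V y) ≤ (1 - κ) * (2 + β * V x + β * V y) :=
      mul_le_mul_of_nonneg_right (by linarith) (by positivity)
    have e3 : 0 ≤ (1 - ε / 2) * (β * V x + β * V y) :=
      mul_nonneg (by linarith) (by positivity)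
    linarith

lemma abs_integral_sub_sum_le {X : Type*} [MeasurableSpace X] [DiscreteMeasurableSpace X]
    {ν : Measure X} [IsProbabilityMeasure ν] {f : X → ℝ} (hf : ∀ x, |f x| ≤ 1) (F : Finset X) :
    |∫ x, f x ∂ν - ∑ x ∈ F, ν.real {x} * f x| ≤ 1 - ν.real F := by
  have hi : Integrable f ν :=
    Integrable.of_bound Measurable.of_discrete.aestronglyMeasurable 1 (ae_of_all _ hf)
  have h1 : ∑ x ∈ F, ν.real {x} * f x = ∫ x in (F : Set X), f x ∂ν := by
    rw [setIntegral_finset _ hi.integrableOn]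
    rfl
  rw [h1, ← integral_add_compl (MeasurableSet.of_discrete (s := (F : Set X))) hi,
    add_sub_cancel_left]
  have h2 := norm_setIntegral_le_of_norm_le_const (μ := ν) (s := ((F : Set X))ᶜ) (f := f)
    (C := 1) (measure_lt_top _ _) (fun x _ => hf x)
  rw [one_mul, probReal_compl_eq_one_sub MeasurableSet.of_discrete] at h2
  exact h2

/-- Geometric ergodicity for bounded observables. -/
lemma IsLyapunov.exists_geometric (hV : S.IsLyapunov V c K) {o : S.Config}
    (ho : ∀ η, 0 < S.transProb 1 η o) :
    ∃ β γ : ℝ, 0 ≤ β ∧ 0 ≤ γ ∧ γ < 1 ∧ ∀ (n : ℕ) (t : ℝ), n ≤ t → ∀ f : S.Config → ℝ,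
      (∀ η, |f η| ≤ 1) → ∀ x y,
        |S.sg t f x - S.sg t f y| ≤ γ ^ n * (2 + β * V x + β * V y) := by
  obtain ⟨β, γ, hβ, hγ0, hγ1, h⟩ := hV.exists_contraction ho
  refine ⟨β, γ, hβ, hγ0, hγ1, fun n => ?_⟩
  induction n with
  | zero =>
    intro t ht f hf x y
    have ht : 0 ≤ t := by simpa using ht
    have h1 := hV.abs_sg_le ht hf x
    have h2 := hV.abs_sg_le ht hf y
    have h3 := mul_nonneg hβ (hV.nonneg x)
    have h4 := mul_nonneg hβ (hV.nonneg y)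
    rw [pow_zero, one_mul]
    refine (abs_sub _ _).trans ?_
    linarith
  | succ n ih =>
    intro t ht f hf x y
    push_cast at ht
    have hn : (0 : ℝ) ≤ n := Nat.cast_nonneg n
    have h0 : 0 ≤ t - 1 := by linarith
    have h1 := h (S.sg (t - 1) f) 1 (γ ^ n) (hV.abs_sg_le h0 hf) (by positivity)
      (ih (t - 1) (by linarith) f hf) x y
    rwa [hV.sg_sg h0 zero_le_one hf, hV.sg_sg h0 zero_le_one hf, add_sub_cancel,
      ← pow_succ'] at h1

/-- The value at time `t + u` averages the values at time `t` over the law at time `u`, under which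
`V` has mean at most `V x + K / c`, uniformly in `u`. This turns oscillation decay into a Cauchy
property in time. -/
lemma IsLyapunov.abs_sg_add_sub_le (hV : S.IsLyapunov V c K) {f : S.Config → ℝ}
    (hf : ∀ η, |f η| ≤ 1) {t u A β : ℝ} (ht : 0 ≤ t) (hu : 0 ≤ u) (hA : 0 ≤ A) (hβ : 0 ≤ β)
    (h : ∀ x y, |S.sg t f x - S.sg t f y| ≤ A * (2 + β * V x + β * V y)) (x : S.Config) :
    |S.sg (t + u) f x - S.sg t f x| ≤ A * (2 + β * V x + β * (V x + K / c)) := by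
  have := hV.isProbabilityMeasure hu x
  have hb := hV.abs_sg_le ht hf
  rw [add_comm t u, ← hV.sg_sg ht hu hf]
  have h1 : S.sg u (S.sg t f) x - S.sg t f x
      = ∫ y, (S.sg t f y - S.sg t f x) ∂(S.transKernel u x) := by
    rw [integral_sub (S.integrable_of_bound _ hb) (integrable_const _)]
    simp [sg]
  have hVi := hV.integrable_transKernel hu x
  have hi : Integrable (fun y => A * (2 + β * V y + β * V x)) (S.transKernel u x) :=
    (((integrable_const _).add (hVi.const_mul _)).add (integrable_const _)).const_mul _
  rw [h1]
  calc _ ≤ ∫ y, A * (2 + β * V y + β * V x) ∂(S.transKernel u x) :=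
        abs_integral_le_integral_abs.trans (integral_mono_of_nonneg
          (ae_of_all _ fun _ => abs_nonneg _) hi (ae_of_all _ fun y => h y x))
    _ = A * (2 + β * S.sg u V x + β * V x) := by
        have hi' : Integrable (fun y => 2 + β * V y) (S.transKernel u x) :=
          (integrable_const _).add (hVi.const_mul _)
        rw [integral_const_mul, integral_add hi' (integrable_const _), integral_add (integrable_const _) (hVi.const_mul _),
          integral_const_mul]
        simp [sg]
    _ ≤ _ := by
        have h2 := mul_le_mul_of_nonneg_left (hV.sg_le' hu x) hβ
        refine mul_le_mul_of_nonneg_left ?_ hA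
        linarith

/-- A Lyapunov function and an accessible state give a limit law with finite weight. -/
lemma IsLyapunov.exists_limit (hV : S.IsLyapunov V c K) {o : S.Config}
    (ho : ∀ η, 0 < S.transProb 1 η o) :
    ∃ μ : Measure S.Config, IsProbabilityMeasure μ ∧ Integrable V μ ∧
      ∀ f : S.Config → ℝ, (∀ η, |f η| ≤ 1) → ∀ x,
        Tendsto (fun t => S.sg t f x) atTop (𝓝 (∫ η, f η ∂μ)) := by
  classical
  obtain ⟨β, γ, hβ, hγ0, hγ1, h⟩ := hV.exists_geometric ho
  have hpow := tendsto_pow_atTop_nhds_zero_of_lt_one hγ0 hγ1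
  have hlim : ∀ f : S.Config → ℝ, (∀ η, |f η| ≤ 1) →
      ∃ l, Tendsto (fun t => S.sg t f o) atTop (𝓝 l) := by
    intro f hf
    refine cauchySeq_tendsto_of_complete (Metric.cauchySeq_iff'.2 fun ε hε => ?_)
    have h1 : Tendsto (fun n => γ ^ n * (2 + β * V o + β * (V o + K / c))) atTop (𝓝 0) := by
      simpa using hpow.mul_const (2 + β * V o + β * (V o + K / c))
    obtain ⟨n, hn⟩ := (h1.eventually (gt_mem_nhds hε)).exists
    refine ⟨n, fun t ht => ?_⟩
    have h2 := hV.abs_sg_add_sub_le hf (t := n) (u := t - n) (Nat.cast_nonneg n)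
      (sub_nonneg.2 ht) (by positivity) hβ (h n n le_rfl f hf) o
    rw [add_sub_cancel] at h2
    exact h2.trans_lt hn
  have hind : ∀ ζ η : S.Config, |Set.indicator {ζ} (1 : S.Config → ℝ) η| ≤ 1 := fun ζ η => by
    by_cases h : η = ζ <;> simp [h]
  -- The candidate law is built from the limits of the point masses. So far mass might escape;
  -- tightness below excludes it.
  choose m hm using fun ζ => hlim (Set.indicator {ζ} 1) (hind ζ)
  have hsg : ∀ t ζ, S.sg t (Set.indicator {ζ} 1) o = (S.transKernel t o).real {ζ} := fun t ζ =>
    integral_indicator_one (measurableSet_singleton ζ)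
  simp only [hsg] at hm
  have hm0 : ∀ ζ, 0 ≤ m ζ := fun ζ => ge_of_tendsto' (hm ζ) fun t => measureReal_nonneg
  set μ : Measure S.Config := Measure.sum fun ζ => ENNReal.ofReal (m ζ) • Measure.dirac ζ with hμ
  have hμs : ∀ ζ, μ {ζ} = ENNReal.ofReal (m ζ) := fun ζ => by
    rw [hμ, Measure.sum_apply _ (measurableSet_singleton ζ), tsum_eq_single ζ]
    · simp
    · intro ξ hξ
      simp [hξ]
  have hreal : ∀ ζ, μ.real {ζ} = m ζ := fun ζ => by
    rw [measureReal_def, hμs, ENNReal.toReal_ofReal (hm0 ζ)]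
  have hpt : ∀ t : ℝ, 0 ≤ t → IsProbabilityMeasure (S.transKernel t o) := fun t ht =>
    hV.isProbabilityMeasure ht o
  have hsum : ∀ F : Finset S.Config,
      Tendsto (fun t => ∑ ζ ∈ F, (S.transKernel t o).real {ζ}) atTop (𝓝 (∑ ζ ∈ F, m ζ)) :=
    fun F => tendsto_finsetSum F fun ζ _ => hm ζ
  have hsumle : ∀ F : Finset S.Config, ∑ ζ ∈ F, m ζ ≤ 1 := fun F => by
    refine le_of_tendsto (hsum F) ?_
    filter_upwards [eventually_ge_atTop 0] with t ht
    have := hpt t ht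
    rw [sum_measureReal_singleton]
    exact measureReal_le_one
  have huniv : μ Set.univ ≤ 1 := by
    rw [← lintegral_one, lintegral_countable', ENNReal.tsum_eq_iSup_sum]
    refine iSup_le fun F => ?_
    simp only [one_mul, hμs]
    rw [← ENNReal.ofReal_sum_of_nonneg fun ζ _ => hm0 ζ]
    exact ENNReal.ofReal_le_one.2 (hsumle F)
  have hfin : IsFiniteMeasure μ := ⟨huniv.trans_lt ENNReal.one_lt_top⟩
  -- A bound for the mean of `V` at every time, started from `o`. By Markov's inequality the finite
  -- set `{V ≤ R}` carries mass at least `1 - B / R` at every time, hence in the limit.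
  set B := V o + K / c with hB
  have htight : ∀ t, 0 ≤ t → ∀ R, 0 < R →
      1 - B / R ≤ (S.transKernel t o).real ((hV.finite R).toFinset : Set S.Config) := by
    intro t ht R hR
    have := hpt t ht
    have h1 := mul_meas_ge_le_integral_of_nonneg (μ := S.transKernel t o) (f := V)
      (ae_of_all _ hV.nonneg) (hV.integrable_transKernel ht o) R
    have h2 := h1.trans (hV.sg_le' ht o)
    have h3 : (S.transKernel t o).real {x | R ≤ V x} ≤ B / R := by
      rw [le_div_iff₀ hR, mul_comm]; exact h2
    have h4 : (((hV.finite R).toFinset : Set S.Config))ᶜ ⊆ {x | R ≤ V x} := by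
      intro x hx
      simp only [Set.Finite.coe_toFinset, Set.mem_compl_iff, Set.mem_ofPred_eq, not_le] at hx
      exact hx.le
    have h5 := measureReal_mono (μ := S.transKernel t o) h4
    rw [probReal_compl_eq_one_sub MeasurableSet.of_discrete] at h5
    linarith
  have htight' : ∀ R, 0 < R → 1 - B / R ≤ μ.real ((hV.finite R).toFinset : Set S.Config) := by
    intro R hR
    rw [← sum_measureReal_singleton]
    simp only [hreal]
    refine ge_of_tendsto (hsum _) ?_
    filter_upwards [eventually_ge_atTop 0] with t ht
    have := hpt t ht
    rw [sum_measureReal_singleton]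
    exact htight t ht R hR
  have hBR : Tendsto (fun R : ℝ => B / R) atTop (𝓝 0) := tendsto_const_nhds.div_atTop tendsto_id
  have hprob : IsProbabilityMeasure μ := by
    have h1 : 1 ≤ μ.real Set.univ := by
      have h2 : Tendsto (fun R : ℝ => 1 - B / R) atTop (𝓝 1) := by
        simpa using hBR.const_sub 1
      refine le_of_tendsto h2 ?_
      filter_upwards [eventually_gt_atTop 0] with R hR
      exact (htight' R hR).trans (measureReal_mono (Set.subset_univ _))
    refine ⟨le_antisymm huniv ?_⟩
    rw [measureReal_def] at h1
    exact (ENNReal.ofReal_one ▸ ENNReal.ofReal_le_iff_le_toReal (measure_ne_top _ _)).2 h1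
  refine ⟨μ, hprob, ?_, ?_⟩
  · refine ⟨Measurable.of_discrete.aestronglyMeasurable, ?_⟩
    rw [hasFiniteIntegral_iff_ofReal (ae_of_all _ hV.nonneg)]
    refine lt_of_le_of_lt ?_ (ENNReal.ofReal_lt_top (r := B))
    rw [lintegral_countable', ENNReal.tsum_eq_iSup_sum]
    refine iSup_le fun F => ?_
    have h1 : Tendsto (fun t => ∑ ζ ∈ F, V ζ * (S.transKernel t o).real {ζ}) atTop
        (𝓝 (∑ ζ ∈ F, V ζ * m ζ)) := tendsto_finsetSum F fun ζ _ => (hm ζ).const_mul _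
    -- Fatou's argument on finite sums: the uniform bound on the mean of `V` survives in the limit,
    -- which makes `V` integrable under `μ`.
    have h2 : ∑ ζ ∈ F, V ζ * m ζ ≤ B := by
      refine le_of_tendsto h1 ?_
      filter_upwards [eventually_ge_atTop 0] with t ht
      refine le_trans ?_ (hV.sg_le' ht o)
      have hi := hV.integrable_transKernel ht o
      calc _ = ∫ ζ in (F : Set S.Config), V ζ ∂(S.transKernel t o) := by
            rw [setIntegral_finset _ hi.integrableOn]
            exact Finset.sum_congr rfl fun ζ _ => mul_comm _ _
        _ ≤ _ := setIntegral_le_integral hi (ae_of_all _ hV.nonneg)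
    simp only [hμs, ← ENNReal.ofReal_mul (hV.nonneg _)]
    rw [← ENNReal.ofReal_sum_of_nonneg fun ζ _ => mul_nonneg (hV.nonneg ζ) (hm0 ζ)]
    exact ENNReal.ofReal_le_ofReal h2
  · intro f hf x
    have ho' : Tendsto (fun t => S.sg t f o) atTop (𝓝 (∫ η, f η ∂μ)) := by
      rw [Metric.tendsto_atTop']
      intro ε hε
      obtain ⟨R, hR, hR0⟩ := ((hBR.eventually (gt_mem_nhds (show 0 < ε / 3 by positivity))).and
        (eventually_gt_atTop 0)).exists
      set F := (hV.finite R).toFinset with hF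
      have h1 : Tendsto (fun t => ∑ ζ ∈ F, (S.transKernel t o).real {ζ} * f ζ) atTop
          (𝓝 (∑ ζ ∈ F, μ.real {ζ} * f ζ)) := by
        simp only [hreal]
        exact tendsto_finsetSum F fun ζ _ => (hm ζ).mul_const _
      obtain ⟨T, hT⟩ := (Metric.tendsto_atTop.1 h1) (ε / 3) (by positivity)
      refine ⟨max T 0, fun t ht => ?_⟩
      have ht0 : 0 ≤ t := (le_max_right T 0).trans ht.le
      have := hpt t ht0
      have e1 := hT t ((le_max_left T 0).trans ht.le)
      have e2 := abs_integral_sub_sum_le (ν := S.transKernel t o) hf F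
      have e3 := abs_integral_sub_sum_le (ν := μ) hf F
      have e4 := htight t ht0 R hR0
      have e5 := htight' R hR0
      rw [Real.dist_eq, abs_lt] at e1 ⊢
      rw [abs_le] at e2 e3
      rw [sg]
      constructor <;> linarith
    -- The starting point is forgotten geometrically, so the limit along `o` is the limit from every
    -- `x`.
    have hdiff : Tendsto (fun t => S.sg t f x - S.sg t f o) atTop (𝓝 0) := by
      have h1 : Tendsto (fun t : ℝ => γ ^ ⌊t⌋₊ * (2 + β * V x + β * V o)) atTop (𝓝 0) := by
        simpa using (hpow.comp tendsto_nat_floor_atTop).mul_const (2 + β * V x + β * V o)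
      refine squeeze_zero_norm' ?_ h1
      filter_upwards [eventually_ge_atTop 0] with t ht
      exact h ⌊t⌋₊ t (Nat.floor_le ht) f hf x o
    simpa using hdiff.add ho'

theorem IsLyapunov.exists_attracting (hV : S.IsLyapunov V c K) {o : S.Config}
    (ho : ∀ η, 0 < S.transProb 1 η o) :
    ∃ μ : Measure S.Config, S.IsStationary μ ∧ S.AttractsAll μ ∧ Integrable V μ := by
  obtain ⟨μ, hμ, hVμ, hlim⟩ := hV.exists_limit ho
  refine ⟨μ, ⟨hμ, fun t ht => ?_⟩, ?_, hVμ⟩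
  · have := hV.isProbabilityMeasure_law ht μ
    refine measure_ext_of_integral fun g hg => ?_
    rw [hV.integral_law ht μ hg]
    -- The limit law at `sg t g` and the time-shifted limit for `g` are limits of the same function,
    -- which gives invariance.
    have h1 := hlim (S.sg t g) (hV.abs_sg_le ht hg) o
    have h2 := (hlim g hg o).comp (tendsto_atTop_add_const_right atTop t tendsto_id)
    refine tendsto_nhds_unique h1 (h2.congr' ?_)
    filter_upwards [eventually_ge_atTop 0] with s hs
    exact (hV.sg_sg ht hs hg o).symm
  · rintro f ⟨C, hC⟩ μ' hμ'
    have hC0 : 0 ≤ C := (abs_nonneg _).trans (hC o)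
    have hg : ∀ η, |(C + 1)⁻¹ * f η| ≤ 1 := fun η => by
      rw [abs_mul, abs_of_pos (by positivity), inv_mul_le_iff₀ (by positivity)]
      linarith [hC η]
    have hpt : ∀ x, Tendsto (fun t => S.sg t f x) atTop (𝓝 (∫ η, f η ∂μ)) := fun x => by
      have := (hlim _ hg x).const_mul (C + 1)
      simp only [sg, integral_const_mul] at this
      simpa only [sg, mul_inv_cancel_left₀ (show C + 1 ≠ 0 by positivity)] using this
    have h1 : Tendsto (fun t => ∫ x, S.sg t f x ∂μ') atTop
        (𝓝 (∫ _x, (∫ η, f η ∂μ) ∂μ')) := by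
      refine tendsto_integral_filter_of_dominated_convergence (fun _ => C)
        (Eventually.of_forall fun t => Measurable.of_discrete.aestronglyMeasurable) ?_
        (integrable_const _) (ae_of_all _ hpt)
      filter_upwards [eventually_ge_atTop 0] with t ht
      exact ae_of_all _ fun η => hV.abs_sg_le ht hC η
    rw [integral_const, probReal_univ, one_smul] at h1
    refine h1.congr' ?_
    filter_upwards [eventually_ge_atTop 0] with t ht
    exact (hV.integral_law ht μ' hC).symm

lemma IsStationary.eq_of_attractsAll {μ ν : Measure S.Config} (hμ : S.IsStationary μ)
    (ha : S.AttractsAll μ) (hν : S.IsStationary ν) : ν = μ := by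
  have := hμ.1
  have := hν.1
  refine measure_ext_of_integral fun g hg => ?_
  refine tendsto_nhds_unique (tendsto_const_nhds.congr' ?_) (ha g ⟨1, hg⟩ ν hν.1)
  filter_upwards [eventually_ge_atTop 0] with t ht
  rw [hν.2 t ht]

end BoundaryDrivenSystem

end

noncomputable section

namespace BoundaryDrivenSystem

variable {N : ℕ} {S : BoundaryDrivenSystem N}

/-! ### Accessibility -/

lemma transProb_self_pos (t : ℝ) (η : S.Config) : 0 < S.transProb t η η := by
  classical
  have h := hold_le_evol t (Pi.single η 1) η
  rw [evol_single, Pi.single_eq_same, mul_one] at h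
  exact (ENNReal.ofReal_pos.2 (Real.exp_pos _)).trans_le h

/-- A jump to the target has positive density at each time `s < t` and leaves positive time `t - s`.
Positivity at all positive times is thus the form that propagates backwards along moves. -/
lemma transProb_pos_of_move {o η : S.Config} {m : Move N} (hm : S.rate m η ≠ 0)
    (h : ∀ t, 0 < t → 0 < S.transProb t (target m η) o) {t : ℝ} (ht : 0 < t) :
    0 < S.transProb t η o := by
  classical
  by_cases hη : target m η = η
  · simpa only [hη] using h t ht
  have hj : S.jumpRate η (target m η) ≠ 0 := by
    rw [jumpRate_eq]
    intro h0
    rw [Finset.sum_eq_zero_iff] at h0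
    have := h0 m (Finset.mem_univ m)
    rw [if_pos ⟨rfl, hη⟩, ENNReal.ofReal_eq_zero] at this
    exact hm (le_antisymm this (S.rate_nonneg m η))
  have hmeas : Measurable fun s => S.holdProb η s
      * S.jumpOp (S.evol (t - s) (Pi.single o 1)) η :=
    (S.holdProb_measurable η).mul (S.jumpOp_measurable (fun η' =>
      ((S.evol_measurable _ η').comp (measurable_const.sub measurable_id))) η)
  rw [← evol_single, evol_eq]
  refine lt_of_lt_of_le ?_ le_add_self
  rw [setLIntegral_pos_iff hmeas]
  refine lt_of_lt_of_le (b := volume (Set.Ico 0 t)) (by simpa using ht) (measure_mono ?_)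
  intro s hs
  refine ⟨?_, Set.Ico_subset_Icc_self hs⟩
  refine mul_ne_zero (ENNReal.ofReal_pos.2 (Real.exp_pos _)).ne' ?_
  refine (lt_of_lt_of_le ?_ (ENNReal.le_tsum (target m η))).ne'
  rw [evol_single]
  exact ENNReal.mul_pos hj (h _ (sub_pos.2 hs.2)).ne'

/-- The number of particles. -/
def size (η : S.Config) : ℕ := ∑ x, η.1 x

lemma sum_disp (m : Move N) : ∑ z, S.disp m z
    = match m with
      | .inl _ => 0
      | .inr (_, true) => -1
      | .inr (_, false) => 1 := by
  rcases m with ⟨x, y⟩ | ⟨b, _ | _⟩ <;> simp [disp]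

lemma size_target {m : Move N} {η : S.Config} (h : S.rate m η ≠ 0) :
    (size (target m η) : ℝ) = size η + ∑ z, S.disp m z := by
  simp only [size]
  push_cast
  rw [← Finset.sum_add_distrib]
  exact Finset.sum_congr rfl fun z _ => target_val h z

lemma ω_ne_zero_of_adj {x y : Fin N}
    (h : (SimpleGraph.fromRel (fun x y : Fin N => S.ω x y ≠ 0)).Adj x y) : S.ω x y ≠ 0 := by
  rw [SimpleGraph.fromRel_adj] at h
  rcases h.2 with h | h
  · exact h
  · rwa [S.ω_symm]

/-! ### Emptying or filling the system by moves of positive rate. -/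

section Closure

variable {P : S.Config → Prop} (hP : ∀ m η, S.rate m η ≠ 0 → P (target m η) → P η) {b : Bool}
  (hb : S.resRate b ≠ 0)
include hP hb

/-- Induction along a path from an occupied site to the reservoir. If the next site is empty, the
particle jumps there, since the rate factor `α + σ * 0` is nonzero; if it is occupied, nothing moves
and the argument continues with the particle found there. -/
lemma of_particle_removable (hθ : (1 + S.σ * S.resDensity b : ℝ) ≠ 0) {k : ℕ}
    (hk : ∀ η : S.Config, size η = k → P η) {x s : Fin N}
    (p : (SimpleGraph.fromRel (fun x y : Fin N => S.ω x y ≠ 0)).Walk x s) (hs : s = S.resSite b)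
    (η : S.Config) (hη : size η = k + 1) (hx : η.1 x ≠ 0) : P η := by
  induction p generalizing η with
  | nil =>
    subst hs
    have hr : S.rate (.inr (b, true)) η ≠ 0 :=
      mul_ne_zero hb (mul_ne_zero (Nat.cast_ne_zero.2 hx) hθ)
    refine hP _ _ hr (hk _ ?_)
    have := size_target hr
    rw [sum_disp, hη] at this
    push_cast at this
    exact_mod_cast (by linarith : (size (target (.inr (b, true)) η) : ℝ) = k)
  | @cons u v w huv p ih =>
    by_cases hv : η.1 v = 0
    · have hr : S.rate (.inl (u, v)) η ≠ 0 := by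
        refine mul_ne_zero (ω_ne_zero_of_adj huv) (mul_ne_zero (Nat.cast_ne_zero.2 hx) ?_)
        simp [hv, (S.α_pos v).ne']
      refine hP _ _ hr (ih hs _ ?_ ?_)
      · have := size_target hr
        rw [sum_disp, hη] at this
        exact_mod_cast (by linarith : (size (target (.inl (u, v)) η) : ℝ) = (k + 1 : ℕ))
      · have := target_val hr v
        simp only [hv, disp, huv.ne', if_true, if_false] at this
        intro h0
        rw [h0] at this
        norm_num at this
    · exact ih hs η hη hv

lemma of_empty_accessible (hθ : (1 + S.σ * S.resDensity b : ℝ) ≠ 0)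
    (h0 : ∀ η : S.Config, size η = 0 → P η) (η : S.Config) : P η := by
  induction hk : size η generalizing η with
  | zero => exact h0 η hk
  | succ k ih =>
    obtain ⟨x, hx⟩ : ∃ x, η.1 x ≠ 0 := by
      by_contra! h
      simp [size, h] at hk
    obtain ⟨p⟩ := S.connected.preconnected x (S.resSite b)
    exact of_particle_removable hP hb hθ ih p rfl η hk hx

/-- The particle–hole mirror image of `of_particle_removable`: when the next site `v` is full, a
jump from `v` to `u` carries the hole from `u` to `v`. -/
lemma of_hole_fillable (hσ : S.σ = -1) (hθ : S.resDensity b ≠ 0) {k : ℕ}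
    (hk : ∀ η : S.Config, size η + k = ∑ x, S.α x → P η) {x s : Fin N}
    (p : (SimpleGraph.fromRel (fun x y : Fin N => S.ω x y ≠ 0)).Walk x s) (hs : s = S.resSite b)
    (η : S.Config) (hη : size η + (k + 1) = ∑ x, S.α x) (hx : η.1 x ≠ S.α x) : P η := by
  have hhole : ∀ {η : S.Config} {x : Fin N}, η.1 x ≠ S.α x → (S.α x + S.σ * η.1 x : ℝ) ≠ 0 := by
    intro η x h h0
    have hσ' : (S.σ : ℝ) = -1 := by simp [hσ]
    rw [hσ'] at h0
    exact h (by exact_mod_cast (by linarith : (η.1 x : ℝ) = S.α x))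
  induction p generalizing η with
  | nil =>
    subst hs
    have hr : S.rate (.inr (b, false)) η ≠ 0 :=
      mul_ne_zero hb (mul_ne_zero hθ (hhole hx))
    refine hP _ _ hr (hk _ ?_)
    have := size_target hr
    rw [sum_disp] at this
    have h2 : size (target (.inr (b, false)) η) = size η + 1 := by
      simp only at this
      exact_mod_cast this
    omega
  | @cons u v w huv p ih =>
    by_cases hv : η.1 v = S.α v
    · have hr : S.rate (.inl (v, u)) η ≠ 0 := by
        refine mul_ne_zero (ω_ne_zero_of_adj huv.symm) (mul_ne_zero ?_ (hhole hx))
        rw [hv]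
        exact Nat.cast_ne_zero.2 (S.α_pos v).ne'
      refine hP _ _ hr (ih hs _ ?_ ?_)
      · have := size_target hr
        rw [sum_disp] at this
        have h2 : size (target (.inl (v, u)) η) = size η := by
          exact_mod_cast this.trans (add_zero _)
        omega
      · have := target_val hr v
        simp only [hv, disp, huv.ne', if_true, if_false] at this
        intro h0
        rw [h0] at this
        linarith
    · exact ih hs η hη hv

lemma of_full_accessible (hσ : S.σ = -1) (hθ : S.resDensity b ≠ 0)
    (h0 : ∀ η : S.Config, size η = ∑ x, S.α x → P η) (η : S.Config) : P η := by
  have hle : size η ≤ ∑ x, S.α x := Finset.sum_le_sum fun x _ => η.2 hσ x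
  obtain ⟨k, hk⟩ := Nat.exists_eq_add_of_le hle
  induction k generalizing η with
  | zero => exact h0 η hk.symm
  | succ k ih =>
    obtain ⟨x, hx⟩ : ∃ x, η.1 x ≠ S.α x := by
      by_contra! h
      simp [size, h] at hk
    obtain ⟨p⟩ := S.connected.preconnected x (S.resSite b)
    refine of_hole_fillable hP hb hσ hθ (k := k) (fun ζ hζ => ?_) p rfl η hk.symm hx
    exact ih ζ (by omega) hζ.symm

end Closure

lemma exists_resRate_pos (hω : 0 < max S.ωL S.ωR) : ∃ b, 0 < S.resRate b := by
  rcases lt_max_iff.1 hω with h | h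
  · exact ⟨false, mul_pos h S.αL_pos⟩
  · exact ⟨true, mul_pos h S.αR_pos⟩

/-- Some state is accessible from every state. -/
theorem exists_accessible (hω : 0 < max S.ωL S.ωR) :
    ∃ o : S.Config, ∀ η, ∀ t, 0 < t → 0 < S.transProb t η o := by
  obtain ⟨b, hb⟩ := exists_resRate_pos hω
  -- The chosen reservoir removes no particle exactly when `1 + σ θ = 0`, that is for exclusion with
  -- `θ = 1`. It then inserts, and the full configuration replaces the empty one as reference state.
  by_cases hθ : (1 + S.σ * S.resDensity b : ℝ) = 0
  · have hσ : S.σ = -1 := by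
      have h0 := S.resDensity_nonneg b
      rcases S.σ_mem with h | h | h
      · exact h
      · simp [h] at hθ
      · rw [h] at hθ; push_cast at hθ; linarith
    have hθ' : S.resDensity b ≠ 0 := by
      intro h; simp [h] at hθ
    refine ⟨⟨S.α, fun _ _ => le_rfl⟩, fun η => ?_⟩
    refine of_full_accessible (P := fun η => ∀ t, 0 < t → 0 < S.transProb t η _)
      (fun m η hm h t ht => transProb_pos_of_move hm h ht) hb.ne' hσ hθ' (fun η hη t _ => ?_) η
    have : η = ⟨S.α, fun _ _ => le_rfl⟩ := by
      refine Subtype.ext (funext fun x => ?_)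
      exact (Finset.sum_eq_sum_iff_of_le fun x _ => η.2 hσ x).1 hη x (Finset.mem_univ x)
    rw [this]
    exact transProb_self_pos t _
  · refine ⟨⟨0, fun _ _ => Nat.zero_le _⟩, fun η => ?_⟩
    refine of_empty_accessible (P := fun η => ∀ t, 0 < t → 0 < S.transProb t η _)
      (fun m η hm h t ht => transProb_pos_of_move hm h ht) hb.ne' hθ (fun η hη t _ => ?_) η
    have : η = ⟨0, fun _ _ => Nat.zero_le _⟩ := by
      refine Subtype.ext (funext fun x => ?_)
      exact Finset.sum_eq_zero_iff.1 hη x (Finset.mem_univ x)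
    rw [this]
    exact transProb_self_pos t _

end BoundaryDrivenSystem

end

noncomputable section

namespace BoundaryDrivenSystem

variable {N : ℕ} (S : BoundaryDrivenSystem N)

/-! ### The one-particle operator and the Lyapunov function -/

/-- The rate at which a dual particle is absorbed by the reservoirs. -/
def killing (x : Fin N) : ℝ := ∑ b, if x = S.resSite b then S.resRate b else 0

lemma killing_nonneg (x : Fin N) : 0 ≤ S.killing x :=
  Finset.sum_nonneg fun b _ => by
    split_ifs
    · exact S.resRate_nonneg b
    · exact le_rfl

lemma killing_pos {b : Bool} (hb : 0 < S.resRate b) : 0 < S.killing (S.resSite b) := by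
  refine Finset.sum_pos' (fun b _ => ?_) ⟨b, Finset.mem_univ b, by simpa using hb⟩
  split_ifs
  · exact S.resRate_nonneg b
  · exact le_rfl

lemma sum_killing_mul (g : Fin N → ℝ) :
    ∑ x, S.killing x * g x = ∑ b, S.resRate b * g (S.resSite b) := by
  simp only [killing, Finset.sum_mul, ite_mul, zero_mul]
  rw [Finset.sum_comm]
  simp

/-- The generator of one dual particle, killed at the reservoirs. -/
def oneParticle : (Fin N → ℝ) →ₗ[ℝ] (Fin N → ℝ) where
  toFun h x := ∑ y, S.ω x y * S.α y * (h y - h x) - S.killing x * h x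
  map_add' g h := by
    funext x
    simp only [Pi.add_apply]
    rw [← add_sub_add_comm, ← Finset.sum_add_distrib, mul_add]
    congr 1
    exact Finset.sum_congr rfl fun y _ => by ring
  map_smul' a h := by
    funext x
    simp only [Pi.smul_apply, smul_eq_mul, RingHom.id_apply, mul_sub, Finset.mul_sum]
    congr 1
    · exact Finset.sum_congr rfl fun y _ => by ring
    · ring

lemma oneParticle_apply (h : Fin N → ℝ) (x : Fin N) :
    S.oneParticle h x = ∑ y, S.ω x y * S.α y * (h y - h x) - S.killing x * h x := rfl

variable {S}

/-- The minimum principle. -/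
lemma nonneg_of_oneParticle_nonpos (hω : 0 < max S.ωL S.ωR) {h : Fin N → ℝ}
    (hh : ∀ x, S.oneParticle h x ≤ 0) (x : Fin N) : 0 ≤ h x := by
  have : Nonempty (Fin N) := ⟨S.first⟩
  obtain ⟨x₀, hx₀⟩ := Finite.exists_min h
  refine le_trans ?_ (hx₀ x)
  by_contra! hneg
  obtain ⟨b, hb⟩ := exists_resRate_pos hω
  have hterm : ∀ u, h u = h x₀ → ∀ y, 0 ≤ S.ω u y * S.α y * (h y - h u) := fun u hu y =>
    mul_nonneg (mul_nonneg (S.ω_nonneg u y) (Nat.cast_nonneg _))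
      (sub_nonneg.2 (hu ▸ hx₀ y))
  -- At a negative minimum both the walk part and the killing part of the operator are nonnegative,
  -- so both vanish: there is no killing there and the minimum spreads to the neighbours. By
  -- connectedness it reaches a site with killing.
  have hprop : ∀ u, h u = h x₀ → S.killing u = 0 ∧ ∀ v, S.ω u v ≠ 0 → h v = h x₀ := by
    intro u hu
    have h1 := hh u
    rw [oneParticle_apply] at h1
    have h2 : 0 ≤ ∑ y, S.ω u y * S.α y * (h y - h u) := Finset.sum_nonneg fun y _ => hterm u hu y
    have h3 : 0 ≤ -(S.killing u * h u) := by
      have := mul_nonneg (S.killing_nonneg u) (neg_nonneg.2 (hu ▸ hneg.le))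
      linarith
    have h4 : ∑ y, S.ω u y * S.α y * (h y - h u) = 0 := by linarith
    have h5 : S.killing u * h u = 0 := by linarith
    refine ⟨(mul_eq_zero.1 h5).resolve_right (hu ▸ hneg.ne), fun v hv => ?_⟩
    have h6 := (Finset.sum_eq_zero_iff_of_nonneg fun y _ => hterm u hu y).1 h4 v
      (Finset.mem_univ v)
    have h7 := (mul_eq_zero.1 h6).resolve_left
      (mul_ne_zero hv (Nat.cast_ne_zero.2 (S.α_pos v).ne'))
    linarith
  have hwalk : ∀ u v : Fin N,
      (SimpleGraph.fromRel (fun x y : Fin N => S.ω x y ≠ 0)).Walk u v → h u = h x₀ →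
      h v = h x₀ := by
    intro u v p
    induction p with
    | nil => exact id
    | cons huv p ih => exact fun hu => ih ((hprop _ hu).2 _ (ω_ne_zero_of_adj huv))
  obtain ⟨p⟩ := S.connected.preconnected x₀ (S.resSite b)
  exact (S.killing_pos hb).ne' (hprop _ (hwalk _ _ p rfl)).1

/-- The expected absorption time of a dual particle. -/
lemma exists_oneParticle_eq_neg_one (hω : 0 < max S.ωL S.ωR) :
    ∃ h : Fin N → ℝ, (∀ x, S.oneParticle h x = -1) ∧ ∀ x, 0 < h x := by
  have hinj : Function.Injective S.oneParticle := by
    rw [← LinearMap.ker_eq_bot, LinearMap.ker_eq_bot']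
    intro h h0
    funext x
    -- The minimum principle for `h` and `-h` gives a trivial kernel, hence surjectivity in finite
    -- dimension.
    have h1 := nonneg_of_oneParticle_nonpos hω (h := h) (fun x => by simp [h0]) x
    have h2 := nonneg_of_oneParticle_nonpos hω (h := -h) (fun x => by simp [h0]) x
    simp only [Pi.neg_apply] at h2
    simp only [Pi.zero_apply]
    linarith
  obtain ⟨h, hh⟩ := LinearMap.injective_iff_surjective.1 hinj (fun _ => -1)
  have hh' : ∀ x, S.oneParticle h x = -1 := fun x => by rw [hh]
  have h0 := nonneg_of_oneParticle_nonpos hω (h := h) (fun x => by rw [hh']; norm_num)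
  refine ⟨h, hh', fun x => lt_of_le_of_ne (h0 x) fun hx => ?_⟩
  have h1 := hh' x
  rw [oneParticle_apply, ← hx] at h1
  have h2 : 0 ≤ ∑ y, S.ω x y * S.α y * (h y - 0) := Finset.sum_nonneg fun y _ =>
    mul_nonneg (mul_nonneg (S.ω_nonneg x y) (Nat.cast_nonneg _)) (by simpa using h0 y)
  linarith

variable (S)

lemma sum_disp_mul (g : Fin N → ℝ) (m : Move N) : ∑ z, S.disp m z * g z
    = match m with
      | .inl (x, y) => g y - g x
      | .inr (b, true) => -g (S.resSite b)
      | .inr (b, false) => g (S.resSite b) := by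
  rcases m with ⟨x, y⟩ | ⟨b, _ | _⟩ <;> simp [disp, sub_mul, Finset.sum_sub_distrib]

lemma sum_moves (F : Move N → ℝ) : ∑ m, F m
    = ∑ x, ∑ y, F (.inl (x, y)) + ∑ b, (F (.inr (b, true)) + F (.inr (b, false))) := by
  rw [Fintype.sum_sum_type, Fintype.sum_prod_type, Fintype.sum_prod_type]
  simp only [Fintype.sum_bool]

/-- The drift of a linear function of the configuration is closed. -/
lemma sum_rate_mul_sum_disp (g : Fin N → ℝ) (η : S.Config) :
    ∑ m, S.rate m η * ∑ z, S.disp m z * g z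
      = ∑ x, η.1 x * S.oneParticle g x
        + ∑ b, S.resRate b * (S.resDensity b * S.α (S.resSite b) * g (S.resSite b)) := by
  simp only [sum_disp_mul]
  rw [sum_moves]
  simp only [rate]
  -- The interaction disappears here: exchanging `x` and `y` changes the sign of the summand.
  have hanti : ∑ x, ∑ y, S.ω x y * (η.1 x * η.1 y * (g y - g x)) = 0 := by
    have h1 : ∑ x, ∑ y, S.ω x y * (η.1 x * η.1 y * (g y - g x))
        = ∑ x, ∑ y, -(S.ω x y * (η.1 x * η.1 y * (g y - g x))) := by
      rw [Finset.sum_comm]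
      refine Finset.sum_congr rfl fun x _ => Finset.sum_congr rfl fun y _ => ?_
      rw [S.ω_symm]; ring
    simp only [Finset.sum_neg_distrib] at h1
    linarith
  have hbulk : ∑ x, ∑ y, S.ω x y * (η.1 x * (S.α y + S.σ * η.1 y)) * (g y - g x)
      = ∑ x, η.1 x * ∑ y, S.ω x y * S.α y * (g y - g x) := by
    have h1 : ∑ x, ∑ y, S.ω x y * (η.1 x * (S.α y + S.σ * η.1 y)) * (g y - g x)
        = ∑ x, η.1 x * ∑ y, S.ω x y * S.α y * (g y - g x)
          + S.σ * ∑ x, ∑ y, S.ω x y * (η.1 x * η.1 y * (g y - g x)) := by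
      simp only [Finset.mul_sum]
      rw [← Finset.sum_add_distrib]
      refine Finset.sum_congr rfl fun x _ => ?_
      rw [← Finset.sum_add_distrib]
      exact Finset.sum_congr rfl fun y _ => by ring
    rw [h1, hanti, mul_zero, add_zero]
  have hkill : ∑ x, η.1 x * (S.killing x * g x)
      = ∑ b, S.resRate b * (g (S.resSite b) * η.1 (S.resSite b)) := by
    rw [← S.sum_killing_mul fun x => g x * η.1 x]
    exact Finset.sum_congr rfl fun x _ => by ring
  have hone : ∑ x, η.1 x * S.oneParticle g x
      = ∑ x, η.1 x * (∑ y, S.ω x y * S.α y * (g y - g x)) - ∑ x, η.1 x * (S.killing x * g x) := by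
    rw [← Finset.sum_sub_distrib]
    exact Finset.sum_congr rfl fun x _ => by rw [oneParticle_apply]; ring
  rw [hbulk, hone, hkill, sub_add_eq_add_sub, add_sub_assoc, ← Finset.sum_sub_distrib]
  congr 1
  exact Finset.sum_congr rfl fun b _ => by ring

lemma size_eq_sum (η : S.Config) : (size η : ℝ) = ∑ z, (η.1 z : ℝ) := by
  simp [size]

lemma coord_le_size (η : S.Config) (x : Fin N) : (η.1 x : ℝ) ≤ size η := by
  rw [size_eq_sum]
  exact Finset.single_le_sum (f := fun z => (η.1 z : ℝ)) (fun z _ => Nat.cast_nonneg _)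
    (Finset.mem_univ x)

/-- The Lyapunov function attached to a weight on the sites. -/
def cubicWeight (h : Fin N → ℝ) (η : S.Config) : ℝ := (size η : ℝ) ^ 2 * ∑ z, η.1 z * h z

lemma cubicWeight_le {h : Fin N → ℝ} {H : ℝ} (hH : ∀ x, h x ≤ H) (η : S.Config) :
    ∑ z, η.1 z * h z ≤ size η * H := by
  rw [size_eq_sum, Finset.sum_mul]
  exact Finset.sum_le_sum fun z _ => mul_le_mul_of_nonneg_left (hH z) (Nat.cast_nonneg _)

lemma le_cubicWeight {h : Fin N → ℝ} {H : ℝ} (hH : ∀ x, H ≤ h x) (η : S.Config) :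
    size η * H ≤ ∑ z, η.1 z * h z := by
  rw [size_eq_sum, Finset.sum_mul]
  exact Finset.sum_le_sum fun z _ => mul_le_mul_of_nonneg_left (hH z) (Nat.cast_nonneg _)

/-- Bulk moves conserve `size`, so the square is only affected by the reservoirs. There the
highest-order factor `2 * n * v` meets the difference of the insertion and removal rates, which is
free of `σ` and bounded above, while their sum, linear in `n`, meets only linear terms. -/
lemma gen_cubicWeight (h : Fin N → ℝ) (η : S.Config) :
    S.gen (S.cubicWeight h) η
      = (size η : ℝ) ^ 2 * (∑ m, S.rate m η * ∑ z, S.disp m z * h z)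
        + ∑ b, ((S.rate (.inr (b, false)) η - S.rate (.inr (b, true)) η)
              * (2 * size η * (∑ z, η.1 z * h z) + h (S.resSite b))
            + (S.rate (.inr (b, false)) η + S.rate (.inr (b, true)) η)
              * (2 * size η * h (S.resSite b) + ∑ z, η.1 z * h z)) := by
  have h1 : S.cubicWeight h = fun ζ => (fun c : Fin N → ℝ => (∑ z, c z) ^ 2 * ∑ z, c z * h z)
      fun z => (ζ.1 z : ℝ) := by
    funext ζ; simp [cubicWeight, size_eq_sum]
  rw [h1]
  refine (S.gen_comp (fun c : Fin N → ℝ => (∑ z, c z) ^ 2 * ∑ z, c z * h z) η).trans ?_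
  set n : ℝ := (size η : ℝ) with hn
  set v : ℝ := ∑ z, η.1 z * h z with hv
  -- With `d = ∑ disp` and `e = ∑ disp * h`: `(n + d)^2 (v + e) - n^2 v = n^2 e + (2 n d + d^2)(v +
  -- e)`.
  have key : ∀ m, S.rate m η * ((fun c : Fin N → ℝ => (∑ z, c z) ^ 2 * ∑ z, c z * h z)
        (fun z => (η.1 z : ℝ) + S.disp m z)
        - (fun c : Fin N → ℝ => (∑ z, c z) ^ 2 * ∑ z, c z * h z) (fun z => (η.1 z : ℝ)))
      = n ^ 2 * (S.rate m η * ∑ z, S.disp m z * h z)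
        + S.rate m η * ((2 * n * (∑ z, S.disp m z) + (∑ z, S.disp m z) ^ 2)
          * (v + ∑ z, S.disp m z * h z)) := by
    intro m
    simp only [add_mul, Finset.sum_add_distrib, ← size_eq_sum, ← hn, ← hv]
    ring
  rw [Finset.sum_congr rfl fun m _ => key m, Finset.sum_add_distrib,
    ← Finset.mul_sum]
  congr 1
  rw [sum_moves]
  simp only [sum_disp, sum_disp_mul]
  simp only [mul_zero, zero_pow two_ne_zero, add_zero, zero_mul, Finset.sum_const_zero, zero_add]
  exact Finset.sum_congr rfl fun b _ => by ring

lemma rate_insert_sub_rate_remove (b : Bool) (η : S.Config) :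
    S.rate (.inr (b, false)) η - S.rate (.inr (b, true)) η
      = S.resRate b * (S.resDensity b * S.α (S.resSite b) - η.1 (S.resSite b)) := by
  simp only [rate]; ring

lemma rate_insert_add_rate_remove_le (b : Bool) (η : S.Config) :
    S.rate (.inr (b, false)) η + S.rate (.inr (b, true)) η
      ≤ S.resRate b * ((1 + 2 * S.resDensity b) * size η
        + S.resDensity b * S.α (S.resSite b)) := by
  simp only [rate]
  rw [← mul_add]
  refine mul_le_mul_of_nonneg_left ?_ (S.resRate_nonneg b)
  have h0 := S.resDensity_nonneg b
  have h1 := S.coord_le_size η (S.resSite b)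
  have h2 : (S.σ : ℝ) ≤ 1 := (le_abs_self _).trans S.σ_sq_le
  have h3 : (0 : ℝ) ≤ η.1 (S.resSite b) := Nat.cast_nonneg _
  have h4 : S.σ * (S.resDensity b * η.1 (S.resSite b)) ≤ 1 * (S.resDensity b * η.1 (S.resSite b)) :=
    mul_le_mul_of_nonneg_right h2 (mul_nonneg h0 h3)
  have h5 := mul_le_mul_of_nonneg_left h1 h0
  linarith

variable {S}

lemma finite_of_size_le (k : ℕ) : {η : S.Config | size η ≤ k}.Finite := by
  have h : (Set.Icc (0 : Fin N → ℕ) fun _ => k).Finite := Set.finite_Icc _ _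
  refine (h.preimage Subtype.val_injective.injOn).subset fun η hη => ?_
  refine ⟨fun x => Nat.zero_le _, fun x => le_trans ?_ hη⟩
  exact Finset.single_le_sum (f := fun z => η.1 z) (fun z _ => Nat.zero_le _) (Finset.mem_univ x)

lemma size_le_cube (η : S.Config) : (size η : ℝ) ≤ (size η : ℝ) ^ 3 := by
  exact_mod_cast Nat.le_self_pow three_ne_zero (size η)

/-- Existence of a Lyapunov function that dominates third moments. -/
theorem exists_isLyapunov (hω : 0 < max S.ωL S.ωR) :
    ∃ (V : S.Config → ℝ) (c K a : ℝ), S.IsLyapunov V c K ∧ 0 < a ∧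
      ∀ η, a * (size η : ℝ) ^ 3 ≤ V η := by
  obtain ⟨h, hh, h0⟩ := exists_oneParticle_eq_neg_one hω
  have : Nonempty (Fin N) := ⟨S.first⟩
  obtain ⟨xm, hxm⟩ := Finite.exists_min h
  obtain ⟨xM, hxM⟩ := Finite.exists_max h
  set a := h xm with ha
  set H := h xM with hH
  have ha0 : 0 < a := h0 xm
  have hH0 : 0 < H := h0 xM
  have hlow : ∀ η : S.Config, a * (size η : ℝ) ^ 3 ≤ S.cubicWeight h η := fun η => by
    have := mul_le_mul_of_nonneg_left (S.le_cubicWeight hxm η) (sq_nonneg (size η : ℝ))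
    rw [cubicWeight]
    linarith
  set A : Bool → ℝ := fun b => S.resRate b * (S.resDensity b * S.α (S.resSite b)) with hA
  set E : Bool → ℝ := fun b => S.resRate b * (1 + 2 * S.resDensity b) with hE
  have hA0 : ∀ b, 0 ≤ A b := fun b => mul_nonneg (S.resRate_nonneg b)
    (mul_nonneg (S.resDensity_nonneg b) (Nat.cast_nonneg _))
  have hE0 : ∀ b, 0 ≤ E b := fun b => mul_nonneg (S.resRate_nonneg b)
    (by linarith [S.resDensity_nonneg b])
  set C : ℝ := ∑ b, (A b * H + (2 * A b * H + 3 * (E b + A b) * H)) with hC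
  set D : ℝ := ∑ b, A b * H with hD
  have hC0 : 0 ≤ C := Finset.sum_nonneg fun b _ => by
    have := hA0 b; have := hE0 b; positivity
  have hD0 : 0 ≤ D := Finset.sum_nonneg fun b _ => mul_nonneg (hA0 b) hH0.le
  have hgen : ∀ η : S.Config, S.gen (S.cubicWeight h) η
      ≤ -(size η : ℝ) ^ 3 + C * (size η : ℝ) ^ 2 + D := by
    intro η
    set n : ℝ := (size η : ℝ) with hn
    set v : ℝ := ∑ z, η.1 z * h z with hv
    have hn0 : 0 ≤ n := Nat.cast_nonneg _
    have hn2 : n ≤ n ^ 2 := by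
      rw [hn]; exact_mod_cast Nat.le_self_pow two_ne_zero (size η)
    have hv0 : 0 ≤ v := Finset.sum_nonneg fun z _ => mul_nonneg (Nat.cast_nonneg _) (h0 z).le
    have hvH : v ≤ n * H := S.cubicWeight_le hxM η
    rw [gen_cubicWeight, sum_rate_mul_sum_disp]
    simp only [hh, mul_neg, mul_one, Finset.sum_neg_distrib, ← size_eq_sum, ← hn, ← hv]
    have hlin : ∑ b, S.resRate b * (S.resDensity b * S.α (S.resSite b) * h (S.resSite b))
        ≤ ∑ b, A b * H := by
      refine Finset.sum_le_sum fun b _ => ?_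
      rw [← mul_assoc]
      exact mul_le_mul_of_nonneg_left (hxM _) (hA0 b)
    have hres : ∑ b, ((S.rate (.inr (b, false)) η - S.rate (.inr (b, true)) η)
              * (2 * n * v + h (S.resSite b))
            + (S.rate (.inr (b, false)) η + S.rate (.inr (b, true)) η)
              * (2 * n * h (S.resSite b) + v))
        ≤ ∑ b, ((2 * A b * H + 3 * (E b + A b) * H) * n ^ 2 + A b * H) := by
      refine Finset.sum_le_sum fun b _ => ?_
      have hx := hxM (S.resSite b)
      have hx0 := (h0 (S.resSite b)).le
      have e1 : S.rate (.inr (b, false)) η - S.rate (.inr (b, true)) η ≤ A b := by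
        rw [rate_insert_sub_rate_remove]
        refine mul_le_mul_of_nonneg_left ?_ (S.resRate_nonneg b)
        linarith [(Nat.cast_nonneg (η.1 (S.resSite b)) : (0 : ℝ) ≤ _)]
      have e2 : S.rate (.inr (b, false)) η + S.rate (.inr (b, true)) η ≤ E b * n + A b := by
        refine (S.rate_insert_add_rate_remove_le b η).trans (le_of_eq ?_)
        simp only [hE, hA, hn]; ring
      have f1 : 2 * n * v + h (S.resSite b) ≤ 2 * n * (n * H) + H := by
        have := mul_le_mul_of_nonneg_left hvH hn0
        linarith
      have f2 : 2 * n * h (S.resSite b) + v ≤ 3 * n * H := by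
        have := mul_le_mul_of_nonneg_left hx hn0
        linarith
      have g1 := (mul_le_mul_of_nonneg_right e1
        (by positivity : 0 ≤ 2 * n * v + h (S.resSite b))).trans
        (mul_le_mul_of_nonneg_left f1 (hA0 b))
      have g2 := (mul_le_mul_of_nonneg_right e2
        (by positivity : 0 ≤ 2 * n * h (S.resSite b) + v)).trans
        (mul_le_mul_of_nonneg_left f2
          (add_nonneg (mul_nonneg (hE0 b) hn0) (hA0 b)))
      have g3 : A b * H * n ≤ A b * H * n ^ 2 :=
        mul_le_mul_of_nonneg_left hn2 (mul_nonneg (hA0 b) hH0.le)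
      nlinarith
    have hsq := mul_le_mul_of_nonneg_left hlin (sq_nonneg n)
    have hCs : C * n ^ 2 = n ^ 2 * ∑ b, A b * H
        + ∑ b, (2 * A b * H + 3 * (E b + A b) * H) * n ^ 2 := by
      rw [Finset.mul_sum, ← Finset.sum_add_distrib, hC, Finset.sum_mul]
      exact Finset.sum_congr rfl fun b _ => by ring
    have hres' := hres.trans_eq Finset.sum_add_distrib
    rw [hCs]
    linarith
  -- Since `V ≤ H * n ^ 3`, half of the drift `-n ^ 3` pays for `-V / (2 * H)`. The other half
  -- absorbs `C * n ^ 2` up to `4 * C ^ 3`, by comparing `n` with `2 * C`.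
  refine ⟨S.cubicWeight h, 1 / (2 * H), 4 * C ^ 3 + D, a, ⟨fun η => ?_, fun R => ?_, by positivity,
    by positivity, fun η => ?_⟩, ha0, hlow⟩
  · exact le_trans (by positivity) (hlow η)
  · obtain ⟨k, hk⟩ := exists_nat_ge (R / a)
    refine (finite_of_size_le k).subset fun η (hη : S.cubicWeight h η ≤ R) => ?_
    have h1 := (hlow η).trans hη
    have h2 : (size η : ℝ) ^ 3 ≤ R / a := by rwa [le_div_iff₀ ha0, mul_comm]
    have h3 := (size_le_cube η).trans (h2.trans hk)
    exact_mod_cast h3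
  · have h1 := hgen η
    have h2 : 1 / (2 * H) * S.cubicWeight h η ≤ (size η : ℝ) ^ 3 / 2 := by
      have h3 := mul_le_mul_of_nonneg_left (S.cubicWeight_le hxM η) (sq_nonneg (size η : ℝ))
      rw [← cubicWeight] at h3
      rw [div_mul_eq_mul_div, one_mul, div_le_iff₀ (by positivity)]
      linarith
    have h4 : C * (size η : ℝ) ^ 2 ≤ (size η : ℝ) ^ 3 / 2 + 4 * C ^ 3 := by
      have hn0 : (0 : ℝ) ≤ size η := Nat.cast_nonneg _
      rcases le_total (2 * C) (size η) with h5 | h5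
      · have := mul_le_mul_of_nonneg_right h5 (sq_nonneg (size η : ℝ))
        have : 0 ≤ C ^ 3 := by positivity
        linarith
      · have h6 : (size η : ℝ) ^ 2 ≤ (2 * C) ^ 2 := by gcongr
        have := mul_le_mul_of_nonneg_left h6 hC0
        have : 0 ≤ (size η : ℝ) ^ 3 := by positivity
        linarith
    linarith

end BoundaryDrivenSystem

end

noncomputable section

namespace BoundaryDrivenSystem

variable {N : ℕ} (S : BoundaryDrivenSystem N)

/-! ### Moment equations -/

lemma exists_rate_le : ∃ C : ℝ, 0 ≤ C ∧ ∀ m η, S.rate m η ≤ C * (1 + size η) ^ 2 := by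
  have h1 : ∀ m : Move N, ∃ C : ℝ, 0 ≤ C ∧ ∀ η, S.rate m η ≤ C * (1 + size η) ^ 2 := by
    have hσ : (S.σ : ℝ) ≤ 1 := (le_abs_self _).trans S.σ_sq_le
    have hsite : ∀ (η : S.Config) (x : Fin N),
        (S.α x + S.σ * η.1 x : ℝ) ≤ (1 + S.α x) * (1 + size η) := by
      intro η x
      have h2 := S.coord_le_size η x
      have h3 : (0 : ℝ) ≤ η.1 x := Nat.cast_nonneg _
      have h4 := mul_le_mul_of_nonneg_right hσ h3
      have h5 : (0 : ℝ) ≤ S.α x * size η := by positivity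
      linarith
    have hle1 : ∀ η : S.Config, (1 + size η : ℝ) ≤ (1 + size η) ^ 2 := fun η => by
      have : (0 : ℝ) ≤ size η := Nat.cast_nonneg _
      nlinarith
    rintro (⟨x, y⟩ | ⟨b, _ | _⟩)
    · refine ⟨S.ω x y * (1 + S.α y), mul_nonneg (S.ω_nonneg x y) (by positivity), fun η => ?_⟩
      have h2 := S.coord_le_size η x
      have h3 : (η.1 x : ℝ) * (S.α y + S.σ * η.1 y)
          ≤ (1 + size η) * ((1 + S.α y) * (1 + size η)) :=
        mul_le_mul (by linarith) (hsite η y) (S.alpha_add_nonneg η y) (by positivity)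
      refine (mul_le_mul_of_nonneg_left h3 (S.ω_nonneg x y)).trans (le_of_eq (by ring))
    · have h0 := mul_nonneg (S.resRate_nonneg b) (S.resDensity_nonneg b)
      refine ⟨S.resRate b * S.resDensity b * (1 + S.α (S.resSite b)),
        mul_nonneg h0 (by positivity), fun η => ?_⟩
      simp only [rate]
      rw [← mul_assoc]
      refine (mul_le_mul_of_nonneg_left (hsite η (S.resSite b)) h0).trans ?_
      rw [← mul_assoc]
      exact mul_le_mul_of_nonneg_left (hle1 η) (mul_nonneg h0 (by positivity))
    · have h0 := mul_nonneg (S.resRate_nonneg b) (S.one_add_resDensity_nonneg b)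
      refine ⟨S.resRate b * (1 + S.σ * S.resDensity b), h0, fun η => ?_⟩
      simp only [rate]
      rw [mul_left_comm, mul_comm]
      refine mul_le_mul_of_nonneg_left ?_ h0
      have := S.coord_le_size η (S.resSite b)
      linarith [hle1 η]
  choose C hC0 hC using h1
  refine ⟨∑ m, C m, Finset.sum_nonneg fun m _ => hC0 m, fun m η => (hC m η).trans ?_⟩
  refine mul_le_mul_of_nonneg_right ?_ (by positivity)
  exact Finset.single_le_sum (fun m _ => hC0 m) (Finset.mem_univ m)

lemma abs_disp_le_one (m : Move N) (z : Fin N) : |S.disp m z| ≤ 1 := by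
  rcases m with ⟨x, y⟩ | ⟨b, _ | _⟩ <;> simp only [disp] <;> split_ifs <;> norm_num

variable {S}
variable {ν : Measure S.Config} [IsProbabilityMeasure ν]
  (hI : Integrable (fun η : S.Config => (size η : ℝ) ^ 3) ν)

include hI

lemma integrable_of_cubic_growth {f : S.Config → ℝ} {C : ℝ}
    (h : ∀ η, |f η| ≤ C * (1 + size η) ^ 3) : Integrable f ν := by
  -- As `n` is a natural number, `n` and `n ^ 2` are at most `n ^ 3`, whence `(1 + n) ^ 3 ≤ 1 + 7 *
  -- n ^ 3`.
  have h1 : Integrable (fun η : S.Config => |C| * (1 + 7 * (size η : ℝ) ^ 3)) ν :=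
    ((integrable_const _).add (hI.const_mul 7)).const_mul _
  refine h1.mono' Measurable.of_discrete.aestronglyMeasurable (ae_of_all _ fun η => ?_)
  have h2 : (size η : ℝ) ^ 2 ≤ (size η : ℝ) ^ 3 := by
    have : size η ^ 2 ≤ size η ^ 3 := by
      rcases Nat.eq_zero_or_pos (size η) with h | h
      · simp [h]
      · exact Nat.pow_le_pow_right h (by norm_num)
    exact_mod_cast this
  have h3 := size_le_cube η
  refine (h η).trans ((mul_le_mul_of_nonneg_right (le_abs_self C) (by positivity)).trans ?_)
  refine mul_le_mul_of_nonneg_left ?_ (abs_nonneg C)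
  linarith

lemma integrable_exitRate : Integrable S.exitRate ν := by
  obtain ⟨C, hC0, hC⟩ := S.exists_rate_le
  refine integrable_of_cubic_growth hI (C := Fintype.card (Move N) * C) fun η => ?_
  rw [abs_of_nonneg (S.exitRate_nonneg η)]
  have h1 : S.totalRate η ≤ ∑ _m : Move N, C * (1 + size η) ^ 2 :=
    Finset.sum_le_sum fun m _ => hC m η
  rw [Finset.sum_const, Finset.card_univ, nsmul_eq_mul, ← mul_assoc] at h1
  refine (S.exitRate_le_totalRate η).trans (h1.trans ?_)
  refine mul_le_mul_of_nonneg_left ?_ (by positivity)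
  exact pow_le_pow_right₀ (by linarith [(Nat.cast_nonneg (size η) : (0 : ℝ) ≤ _)]) (by norm_num)

/-- Rates grow quadratically, so a linear bound on the increments is what third moments can pay for.
The bound is only needed for moves of nonzero rate, where `target_val` applies. -/
lemma integral_gen_of_growth {V : S.Config → ℝ} {c K : ℝ} (hV : S.IsLyapunov V c K)
    (hs : S.IsStationary ν) {f : S.Config → ℝ} {C : ℝ}
    (hf : ∀ η m, S.rate m η ≠ 0 → |f (target m η) - f η| ≤ C * (1 + size η)) :
    ∫ η, S.gen f η ∂ν = 0 := by
  refine hV.integral_gen hs (integrable_exitRate hI) ?_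
  obtain ⟨D, hD0, hD⟩ := S.exists_rate_le
  refine integrable_finsetSum _ fun m _ => ?_
  refine integrable_of_cubic_growth hI (C := D * |C|) fun η => ?_
  rw [abs_mul, abs_abs, abs_of_nonneg (S.rate_nonneg m η)]
  by_cases h : S.rate m η = 0
  · rw [h, zero_mul]; positivity
  · have h1 : |f (target m η) - f η| ≤ |C| * (1 + size η) :=
      (hf η m h).trans (mul_le_mul_of_nonneg_right (le_abs_self C) (by positivity))
    calc _ ≤ D * (1 + size η) ^ 2 * (|C| * (1 + size η)) :=
          mul_le_mul (hD m η) h1 (abs_nonneg _) (by positivity)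
      _ = _ := by ring

lemma integrable_coord (x : Fin N) : Integrable (fun η : S.Config => (η.1 x : ℝ)) ν := by
  refine integrable_of_cubic_growth hI (C := 1) fun η => ?_
  have h1 := S.coord_le_size η x
  have h2 : (0 : ℝ) ≤ size η := Nat.cast_nonneg _
  rw [abs_of_nonneg (Nat.cast_nonneg _), one_mul]
  have : (1 + size η : ℝ) ≤ (1 + size η) ^ 3 := le_self_pow₀ (by linarith) (by norm_num)
  linarith

lemma integrable_coord_mul (x y : Fin N) :
    Integrable (fun η : S.Config => (η.1 x : ℝ) * η.1 y) ν := by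
  refine integrable_of_cubic_growth hI (C := 1) fun η => ?_
  have h1 := S.coord_le_size η x
  have h1' := S.coord_le_size η y
  have h2 : (0 : ℝ) ≤ size η := Nat.cast_nonneg _
  rw [abs_of_nonneg (by positivity), one_mul]
  calc (η.1 x : ℝ) * η.1 y ≤ (1 + size η) * (1 + size η) :=
        mul_le_mul (by linarith) (by linarith) (Nat.cast_nonneg _) (by positivity)
    _ = (1 + size η) ^ 2 := by ring
    _ ≤ _ := pow_le_pow_right₀ (by linarith) (by norm_num)

omit hI

omit [IsProbabilityMeasure ν] in
lemma integral_coord (x : Fin N) : ∫ η, (η.1 x : ℝ) ∂ν = S.α x * S.profile ν x := by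
  have : (S.α x : ℝ) ≠ 0 := Nat.cast_ne_zero.2 (S.α_pos x).ne'
  rw [profile, integral_div, mul_div_cancel₀ _ this]

variable (S)

lemma sum_reservoirs_eq (θ : Fin N → ℝ) (x : Fin N) :
    ∑ b, (if x = S.resSite b then S.resRate b * (S.resDensity b - θ x) else 0)
      = (if x = S.first then S.ωL * S.αL * (S.θL - θ x) else 0)
        + (if x = S.last then S.ωR * S.αR * (S.θR - θ x) else 0) := by
  rw [Fintype.sum_bool, add_comm]
  rfl

lemma oneParticle_single (x w : Fin N) :
    S.oneParticle (Pi.single x 1) w = S.ω x w * S.α x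
      - if w = x then ∑ y, S.ω x y * S.α y + S.killing x else 0 := by
  rw [oneParticle_apply]
  simp only [mul_sub, Finset.sum_sub_distrib, Pi.single_apply]
  by_cases h : w = x
  · subst h; simp; ring
  · simp [h, S.ω_symm w x]

lemma sum_rate_mul_disp (x : Fin N) (η : S.Config) :
    ∑ m, S.rate m η * S.disp m x = ∑ w, η.1 w * S.oneParticle (Pi.single x 1) w
      + ∑ b, if x = S.resSite b then S.resRate b * S.resDensity b * S.α x else 0 := by
  have h := S.sum_rate_mul_sum_disp (Pi.single x 1) η
  simp only [Pi.single_apply, mul_ite, mul_one, mul_zero, Finset.sum_ite_eq', Finset.mem_univ,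
    if_true] at h
  rw [h]
  congr 1
  refine Finset.sum_congr rfl fun b _ => ?_
  by_cases hb : x = S.resSite b
  · rw [if_pos hb, if_pos hb.symm, ← hb, mul_assoc]
  · rw [if_neg hb, if_neg (Ne.symm hb)]

/-- The carré du champ of two occupation variables. -/
lemma sum_rate_mul_disp_mul_disp (x y : Fin N) (η : S.Config) :
    ∑ m, S.rate m η * (S.disp m x * S.disp m y)
      = (if x = y then ∑ z, (S.rate (.inl (x, z)) η + S.rate (.inl (z, x)) η)
          + ∑ b, (if x = S.resSite b then
              S.rate (.inr (b, true)) η + S.rate (.inr (b, false)) η else 0) else 0)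
        - (S.rate (.inl (x, y)) η + S.rate (.inl (y, x)) η) := by
  rw [sum_moves]
  have h1 : ∑ u, ∑ v, S.rate (.inl (u, v)) η * (S.disp (.inl (u, v)) x * S.disp (.inl (u, v)) y)
      = (if x = y then ∑ z, (S.rate (.inl (x, z)) η + S.rate (.inl (z, x)) η) else 0)
        - (S.rate (.inl (x, y)) η + S.rate (.inl (y, x)) η) := by
    simp only [disp]
    by_cases hxy : x = y
    · subst hxy
      simp only [mul_sub, Finset.sum_sub_distrib, mul_ite, mul_one, mul_zero]
      simp [Finset.sum_add_distrib]
      ring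
    · have hyx : y ≠ x := Ne.symm hxy
      have hpt : ∀ u v, S.rate (.inl (u, v)) η * (((if x = v then 1 else 0) - if x = u then 1 else 0)
          * ((if y = v then 1 else 0) - if y = u then 1 else 0))
          = -(if v = x then if u = y then S.rate (.inl (u, v)) η else 0 else 0)
            - (if v = y then if u = x then S.rate (.inl (u, v)) η else 0 else 0) := by
        intro u v
        by_cases h1 : x = v
        · subst h1
          by_cases h2 : y = u
          · subst h2; simp [hxy, hyx]
          · simp [hxy, hyx, h2, Ne.symm h2]
        · by_cases h2 : y = v
          · subst h2
            by_cases h3 : x = u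
            · subst h3; simp [hxy, hyx]
            · simp [hxy, hyx, h3, Ne.symm h3]
          · by_cases h3 : x = u
            · subst h3; simp [hyx, h1, h2, Ne.symm h1, Ne.symm h2]
            · simp [h1, h2, h3, Ne.symm h1, Ne.symm h2]
      simp only [hpt, Finset.sum_sub_distrib, Finset.sum_neg_distrib]
      simp [hxy]
      ring
  rw [h1]
  simp only [disp]
  by_cases hxy : x = y
  · subst hxy
    simp only [if_true]
    rw [add_sub_right_comm]
    congr 1
    refine Finset.sum_congr rfl fun b _ => ?_
    split_ifs <;> ring
  · simp only [hxy, if_false]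
    rw [Finset.sum_eq_zero, add_zero]
    intro b _
    by_cases hb : x = S.resSite b
    · have : y ≠ S.resSite b := fun h => hxy (hb.trans h.symm)
      simp [this]
    · simp [hb]

end BoundaryDrivenSystem

end

noncomputable section

namespace BoundaryDrivenSystem

variable {N : ℕ} {S : BoundaryDrivenSystem N}

/-! ### First and second moments of a stationary measure. -/

section Moments

variable {ν : Measure S.Config} [IsProbabilityMeasure ν] {V : S.Config → ℝ} {c K : ℝ}

/-- Gain and loss separated: the total coefficient of `θ x` is the rate at which a dual particle
leaves `x`, by jumping or by absorption. -/
lemma solvesProfileEquations_iff {θ : Fin N → ℝ} :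
    S.SolvesProfileEquations θ ↔ ∀ x, ∑ y, S.ω x y * S.α y * θ y
        + ∑ b, (if x = S.resSite b then S.resRate b * S.resDensity b else 0)
      = (∑ y, S.ω x y * S.α y + S.killing x) * θ x := by
  refine forall_congr' fun x => ?_
  rw [add_assoc, ← sum_reservoirs_eq]
  have h1 : ∑ b, (if x = S.resSite b then S.resRate b * (S.resDensity b - θ x) else 0)
      = ∑ b, (if x = S.resSite b then S.resRate b * S.resDensity b else 0)
        - S.killing x * θ x := by
    rw [killing, Finset.sum_mul, ← Finset.sum_sub_distrib]
    refine Finset.sum_congr rfl fun b _ => ?_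
    split_ifs <;> ring
  have h2 : ∑ y, S.ω x y * S.α y * (θ y - θ x)
      = ∑ y, S.ω x y * S.α y * θ y - (∑ y, S.ω x y * S.α y) * θ x := by
    rw [Finset.sum_mul, ← Finset.sum_sub_distrib]
    exact Finset.sum_congr rfl fun y _ => by ring
  rw [h1, h2]
  constructor <;> intro h <;> linarith

omit [IsProbabilityMeasure ν] in
lemma integral_sum_mul_oneParticle {g : S.Config → ℝ} (x : Fin N)
    (hg : ∀ w, Integrable (fun η : S.Config => g η * η.1 w) ν) (hg' : Integrable g ν) :
    ∫ η, g η * ∑ m, S.rate m η * S.disp m x ∂ν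
      = ∑ w, (∫ η, g η * η.1 w ∂ν) * S.oneParticle (Pi.single x 1) w
      + (∫ η, g η ∂ν)
        * ∑ b, if x = S.resSite b then S.resRate b * S.resDensity b * S.α x else 0 := by
  simp only [sum_rate_mul_disp, mul_add, Finset.mul_sum, ← mul_assoc]
  rw [integral_add, integral_finsetSum, integral_finsetSum]
  · congr 1
    · exact Finset.sum_congr rfl fun w _ => integral_mul_const _ _
    · exact Finset.sum_congr rfl fun b _ => integral_mul_const _ _
  · exact fun b _ => hg'.mul_const _
  · exact fun w _ => (hg w).mul_const _
  · exact integrable_finsetSum _ fun w _ => (hg w).mul_const _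
  · exact integrable_finsetSum _ fun w _ => hg'.mul_const _

variable (hI : Integrable (fun η : S.Config => (size η : ℝ) ^ 3) ν)
  (hV : S.IsLyapunov V c K) (hs : S.IsStationary ν)
include hI hV hs

lemma integral_drift_eq_zero (x : Fin N) :
    ∫ η, ∑ m, S.rate m η * S.disp m x ∂ν = 0 := by
  have h := integral_gen_of_growth hI hV hs (f := fun η : S.Config => (η.1 x : ℝ)) (C := 1)
    (fun η m hm => by
      rw [target_val hm, add_sub_cancel_left]
      have h2 : (0 : ℝ) ≤ size η := Nat.cast_nonneg _
      linarith [S.abs_disp_le_one m x])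
  rw [← h]
  refine integral_congr_ae (ae_of_all _ fun η => ?_)
  simp only
  rw [S.gen_comp (fun c => c x)]
  exact Finset.sum_congr rfl fun m _ => by ring

lemma sum_mean_mul_oneParticle (x : Fin N) :
    ∑ w, (∫ η, (η.1 w : ℝ) ∂ν) * S.oneParticle (Pi.single x 1) w
      + ∑ b, (if x = S.resSite b then S.resRate b * S.resDensity b * S.α x else 0) = 0 := by
  have h := integral_sum_mul_oneParticle (ν := ν) (g := fun _ => 1) x
    (fun w => by simpa using integrable_coord hI w) (integrable_const 1)
  simp only [one_mul, integral_const, probReal_univ, smul_eq_mul, mul_one] at h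
  rw [← h]
  exact integral_drift_eq_zero hI hV hs x

theorem solvesProfileEquations_profile : S.SolvesProfileEquations (S.profile ν) := by
  rw [solvesProfileEquations_iff]
  intro x
  have hα : (S.α x : ℝ) ≠ 0 := Nat.cast_ne_zero.2 (S.α_pos x).ne'
  have h := sum_mean_mul_oneParticle hI hV hs x
  simp only [oneParticle_single, integral_coord, mul_sub, Finset.sum_sub_distrib, mul_ite,
    mul_zero, Finset.sum_ite_eq', Finset.mem_univ, if_true] at h
  have h1 : ∑ w, S.α w * S.profile ν w * (S.ω x w * S.α x)
      = S.α x * ∑ w, S.ω x w * S.α w * S.profile ν w := by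
    rw [Finset.mul_sum]
    exact Finset.sum_congr rfl fun w _ => by ring
  have h2 : ∑ b, (if x = S.resSite b then S.resRate b * S.resDensity b * S.α x else 0)
      = S.α x * ∑ b, (if x = S.resSite b then S.resRate b * S.resDensity b else 0) := by
    rw [Finset.mul_sum]
    refine Finset.sum_congr rfl fun b _ => ?_
    split_ifs <;> ring
  rw [h1, h2] at h
  refine mul_left_cancel₀ hα ?_
  linarith

/-- Stationarity of the second moments. -/
lemma second_moment_equation (x y : Fin N) :
    ∫ η, (η.1 y : ℝ) * ∑ m, S.rate m η * S.disp m x ∂ν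
      + ∫ η, (η.1 x : ℝ) * ∑ m, S.rate m η * S.disp m y ∂ν
      + ∫ η, ∑ m, S.rate m η * (S.disp m x * S.disp m y) ∂ν = 0 := by
  have hgrow : ∀ η m, S.rate m η ≠ 0 →
      |((target m η).1 x : ℝ) * (target m η).1 y - (η.1 x : ℝ) * η.1 y| ≤ 2 * (1 + size η) := by
    intro η m hm
    rw [target_val hm, target_val hm]
    have e : ((η.1 x : ℝ) + S.disp m x) * (η.1 y + S.disp m y) - (η.1 x : ℝ) * η.1 y
        = η.1 x * S.disp m y + S.disp m x * η.1 y + S.disp m x * S.disp m y := by ring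
    have hx := S.coord_le_size η x
    have hy := S.coord_le_size η y
    have dx := S.abs_disp_le_one m x
    have dy := S.abs_disp_le_one m y
    have b1 : |(η.1 x : ℝ) * S.disp m y| ≤ size η * 1 := by
      rw [abs_mul, abs_of_nonneg (Nat.cast_nonneg _)]
      exact mul_le_mul hx dy (abs_nonneg _) (Nat.cast_nonneg _)
    have b2 : |S.disp m x * (η.1 y : ℝ)| ≤ 1 * size η := by
      rw [abs_mul, abs_of_nonneg (Nat.cast_nonneg (η.1 y) : (0 : ℝ) ≤ η.1 y)]
      exact mul_le_mul dx hy (Nat.cast_nonneg _) zero_le_one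
    have b3 : |S.disp m x * S.disp m y| ≤ 1 * 1 := by
      rw [abs_mul]
      exact mul_le_mul dx dy (abs_nonneg _) zero_le_one
    rw [e]
    refine (abs_add_three _ _ _).trans ?_
    linarith
  have h := integral_gen_of_growth hI hV hs
    (f := fun η : S.Config => (η.1 x : ℝ) * η.1 y) hgrow
  have hint : ∀ (z w : Fin N), Integrable
      (fun η : S.Config => (η.1 z : ℝ) * ∑ m, S.rate m η * S.disp m w) ν := by
    intro z w
    simp only [sum_rate_mul_disp, mul_add, Finset.mul_sum, ← mul_assoc]
    exact (integrable_finsetSum _ fun u _ => (integrable_coord_mul hI z u).mul_const _).add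
      (integrable_finsetSum _ fun b _ => (integrable_coord hI z).mul_const _)
  have hΓ : Integrable (fun η => ∑ m, S.rate m η * (S.disp m x * S.disp m y)) ν := by
    obtain ⟨C, hC0, hC⟩ := S.exists_rate_le
    refine integrable_finsetSum _ fun m _ => ?_
    refine integrable_of_cubic_growth hI (C := C) fun η => ?_
    rw [abs_mul, abs_of_nonneg (S.rate_nonneg m η), abs_mul]
    have d : |S.disp m x| * |S.disp m y| ≤ 1 * 1 :=
      mul_le_mul (S.abs_disp_le_one m x) (S.abs_disp_le_one m y) (abs_nonneg _) zero_le_one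
    have h0 : (0 : ℝ) ≤ size η := Nat.cast_nonneg _
    calc _ ≤ C * (1 + size η) ^ 2 * (1 * 1) :=
          mul_le_mul (hC m η) d (by positivity) (by positivity)
      _ = C * (1 + size η) ^ 2 := by ring
      _ ≤ _ := mul_le_mul_of_nonneg_left
          (pow_le_pow_right₀ (by linarith) (by norm_num)) hC0
  have hadd : Integrable (fun η : S.Config => (η.1 y : ℝ) * ∑ m, S.rate m η * S.disp m x
      + (η.1 x : ℝ) * ∑ m, S.rate m η * S.disp m y) ν := (hint y x).add (hint x y)
  rw [← integral_add (hint y x) (hint x y), ← integral_add hadd hΓ, ← h]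
  refine integral_congr_ae (ae_of_all _ fun η => ?_)
  simp only
  rw [S.gen_comp (fun c => c x * c y), Finset.mul_sum, Finset.mul_sum, ← Finset.sum_add_distrib,
    ← Finset.sum_add_distrib]
  exact Finset.sum_congr rfl fun m _ => by ring

/-- If distinct sites are uncorrelated, the drift of one site correlates with another site only
through the variance of the latter. -/
lemma integral_mul_drift_of_uncorrelated (hcov : ∀ x y, x ≠ y → ∫ η, (η.1 x : ℝ) * η.1 y ∂ν
      = (∫ η, (η.1 x : ℝ) ∂ν) * ∫ η, (η.1 y : ℝ) ∂ν) (x y : Fin N) :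
    ∫ η, (η.1 y : ℝ) * ∑ m, S.rate m η * S.disp m x ∂ν
      = (∫ η, (η.1 y : ℝ) * η.1 y ∂ν - (∫ η, (η.1 y : ℝ) ∂ν) * ∫ η, (η.1 y : ℝ) ∂ν)
        * S.oneParticle (Pi.single x 1) y := by
  rw [integral_sum_mul_oneParticle x (fun w => integrable_coord_mul hI y w) (integrable_coord hI y)]
  have h1 := sum_mean_mul_oneParticle hI hV hs x
  have h2 : ∑ w, (∫ η, (η.1 y : ℝ) * η.1 w ∂ν) * S.oneParticle (Pi.single x 1) w
      = (∫ η, (η.1 y : ℝ) ∂ν) * ∑ w, (∫ η, (η.1 w : ℝ) ∂ν) * S.oneParticle (Pi.single x 1) w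
        + (∫ η, (η.1 y : ℝ) * η.1 y ∂ν - (∫ η, (η.1 y : ℝ) ∂ν) * ∫ η, (η.1 y : ℝ) ∂ν)
        * S.oneParticle (Pi.single x 1) y := by
    -- After centring, only the summand `w = y` survives; the mean part cancels against the first
    -- moment equation.
    rw [Finset.mul_sum, ← sub_eq_iff_eq_add', ← Finset.sum_sub_distrib,
      Finset.sum_eq_single y]
    · ring
    · intro w _ hw
      rw [hcov y w hw.symm]
      ring
    · simp
  rw [h2, add_right_comm, ← mul_add, h1, mul_zero, zero_add]

end Moments

end BoundaryDrivenSystem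

end

noncomputable section

namespace BoundaryDrivenSystem

variable {N : ℕ} {S : BoundaryDrivenSystem N}

/-! ### Correlations out of equilibrium. -/

section Correlations

variable {ν : Measure S.Config} [IsProbabilityMeasure ν] {V : S.Config → ℝ} {c K : ℝ}
  (hI : Integrable (fun η : S.Config => (size η : ℝ) ^ 3) ν)

include hI

lemma integrable_rate (m : Move N) : Integrable (S.rate m) ν := by
  rcases m with ⟨x, y⟩ | ⟨b, _ | _⟩
  · have h : S.rate (.inl (x, y)) = fun η : S.Config =>
        S.ω x y * (S.α y * (η.1 x : ℝ) + S.σ * ((η.1 x : ℝ) * η.1 y)) := by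
      funext η; simp only [rate]; ring
    rw [h]
    exact (((integrable_coord hI x).const_mul _).add
      ((integrable_coord_mul hI x y).const_mul _)).const_mul _
  · exact (((integrable_const _).add ((integrable_coord hI _).const_mul _)).const_mul _).const_mul _
  · exact ((integrable_coord hI _).mul_const _).const_mul _

lemma integral_rate_hop (hcov : ∀ x y, x ≠ y → ∫ η, (η.1 x : ℝ) * η.1 y ∂ν
      = (∫ η, (η.1 x : ℝ) ∂ν) * ∫ η, (η.1 y : ℝ) ∂ν) (x y : Fin N) :
    ∫ η, S.rate (.inl (x, y)) η ∂ν
      = S.α x * (S.ω x y * S.α y * (S.profile ν x + S.σ * S.profile ν x * S.profile ν y)) := by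
  have h : S.rate (.inl (x, y)) = fun η : S.Config =>
      S.ω x y * (S.α y * (η.1 x : ℝ) + S.σ * ((η.1 x : ℝ) * η.1 y)) := by
    funext η; simp only [rate]; ring
  by_cases hxy : x = y
  · subst hxy
    simp [h, S.ω_self]
  · rw [h, integral_const_mul, integral_add ((integrable_coord hI x).const_mul _)
      ((integrable_coord_mul hI x y).const_mul _), integral_const_mul, integral_const_mul,
      hcov x y hxy, integral_coord, integral_coord]
    ring

lemma integral_rate_reservoir (b : Bool) :
    ∫ η, S.rate (.inr (b, true)) η ∂ν + ∫ η, S.rate (.inr (b, false)) η ∂ν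
      = S.α (S.resSite b) * (S.resRate b * (S.profile ν (S.resSite b) + S.resDensity b
        + 2 * S.σ * S.profile ν (S.resSite b) * S.resDensity b)) := by
  simp only [rate]
  rw [integral_const_mul, integral_const_mul, integral_mul_const, integral_const_mul,
    integral_add (integrable_const _) ((integrable_coord hI _).const_mul _), integral_const_mul,
    integral_coord, integral_const, probReal_univ, one_smul]
  ring

variable (hV : S.IsLyapunov V c K) (hs : S.IsStationary ν)
include hV hs

/-- Without correlations the second moment equations close on the profile and the variances. The
diagonal equations determine the variances, and the equation for a bond then leaves a square that
must vanish. -/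
lemma profile_eq_of_uncorrelated (hσ : S.σ ≠ 0)
    (hcov : ∀ x y, x ≠ y → ∫ η, (η.1 x : ℝ) * η.1 y ∂ν
      = (∫ η, (η.1 x : ℝ) ∂ν) * ∫ η, (η.1 y : ℝ) ∂ν) {x y : Fin N} (hxy : S.ω x y ≠ 0) :
    S.profile ν x = S.profile ν y := by
  set θ := S.profile ν with hθ
  set D : Fin N → ℝ := fun x => ∫ η, (η.1 x : ℝ) * η.1 x ∂ν
    - (∫ η, (η.1 x : ℝ) ∂ν) * ∫ η, (η.1 x : ℝ) ∂ν with hD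
  set κ : Fin N → ℝ := fun x => ∑ y, S.ω x y * S.α y + S.killing x with hκ
  have hα : ∀ x, (S.α x : ℝ) ≠ 0 := fun x => Nat.cast_ne_zero.2 (S.α_pos x).ne'
  have hprof := solvesProfileEquations_iff.1 (solvesProfileEquations_profile hI hV hs)
  have hrate := integral_rate_hop hI hcov
  -- The diagonal equation reads `2 κ D = α (κ θ + (1 + 2 σ θ) κ θ)`, once the incoming flux has
  -- been replaced by `κ θ` through the profile equation. At an endpoint of a bond `κ` is positive.
  have hDx : ∀ x, κ x ≠ 0 → D x = S.α x * (θ x * (1 + S.σ * θ x)) := by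
    intro x hκx
    have h := second_moment_equation hI hV hs x x
    rw [integral_mul_drift_of_uncorrelated hI hV hs hcov, oneParticle_single, S.ω_self] at h
    simp only [sum_rate_mul_disp_mul_disp, if_true] at h
    rw [integral_sub, integral_add, integral_finsetSum, integral_finsetSum, integral_add] at h
    · have h1 : ∑ z, ∫ η, (S.rate (.inl (x, z)) η + S.rate (.inl (z, x)) η) ∂ν
          = S.α x * ((∑ y, S.ω x y * S.α y) * θ x
            + (1 + 2 * S.σ * θ x) * ∑ y, S.ω x y * S.α y * θ y) := by
        rw [Finset.sum_mul, Finset.mul_sum, ← Finset.sum_add_distrib, Finset.mul_sum]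
        refine Finset.sum_congr rfl fun z _ => ?_
        rw [integral_add (integrable_rate hI _) (integrable_rate hI _), hrate, hrate,
          S.ω_symm z x, hθ]
        ring
      have h2 : ∑ b, ∫ η, (if x = S.resSite b then
            S.rate (.inr (b, true)) η + S.rate (.inr (b, false)) η else 0) ∂ν
          = S.α x * (S.killing x * θ x + (1 + 2 * S.σ * θ x)
            * ∑ b, (if x = S.resSite b then S.resRate b * S.resDensity b else 0)) := by
        rw [killing, Finset.sum_mul, Finset.mul_sum, ← Finset.sum_add_distrib, Finset.mul_sum]
        refine Finset.sum_congr rfl fun b _ => ?_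
        by_cases hb : x = S.resSite b
        · simp only [if_pos hb]
          rw [integral_add (integrable_rate hI _) (integrable_rate hI _),
            integral_rate_reservoir hI, ← hb, hθ]
          ring
        · simp [if_neg hb]
      rw [h1, h2, hrate, S.ω_self] at h
      have h3 := hprof x
      rw [← hθ] at h3
      have h4 : κ x * D x = κ x * (S.α x * (θ x * (1 + S.σ * θ x))) := by
        simp only [hκ, hD]
        have h5 := congrArg (fun r => S.α x * (1 + 2 * S.σ * θ x) * r) h3
        linarith
      exact mul_left_cancel₀ hκx h4
    · exact integrable_rate hI _
    · exact integrable_rate hI _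
    · intro b _
      by_cases hb : x = S.resSite b
      · simp only [if_pos hb]
        exact (integrable_rate hI _).add (integrable_rate hI _)
      · simp [if_neg hb]
    · exact fun z _ => (integrable_rate hI _).add (integrable_rate hI _)
    · exact integrable_finsetSum _ fun z _ => (integrable_rate hI _).add (integrable_rate hI _)
    · refine integrable_finsetSum _ fun b _ => ?_
      by_cases hb : x = S.resSite b
      · simp only [if_pos hb]
        exact (integrable_rate hI _).add (integrable_rate hI _)
      · simp [if_neg hb]
    · refine (integrable_finsetSum _ fun z _ =>
        (integrable_rate hI _).add (integrable_rate hI _)).add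
        (integrable_finsetSum _ fun b _ => ?_)
      by_cases hb : x = S.resSite b
      · simp only [if_pos hb]
        exact (integrable_rate hI _).add (integrable_rate hI _)
      · simp [if_neg hb]
    · exact (integrable_rate hI _).add (integrable_rate hI _)
  have hne : x ≠ y := by rintro rfl; exact hxy (S.ω_self x)
  have hκpos : ∀ {x y}, S.ω x y ≠ 0 → κ x ≠ 0 := by
    intro x y h
    have h1 : 0 < ∑ y, S.ω x y * S.α y := Finset.sum_pos'
      (fun z _ => mul_nonneg (S.ω_nonneg x z) (Nat.cast_nonneg _))
      ⟨y, Finset.mem_univ y, mul_pos (lt_of_le_of_ne (S.ω_nonneg x y) h.symm)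
        (Nat.cast_pos.2 (S.α_pos y))⟩
    exact (add_pos_of_pos_of_nonneg h1 (S.killing_nonneg x)).ne'
  have hx := hDx x (hκpos hxy)
  have hy := hDx y (hκpos (by rwa [S.ω_symm]))
  have h := second_moment_equation hI hV hs x y
  rw [integral_mul_drift_of_uncorrelated hI hV hs hcov,
    integral_mul_drift_of_uncorrelated hI hV hs hcov, oneParticle_single, oneParticle_single,
    if_neg hne, if_neg hne.symm] at h
  simp only [sum_rate_mul_disp_mul_disp, if_neg hne, zero_sub] at h
  rw [integral_neg, integral_add (integrable_rate hI _) (integrable_rate hI _), hrate, hrate,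
    S.ω_symm y x, ← hθ] at h
  change D y * _ + D x * _ + _ = 0 at h
  rw [hx, hy] at h
  -- The variances contribute `θ_x + θ_y + σ (θ_x^2 + θ_y^2)` and the exchange rates `-(θ_x + θ_y +
  -- 2 σ θ_x θ_y)`.
  have h6 : S.ω x y * S.α x * S.α y * S.σ * (θ x - θ y) ^ 2 = 0 := by linarith
  have hσ' : (S.σ : ℝ) ≠ 0 := Int.cast_ne_zero.2 hσ
  have h7 := (mul_eq_zero.1 h6).resolve_left
    (mul_ne_zero (mul_ne_zero (mul_ne_zero hxy (hα x)) (hα y)) hσ')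
  exact sub_eq_zero.1 (pow_eq_zero_iff two_ne_zero |>.1 h7)

/-- Out of equilibrium, interacting systems have correlated sites. -/
theorem exists_correlated (hσ : S.σ ≠ 0) (hL : 0 < S.ωL) (hR : 0 < S.ωR) (hθ : S.θL ≠ S.θR)
    (hN : 2 ≤ N) : ∃ x y : Fin N, x ≠ y ∧ ∫ η, (η.1 x : ℝ) * η.1 y ∂ν
      ≠ (∫ η, (η.1 x : ℝ) ∂ν) * ∫ η, (η.1 y : ℝ) ∂ν := by
  by_contra! hcov
  have hedge : ∀ x y, S.ω x y ≠ 0 → S.profile ν x = S.profile ν y := fun x y h =>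
    profile_eq_of_uncorrelated hI hV hs hσ hcov h
  have hwalk : ∀ u v : Fin N,
      (SimpleGraph.fromRel (fun x y : Fin N => S.ω x y ≠ 0)).Walk u v →
      S.profile ν u = S.profile ν v := by
    intro u v p
    induction p with
    | nil => rfl
    | cons huv p ih => exact (hedge _ _ (ω_ne_zero_of_adj huv)).trans ih
  have hconst : ∀ u v, S.profile ν u = S.profile ν v := fun u v => by
    obtain ⟨p⟩ := S.connected.preconnected u v
    exact hwalk u v p
  have hfl : S.first ≠ S.last := by
    intro h
    have := congrArg Fin.val h
    simp only [first, last] at this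
    omega
  have hp := solvesProfileEquations_profile hI hV hs
  -- For a constant profile the bulk sum vanishes. As `N ≥ 2`, each end site sees only its own
  -- reservoir, so the constant equals both `θL` and `θR`.
  have h1 := hp S.first
  have h2 := hp S.last
  rw [if_pos rfl, if_neg hfl, Finset.sum_eq_zero fun y _ => by
    rw [hconst y S.first, sub_self, mul_zero]] at h1
  rw [if_pos rfl, if_neg hfl.symm, Finset.sum_eq_zero fun y _ => by
    rw [hconst y S.last, sub_self, mul_zero]] at h2
  simp only [zero_add, add_zero, mul_eq_zero, hL.ne', hR.ne', S.αL_pos.ne', S.αR_pos.ne',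
    false_or, sub_eq_zero] at h1 h2
  exact hθ (h1.trans ((hconst _ _).trans h2.symm))

omit hV hs

omit [IsProbabilityMeasure ν] hI in
lemma centered_mul_eq (x y : Fin N) :
    (fun η : S.Config =>
      ((η.1 x : ℝ) / S.α x - S.profile ν x) * ((η.1 y : ℝ) / S.α y - S.profile ν y))
    = fun η => ((η.1 x : ℝ) * η.1 y) / (S.α x * S.α y) + ((η.1 x : ℝ) * -(S.profile ν y / S.α x)
      + ((η.1 y : ℝ) * -(S.profile ν x / S.α y) + S.profile ν x * S.profile ν y)) := by
  have hx : (S.α x : ℝ) ≠ 0 := Nat.cast_ne_zero.2 (S.α_pos x).ne'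
  have hy : (S.α y : ℝ) ≠ 0 := Nat.cast_ne_zero.2 (S.α_pos y).ne'
  funext η
  field_simp
  ring

lemma integrable_centered_mul (x y : Fin N) :
    Integrable (fun η : S.Config =>
      ((η.1 x : ℝ) / S.α x - S.profile ν x) * ((η.1 y : ℝ) / S.α y - S.profile ν y)) ν := by
  rw [centered_mul_eq]
  exact ((integrable_coord_mul hI x y).div_const _).add (((integrable_coord hI x).mul_const _).add
    (((integrable_coord hI y).mul_const _).add (integrable_const _)))

lemma integral_centered_mul (x y : Fin N) :
    ∫ η, ((η.1 x : ℝ) / S.α x - S.profile ν x) * ((η.1 y : ℝ) / S.α y - S.profile ν y) ∂ν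
      = (∫ η, (η.1 x : ℝ) * η.1 y ∂ν - (∫ η, (η.1 x : ℝ) ∂ν) * ∫ η, (η.1 y : ℝ) ∂ν)
        / (S.α x * S.α y) := by
  have hx : (S.α x : ℝ) ≠ 0 := Nat.cast_ne_zero.2 (S.α_pos x).ne'
  have hy : (S.α y : ℝ) ≠ 0 := Nat.cast_ne_zero.2 (S.α_pos y).ne'
  have i1 := (integrable_coord_mul hI x y).div_const (S.α x * S.α y : ℝ)
  have i2 := (integrable_coord hI x).mul_const (-(S.profile ν y / S.α x))
  have i3 : Integrable (fun η : S.Config => (η.1 y : ℝ) * -(S.profile ν x / S.α y)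
      + S.profile ν x * S.profile ν y) ν :=
    ((integrable_coord hI y).mul_const _).add (integrable_const _)
  have i4 : Integrable (fun η : S.Config => (η.1 x : ℝ) * -(S.profile ν y / S.α x)
      + ((η.1 y : ℝ) * -(S.profile ν x / S.α y) + S.profile ν x * S.profile ν y)) ν := i2.add i3
  rw [centered_mul_eq, integral_add i1 i4, integral_add i2 i3,
    integral_add ((integrable_coord hI y).mul_const _) (integrable_const _), integral_div,
    integral_mul_const, integral_mul_const, integral_coord, integral_coord, integral_const,
    probReal_univ, one_smul]
  field_simp
  ring

omit hI

omit [IsProbabilityMeasure ν] in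
/-- Under a product measure distinct sites are uncorrelated. -/
lemma integral_coord_mul_of_isProductOf {ρ : Fin N → Measure ℕ} [∀ x, IsProbabilityMeasure (ρ x)]
    (h : S.IsProductOf ν ρ) {x y : Fin N} (hxy : x ≠ y) :
    ∫ η, (η.1 x : ℝ) * η.1 y ∂ν = (∫ η, (η.1 x : ℝ) ∂ν) * ∫ η, (η.1 y : ℝ) ∂ν := by
  have hmap : ∀ f : (Fin N → ℕ) → ℝ, ∫ η : S.Config, f η.1 ∂ν = ∫ ζ, f ζ ∂(Measure.pi ρ) := by
    intro f
    rw [← h, integral_map measurable_subtype_coe.aemeasurable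
      Measurable.of_discrete.aestronglyMeasurable]
  have hind := iIndepFun_pi (μ := ρ) (X := fun _ (k : ℕ) => (k : ℝ))
    (fun x => Measurable.of_discrete.aemeasurable)
  rw [hmap fun ζ => (ζ x : ℝ) * ζ y, hmap fun ζ => (ζ x : ℝ), hmap fun ζ => (ζ y : ℝ)]
  exact (hind.indepFun hxy).integral_mul_eq_mul_integral
    Measurable.of_discrete.aestronglyMeasurable Measurable.of_discrete.aestronglyMeasurable

end Correlations

end BoundaryDrivenSystem

end

noncomputable section

/-! ### Products of Poisson measures -/

lemma poissonMeasure_singleton_succ (r : ℝ≥0) (n : ℕ) :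
    ((n + 1 : ℕ) : ℝ≥0∞) * poissonMeasure r {n + 1} = r * poissonMeasure r {n} := by
  rw [poissonMeasure_singleton, poissonMeasure_singleton, ← ENNReal.ofReal_natCast,
    ← ENNReal.ofReal_coe_nnreal, ← ENNReal.ofReal_mul (Nat.cast_nonneg _),
    ← ENNReal.ofReal_mul r.coe_nonneg]
  congr 1
  rw [Nat.factorial_succ]
  push_cast
  have : (n.factorial : ℝ) ≠ 0 := Nat.cast_ne_zero.2 n.factorial_ne_zero
  field_simp
  ring

/-- Mecke's formula for a product of Poisson measures. -/
lemma lintegral_pi_poisson {ι : Type*} [Fintype ι] [DecidableEq ι] (r : ι → ℝ≥0) (x : ι)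
    (F : (ι → ℕ) → ℝ≥0∞) :
    ∫⁻ ζ, (ζ x : ℝ≥0∞) * F ζ ∂(Measure.pi fun i => poissonMeasure (r i))
      = r x * ∫⁻ ζ, F (Function.update ζ x (ζ x + 1))
        ∂(Measure.pi fun i => poissonMeasure (r i)) := by
  set p : (ι → ℕ) → ℝ≥0∞ := fun ζ => ∏ i, poissonMeasure (r i) {ζ i} with hp
  have hinj : Function.Injective fun ζ : ι → ℕ => Function.update ζ x (ζ x + 1) := by
    intro ζ ξ h
    funext i
    have := congrFun h i
    by_cases hi : i = x
    · subst hi; simpa using this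
    · simpa [hi] using this
  rw [lintegral_countable', lintegral_countable', ← ENNReal.tsum_mul_left]
  simp only [Measure.pi_singleton]
  -- Reindexing by the shift `ζ ↦ ζ + δ_x`: its range consists of the configurations with `ζ x ≠ 0`,
  -- and elsewhere the factor `ζ x` kills the summand.
  rw [← hinj.tsum_eq]
  · refine tsum_congr fun ζ => ?_
    have hprod : ∀ ξ : ι → ℕ, ∏ i, poissonMeasure (r i) {ξ i}
        = poissonMeasure (r x) {ξ x} * ∏ i ∈ Finset.univ.erase x, poissonMeasure (r i) {ξ i} :=
      fun ξ => (Finset.mul_prod_erase _ _ (Finset.mem_univ x)).symm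
    have herase : ∏ i ∈ Finset.univ.erase x, poissonMeasure (r i)
          {Function.update ζ x (ζ x + 1) i}
        = ∏ i ∈ Finset.univ.erase x, poissonMeasure (r i) {ζ i} :=
      Finset.prod_congr rfl fun i hi => by
        rw [Function.update_of_ne (Finset.ne_of_mem_erase hi)]
    rw [hprod, hprod ζ, herase, Function.update_self]
    have := poissonMeasure_singleton_succ (r x) (ζ x)
    calc _ = (((ζ x + 1 : ℕ) : ℝ≥0∞) * poissonMeasure (r x) {ζ x + 1})
          * (F (Function.update ζ x (ζ x + 1))
            * ∏ i ∈ Finset.univ.erase x, poissonMeasure (r i) {ζ i}) := by ring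
      _ = _ := by rw [this]; ring
  · intro ζ hζ
    have h0 : ζ x ≠ 0 := by
      intro h
      simp [h] at hζ
    refine ⟨Function.update ζ x (ζ x - 1), ?_⟩
    simp [Nat.sub_add_cancel (Nat.one_le_iff_ne_zero.2 h0)]

namespace BoundaryDrivenSystem

variable {N : ℕ} {S : BoundaryDrivenSystem N}

lemma insert_val (h0 : S.σ = 0) (η : S.Config) (x : Fin N) :
    (insert η x).1 = Function.update η.1 x (η.1 x + 1) :=
  moveTo_val fun h => by simp [h0] at h

lemma remove_insert (h0 : S.σ = 0) (η : S.Config) (x : Fin N) : remove (insert η x) x = η := by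
  refine Subtype.ext ?_
  rw [remove, moveTo_val (fun h => by simp [h0] at h), insert_val h0]
  simp

/-- Mecke's formula replaces the weight `η x` by an added particle at `x`; a hop out of `x` then
amounts to inserting at the arrival site instead, and a removal at `x` undoes the insertion. -/
lemma hop_insert (h0 : S.σ = 0) (η : S.Config) (x y : Fin N) : hop (insert η x) x y = insert η y := by
  refine Subtype.ext ?_
  have h1 : (insert η x).1 x ≠ 0 := by simp [insert_val h0]
  rw [hop, if_neg h1, moveTo_val (fun h => by simp [h0] at h), insert_val h0, insert_val h0]
  funext z
  simp only [Pi.add_apply, Pi.sub_apply, Pi.single_apply, Function.update_apply]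
  by_cases hx : z = x
  · subst hx
    by_cases hy : z = y
    · subst hy; simp
    · simp [hy]
  · by_cases hy : z = y
    · subst hy; simp [hx]
    · simp [hx, hy]

/-- The product of Poisson measures as a measure on the configurations of independent walkers. -/
def poissonProduct (h0 : S.σ = 0) (r : Fin N → ℝ≥0) : Measure S.Config :=
  (Measure.pi fun x => poissonMeasure (r x)).map fun ζ => ⟨ζ, fun h => by simp [h0] at h⟩

variable (h0 : S.σ = 0) (r : Fin N → ℝ≥0)

instance : IsProbabilityMeasure (poissonProduct h0 r) :=
  Measure.isProbabilityMeasure_map Measurable.of_discrete.aemeasurable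

lemma poissonProduct_isProductOf :
    S.IsProductOf (poissonProduct h0 r) fun x => poissonMeasure (r x) := by
  rw [IsProductOf, poissonProduct, Measure.map_map measurable_subtype_coe Measurable.of_discrete]
  exact Measure.map_id

lemma lintegral_poissonProduct (x : Fin N) (F : S.Config → ℝ≥0∞) :
    ∫⁻ η, (η.1 x : ℝ≥0∞) * F η ∂(poissonProduct h0 r)
      = r x * ∫⁻ η, F (insert η x) ∂(poissonProduct h0 r) := by
  rw [poissonProduct, lintegral_map Measurable.of_discrete Measurable.of_discrete,
    lintegral_map Measurable.of_discrete Measurable.of_discrete]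
  refine (lintegral_pi_poisson r x fun ζ => F ⟨ζ, fun h => by simp [h0] at h⟩).trans ?_
  congr 1
  refine lintegral_congr fun ζ => ?_
  congr 1
  refine Subtype.ext ?_
  rw [insert_val h0]

/-- Mecke's formula as an identity of measures, so that it passes to real-valued integrands without
an integrability hypothesis. -/
lemma withDensity_poissonProduct (x : Fin N) :
    (poissonProduct h0 r).withDensity (fun η => ((η.1 x : ℝ≥0) : ℝ≥0∞))
      = (r x : ℝ≥0∞) • (poissonProduct h0 r).map fun η => insert η x := by
  refine Measure.ext fun s hs => ?_
  rw [withDensity_apply _ hs, ← lintegral_indicator hs, Measure.smul_apply,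
    Measure.map_apply Measurable.of_discrete hs,
    ← lintegral_indicator_one (Measurable.of_discrete hs), smul_eq_mul]
  have := lintegral_poissonProduct h0 r x (s.indicator 1)
  refine Eq.trans (lintegral_congr fun η => ?_) (this.trans ?_)
  · by_cases h : η ∈ s <;> simp [h]
  · rfl

lemma integral_poissonProduct (x : Fin N) (G : S.Config → ℝ) :
    ∫ η, (η.1 x : ℝ) * G η ∂(poissonProduct h0 r)
      = r x * ∫ η, G (insert η x) ∂(poissonProduct h0 r) := by
  have h1 := integral_withDensity_eq_integral_smul (μ := poissonProduct h0 r)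
    (f := fun η : S.Config => (η.1 x : ℝ≥0)) Measurable.of_discrete G
  rw [withDensity_poissonProduct, integral_smul_measure,
    integral_map Measurable.of_discrete.aemeasurable
      Measurable.of_discrete.aestronglyMeasurable] at h1
  simpa [NNReal.smul_def] using h1.symm

lemma integrable_coord_poissonProduct (x : Fin N) :
    Integrable (fun η : S.Config => (η.1 x : ℝ)) (poissonProduct h0 r) := by
  refine ⟨Measurable.of_discrete.aestronglyMeasurable, ?_⟩
  rw [hasFiniteIntegral_iff_ofReal (ae_of_all _ fun _ => Nat.cast_nonneg _)]
  have := lintegral_poissonProduct h0 r x 1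
  simp only [Pi.one_apply, mul_one, lintegral_const, measure_univ] at this
  simp [this]

lemma integrable_rate_poissonProduct (m : Move N) :
    Integrable (S.rate m) (poissonProduct h0 r) := by
  have hσ : (S.σ : ℝ) = 0 := by simp [h0]
  rcases m with ⟨x, y⟩ | ⟨b, _ | _⟩
  · have e : S.rate (.inl (x, y)) = fun η : S.Config => (S.ω x y * S.α y) * (η.1 x : ℝ) := by
      funext η; simp only [rate, hσ]; ring
    rw [e]
    exact (integrable_coord_poissonProduct h0 r x).const_mul _
  · have e : S.rate (.inr (b, false))
        = fun _ : S.Config => S.resRate b * S.resDensity b * S.α (S.resSite b) := by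
      funext η; simp only [rate, hσ]; ring
    rw [e]
    exact integrable_const _
  · have e : S.rate (.inr (b, true))
        = fun η : S.Config => S.resRate b * (η.1 (S.resSite b) : ℝ) := by
      funext η; simp only [rate, hσ]; ring
    rw [e]
    exact (integrable_coord_poissonProduct h0 r _).const_mul _

lemma integral_gen_poissonProduct {θ : Fin N → ℝ} (hθ : S.SolvesProfileEquations θ)
    (hr : ∀ x, (r x : ℝ) = S.α x * θ x) {g : S.Config → ℝ} {M : ℝ} (hg : ∀ η, |g η| ≤ M) :
    ∫ η, S.gen g η ∂(poissonProduct h0 r) = 0 := by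
  set π := poissonProduct h0 r with hπ
  have hσ : (S.σ : ℝ) = 0 := by simp [h0]
  have hgi : ∀ T : S.Config → S.Config, Integrable (fun η => g (T η)) π := fun T =>
    S.integrable_of_bound π fun η => hg (T η)
  have hG : ∀ m η, |g (target m η) - g η| ≤ 2 * M := fun m η => by
    refine (abs_sub _ _).trans ?_
    linarith [hg (target m η), hg η]
  -- Every move integrates to a linear expression in `J`: a hop gives `J y - J x`, a removal `-J x`,
  -- an insertion `J x`.
  set J : Fin N → ℝ := fun x => ∫ η, g (insert η x) ∂π - ∫ η, g η ∂π with hJ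
  have hhop : ∀ x y, ∫ η, S.rate (.inl (x, y)) η * (g (target (.inl (x, y)) η) - g η) ∂π
      = S.ω x y * S.α y * S.α x * (θ x * (J y - J x)) := by
    intro x y
    have e : ∀ η : S.Config, S.rate (.inl (x, y)) η * (g (target (.inl (x, y)) η) - g η)
        = S.ω x y * S.α y * (η.1 x * (g (hop η x y) - g η)) := by
      intro η; simp only [rate, target, hσ]; ring
    simp only [e]
    rw [integral_const_mul, integral_poissonProduct h0 r x fun η => g (hop η x y) - g η]
    simp only [hop_insert h0]
    rw [integral_sub (hgi _) (hgi _), hr, hJ]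
    ring
  have hrem : ∀ b, ∫ η, S.rate (.inr (b, true)) η * (g (target (.inr (b, true)) η) - g η) ∂π
      = -(S.resRate b * S.α (S.resSite b) * (θ (S.resSite b) * J (S.resSite b))) := by
    intro b
    have e : ∀ η : S.Config, S.rate (.inr (b, true)) η * (g (target (.inr (b, true)) η) - g η)
        = S.resRate b * (η.1 (S.resSite b) * (g (remove η (S.resSite b)) - g η)) := by
      intro η; simp only [rate, target, hσ]; ring
    simp only [e]
    rw [integral_const_mul,
      integral_poissonProduct h0 r _ fun η => g (remove η (S.resSite b)) - g η]
    simp only [remove_insert h0]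
    rw [integral_sub (hgi fun η => η) (hgi _), hr, hJ]
    ring
  have hins : ∀ b, ∫ η, S.rate (.inr (b, false)) η * (g (target (.inr (b, false)) η) - g η) ∂π
      = S.resRate b * S.α (S.resSite b) * (S.resDensity b * J (S.resSite b)) := by
    intro b
    have e : ∀ η : S.Config, S.rate (.inr (b, false)) η * (g (target (.inr (b, false)) η) - g η)
        = S.resRate b * S.resDensity b * S.α (S.resSite b)
          * (g (insert η (S.resSite b)) - g η) := by
      intro η; simp only [rate, target, hσ]; ring
    simp only [e]
    rw [integral_const_mul, integral_sub (hgi _) (hgi fun η => η), hJ]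
    ring
  have hint : ∀ m, Integrable (fun η => S.rate m η * (g (target m η) - g η)) π := by
    intro m
    exact (integrable_rate_poissonProduct h0 r m).mul_bdd (c := 2 * M)
      Measurable.of_discrete.aestronglyMeasurable (ae_of_all _ (hG m))
  simp only [gen_eq_sum]
  rw [integral_finsetSum _ fun m _ => hint m, sum_moves]
  simp only [hhop, hrem, hins]
  -- Summation by parts using the symmetry of `ω`: the coefficient of `α x * J x` becomes the bulk
  -- part of the profile equation at `x`.
  have hswap : ∑ x, ∑ y, S.ω x y * S.α y * S.α x * (θ x * (J y - J x))
      = ∑ x, S.α x * J x * ∑ y, S.ω x y * S.α y * (θ y - θ x) := by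
    simp only [mul_sub, Finset.sum_sub_distrib, Finset.mul_sum]
    congr 1
    · rw [Finset.sum_comm]
      refine Finset.sum_congr rfl fun x _ => Finset.sum_congr rfl fun y _ => ?_
      rw [S.ω_symm]; ring
    · exact Finset.sum_congr rfl fun x _ => Finset.sum_congr rfl fun y _ => by ring
  have hres : ∑ b, (-(S.resRate b * S.α (S.resSite b) * (θ (S.resSite b) * J (S.resSite b)))
        + S.resRate b * S.α (S.resSite b) * (S.resDensity b * J (S.resSite b)))
      = ∑ x, S.α x * J x
        * ∑ b, (if x = S.resSite b then S.resRate b * (S.resDensity b - θ x) else 0) := by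
    simp only [Finset.mul_sum]
    rw [Finset.sum_comm]
    refine Finset.sum_congr rfl fun b _ => ?_
    simp only [mul_ite, mul_zero, Finset.sum_ite_eq', Finset.mem_univ, if_true]
    ring
  rw [hswap, hres, ← Finset.sum_add_distrib]
  refine Finset.sum_eq_zero fun x _ => ?_
  rw [← mul_add, sum_reservoirs_eq, ← add_assoc, hθ x, mul_zero]

theorem poissonProduct_isStationary {V : S.Config → ℝ} {c K : ℝ} (hV : S.IsLyapunov V c K)
    {θ : Fin N → ℝ} (hθ : S.SolvesProfileEquations θ) (hr : ∀ x, (r x : ℝ) = S.α x * θ x) :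
    S.IsStationary (poissonProduct h0 r) := by
  refine hV.isStationary_of_integral_gen _ ?_ fun g ⟨M, hM⟩ =>
    integral_gen_poissonProduct h0 r hθ hr hM
  have hi : Integrable S.totalRate (poissonProduct h0 r) :=
    integrable_finsetSum _ fun m _ => integrable_rate_poissonProduct h0 r m
  refine hi.mono' Measurable.of_discrete.aestronglyMeasurable (ae_of_all _ fun η => ?_)
  rw [Real.norm_of_nonneg (S.exitRate_nonneg η)]
  exact S.exitRate_le_totalRate η

end BoundaryDrivenSystem

end

/-! ### Assembly of the ergodic, Poisson and correlation statements. -/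

theorem mainTheorem4 {N : ℕ} (S : BoundaryDrivenSystem N) (hω : 0 < max S.ωL S.ωR) :
    ∃ μ : Measure S.Config,
      -- `μ` is the unique stationary measure, and attracts every initial distribution
      S.IsStationary μ ∧
      (∀ μ' : Measure S.Config, S.IsStationary μ' → μ' = μ) ∧
      S.AttractsAll μ ∧
      -- the stationary profile is well defined and solves the difference equations
      (∀ x, Integrable (fun η : S.Config => (η.1 x : ℝ) / S.α x) μ) ∧
      S.SolvesProfileEquations (S.profile μ) ∧
      -- IRW
      (S.σ = 0 →
        S.IsProductOf μ (fun x => poissonMeasure (S.α x * S.profile μ x).toNNReal)) ∧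
      -- SEP and SIP out of equilibrium
      ((S.σ = -1 ∨ S.σ = 1) → 0 < S.ωL → 0 < S.ωR → S.θL ≠ S.θR → 2 ≤ N →
        (∃ x y : Fin N, x ≠ y ∧
          Integrable (fun η : S.Config =>
            ((η.1 x : ℝ) / S.α x - S.profile μ x) * ((η.1 y : ℝ) / S.α y - S.profile μ y)) μ ∧
          ∫ η, ((η.1 x : ℝ) / S.α x - S.profile μ x)
            * ((η.1 y : ℝ) / S.α y - S.profile μ y) ∂μ ≠ 0) ∧
        ¬ ∃ ν : Fin N → Measure ℕ, (∀ x, IsProbabilityMeasure (ν x)) ∧ S.IsProductOf μ ν) := by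
  obtain ⟨V, c, K, a, hV, ha, haV⟩ := BoundaryDrivenSystem.exists_isLyapunov hω
  obtain ⟨o, ho⟩ := BoundaryDrivenSystem.exists_accessible hω
  obtain ⟨μ, hμ, hatt, hVμ⟩ := hV.exists_attracting fun η => ho η 1 one_pos
  have hprob : IsProbabilityMeasure μ := hμ.1
  have huniq : ∀ μ' : Measure S.Config, S.IsStationary μ' → μ' = μ := fun μ' h =>
    hμ.eq_of_attractsAll hatt h
  have hI : Integrable (fun η : S.Config => (BoundaryDrivenSystem.size η : ℝ) ^ 3) μ := by
    refine (hVμ.const_mul a⁻¹).mono' Measurable.of_discrete.aestronglyMeasurable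
      (ae_of_all _ fun η => ?_)
    rw [Real.norm_of_nonneg (by positivity), inv_mul_eq_div, le_div_iff₀' ha]
    exact haV η
  have hprofile := BoundaryDrivenSystem.solvesProfileEquations_profile hI hV hμ
  refine ⟨μ, hμ, huniq, hatt,
    fun x => (BoundaryDrivenSystem.integrable_coord hI x).div_const _, hprofile,
    fun hσ => ?_, fun hσ hL hR hθ hN => ?_⟩
  -- The Poisson parameters come from the profile of `μ` itself, which is nonnegative and already
  -- known to solve the equations. The product is then stationary, and uniqueness makes it equal to
  -- `μ`.
  · have hr : ∀ x, (((S.α x * S.profile μ x).toNNReal : ℝ≥0) : ℝ) = S.α x * S.profile μ x :=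
      fun x => Real.coe_toNNReal _ (mul_nonneg (Nat.cast_nonneg _)
        (integral_nonneg fun η => div_nonneg (Nat.cast_nonneg _) (Nat.cast_nonneg _)))
    have h := BoundaryDrivenSystem.poissonProduct_isProductOf hσ
      fun x => (S.α x * S.profile μ x).toNNReal
    rwa [huniq _ (BoundaryDrivenSystem.poissonProduct_isStationary hσ _ hV hprofile hr)] at h
  · have hσ0 : S.σ ≠ 0 := by
      rcases hσ with h | h <;> simp [h]
    obtain ⟨x, y, hxy, hne⟩ :=
      BoundaryDrivenSystem.exists_correlated hI hV hμ hσ0 hL hR hθ hN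
    refine ⟨⟨x, y, hxy, BoundaryDrivenSystem.integrable_centered_mul hI x y, ?_⟩, ?_⟩
    · rw [BoundaryDrivenSystem.integral_centered_mul hI]
      exact div_ne_zero (sub_ne_zero.2 hne)
        (mul_ne_zero (Nat.cast_ne_zero.2 (S.α_pos x).ne') (Nat.cast_ne_zero.2 (S.α_pos y).ne'))
    · rintro ⟨ρ, hρ, h⟩
      exact hne (BoundaryDrivenSystem.integral_coord_mul_of_isProductOf h hxy)
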